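/- \textbf{Setting.} Let $\sigma,\varphi:\mathbb R\to\mathbb R$ be (fixed) Lipschitz functions, $\gamma>0$ and $d\in\mathbb N$ fixed. For each $n$ let $p=p(n)$, $T=T(n)$ be integers, $X=X_n\in\mathbb R^{p\times T}$ and $Y=Y_n\in\mathbb R^{d\times T}$ deterministic matrices, with, as $n\to\infty$, $$0<\liminf_n\min\{p/n,T/n\}\le\limsup_n\max\{p/n,T/n\}<\infty,\qquad \limsup_n\|X\|<\infty,\qquad \limsup_n\max_{i,j}|Y_{ij}|<\infty,$$ where $\|\cdot\|$ is the operator norm. On a probability space let, for every $n$, $\tilde W=\tilde W_n\in\mathbb R^{n\times p}$ have i.i.d. $\mathcal N(0,1)$ entries (with arbitrary dependence between different $n$), and put $W=\varphi(\tilde W)$ and $\Sigma=\sigma(WX)\in\mathbb R^{n\times T}$, both entrywise. Let $$Q=\Big(\tfrac1T\Sigma^{\mathsf T}\Sigma+\gamma I_T\Big)^{-1},\qquad \beta=\tfrac1T\Sigma QY^{\mathsf T},\qquad E_{\rm train}=\tfrac1T\big\|Y^{\mathsf T}-\Sigma^{\mathsf T}\beta\big\|_F^2 .$$ Let $\Phi=\mathbb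 E[\sigma(w^{\mathsf T}X)^{\mathsf T}\sigma(w^{\mathsf T}X)]\in\mathbb R^{T\times T}$ where $w=\varphi(b)$ entrywise, $b\sim\mathcal N(0,I_p)$. For $\delta\ge0$ put $$\Psi=\frac nT\frac{\Phi}{1+\delta},\qquad \bar Q=(\Psi+\gamma I_T)^{-1}.$$ \textbf{Theorem (asymptotic training mean-square error).} For every $n$ one has $E_{\rm train}=\frac{\gamma^2}T\operatorname{tr}Y^{\mathsf T}YQ^2$, and the equation $\delta=\frac1T\operatorname{tr}\Phi\bar Q$ has a unique solution $\delta\ge0$ (which is positive unless $\Phi=0$). With $\Psi,\bar Q$ taken at this $\delta=\delta_n$ and $$\bar E_{\rm train}=\frac{\gamma^2}T\operatorname{tr}\,Y^{\mathsf T}Y\bar Q\left[\frac{\frac1n\operatorname{tr}\Psi\bar Q^2}{1-\frac1n\operatorname{tr}(\Psi\bar Q)^2}\,\Psi+I_T\right]\bar Q,$$ for every $\varepsilon>0$, almost surely, $$n^{\frac12-\varepsilon}\big(E_{\rm train}-\bar E_{\rm train}\big)\longrightarrow0\qquad(n\to\infty).$$ -/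

import Mathlib

open Filter Topology MeasureTheory ProbabilityTheory
open scoped ENNReal NNReal Matrix

namespace RandomFeatures

noncomputable section

/-- The operator norm of a real matrix for the Euclidean norms. -/
def opNorm {m k : ℕ} (A : Matrix (Fin m) (Fin k) ℝ) : ℝ :=
  open scoped Matrix.Norms.L2Operator in ‖A‖

/-- The Frobenius norm of a real matrix. -/
def frobNorm {m k : ℕ} (A : Matrix (Fin m) (Fin k) ℝ) : ℝ :=
  open scoped Matrix.Norms.Frobenius in ‖A‖

/-- The law `N_φ(0, I_p)` of the vector `φ(b)` (entrywise) for `b` standard Gaussian in `ℝ^p`. -/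
def lawNφ (φ : ℝ → ℝ) (p : ℕ) : Measure (Fin p → ℝ) :=
  (Measure.pi fun _ : Fin p => gaussianReal 0 1).map fun b k => φ (b k)

/-- The matrix of random features: `σ(W X)`, with `σ` applied entrywise. -/
def features {n p T : ℕ} (σ : ℝ → ℝ) (W : Matrix (Fin n) (Fin p) ℝ)
    (X : Matrix (Fin p) (Fin T) ℝ) : Matrix (Fin n) (Fin T) ℝ :=
  (W * X).map σ

/-- The resolvent `Q = ((1/T) Sᵀ S + γ I_T)⁻¹`. -/
def resolvent {n T : ℕ} (γ : ℝ) (S : Matrix (Fin n) (Fin T) ℝ) : Matrix (Fin T) (Fin T) ℝ :=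
  ((1 / (T : ℝ)) • (Sᵀ * S) + γ • (1 : Matrix (Fin T) (Fin T) ℝ))⁻¹

/-- The ridge regressor `β = (1/T) S Q Yᵀ`. -/
def ridge {n T d : ℕ} (γ : ℝ) (S : Matrix (Fin n) (Fin T) ℝ) (Y : Matrix (Fin d) (Fin T) ℝ) :
    Matrix (Fin n) (Fin d) ℝ :=
  (1 / (T : ℝ)) • (S * resolvent γ S * Yᵀ)

/-- The training mean-square error `(1/T) ‖Yᵀ - Sᵀ β‖_F²`. -/
def trainError {n T d : ℕ} (γ : ℝ) (S : Matrix (Fin n) (Fin T) ℝ)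
    (Y : Matrix (Fin d) (Fin T) ℝ) : ℝ :=
  (1 / (T : ℝ)) * frobNorm (Yᵀ - Sᵀ * ridge γ S Y) ^ 2

/-- The matrix `Φ = E[σ(wᵀX)ᵀ σ(wᵀX)]` with `w ∼ N_φ(0, I_p)`. -/
def Phi {p T : ℕ} (σ φ : ℝ → ℝ) (X : Matrix (Fin p) (Fin T) ℝ) : Matrix (Fin T) (Fin T) ℝ :=
  Matrix.of fun i j => ∫ w, σ ((w ᵥ* X) i) * σ ((w ᵥ* X) j) ∂(lawNφ φ p)

/-- `Ψ = (n/T) Φ/(1+δ)`. -/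
def Psi {T : ℕ} (n : ℕ) (Φ : Matrix (Fin T) (Fin T) ℝ) (δ : ℝ) : Matrix (Fin T) (Fin T) ℝ :=
  ((n : ℝ) / (T : ℝ) / (1 + δ)) • Φ

/-- `Q̄ = ((n/T) Φ/(1+δ) + γ I_T)⁻¹`. -/
def Qbar {T : ℕ} (n : ℕ) (γ : ℝ) (Φ : Matrix (Fin T) (Fin T) ℝ) (δ : ℝ) :
    Matrix (Fin T) (Fin T) ℝ :=
  (Psi n Φ δ + γ • (1 : Matrix (Fin T) (Fin T) ℝ))⁻¹

/-- `δ` is a nonnegative solution of `δ = (1/T) tr (Φ Q̄)`. It is then positive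
unless `Φ = 0`, in which case it is `0`. -/
def IsDelta {T : ℕ} (n : ℕ) (γ : ℝ) (Φ : Matrix (Fin T) (Fin T) ℝ) (δ : ℝ) : Prop :=
  0 ≤ δ ∧ δ = (1 / (T : ℝ)) * (Φ * Qbar n γ Φ δ).trace

/-- The deterministic equivalent
`(γ²/T) tr YᵀY Q̄ [ ((1/n) tr ΨQ̄² / (1 - (1/n) tr (ΨQ̄)²)) Ψ + I_T ] Q̄`. -/
def trainErrorBar {T d : ℕ} (n : ℕ) (γ : ℝ) (Φ : Matrix (Fin T) (Fin T) ℝ) (δ : ℝ)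
    (Y : Matrix (Fin d) (Fin T) ℝ) : ℝ :=
  let Q := Qbar n γ Φ δ
  let Ψ := Psi n Φ δ
  (γ ^ 2 / (T : ℝ)) * (Yᵀ * Y * Q *
    ((((1 / (n : ℝ)) * (Ψ * Q ^ 2).trace) / (1 - (1 / (n : ℝ)) * ((Ψ * Q) ^ 2).trace)) • Ψ
      + (1 : Matrix (Fin T) (Fin T) ℝ)) * Q).trace

/-- The growth conditions on the dimensions and the data, in the regime `n → ∞`. -/
structure GrowthRate {d : ℕ} (p T : ℕ → ℕ) (X : ∀ n, Matrix (Fin (p n)) (Fin (T n)) ℝ)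
    (Y : ∀ n, Matrix (Fin d) (Fin (T n)) ℝ) : Prop where
  liminf_pos : 0 < liminf
    (fun n : ℕ => min ((p n : ℝ≥0∞) / (n : ℝ≥0∞)) ((T n : ℝ≥0∞) / (n : ℝ≥0∞))) atTop
  limsup_lt_top : limsup
    (fun n : ℕ => max ((p n : ℝ≥0∞) / (n : ℝ≥0∞)) ((T n : ℝ≥0∞) / (n : ℝ≥0∞))) atTop < ∞
  limsup_X : limsup (fun n : ℕ => ENNReal.ofReal (opNorm (X n))) atTop < ∞
  limsup_Y : limsup (fun n : ℕ => ⨆ i, ⨆ j, ENNReal.ofReal |Y n i j|) atTop < ∞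

end

end RandomFeatures

/-! The residual of the ridge regression is `γ Q Yᵀ`, so the training error is `γ²/T` times the sum
over the `d` rows `y` of `Y` of the forms `yᵀ Q² y`. It is split into its fluctuation about its mean
and the bias of that mean. Every even moment of order `2k` of the total error is `O(n^{-k})`; a
large `k` and a summation over `n` give the almost sure rate, with no relation needed between
different `n`.

Fluctuation. The feature matrix is a Lipschitz image of a Gaussian vector, with a constant free of
the dimension, so the Maurey–Pisier argument controls all even central moments of its Lipschitz
functions (`conc_map_pi_gaussian`). The Gram matrix is quadratic in the features, but `Σ Q` has norm
at most `√(T/γ)`, so `Q` is Lipschitz in the features with constant of order `T^{-1/2}`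
(`abs_resolvent_sub_le`); the training error inherits this (`abs_trainError_sub_le`).

Bias. One row `s` is singled out, and `Q₋` is the resolvent of the others. Sherman–Morrison gives
`sᵀQx = sᵀQ₋x / (1 + sᵀQ₋s/T)`, and `sᵀQ₋s/T` concentrates about its mean `α`. Replacing it by `α`
turns the resolvent identity into the one that defines `Q̄` at parameter `α`
(`HasMomentBounds.abs_integral_fullRes_sub_le`). Tested against `s` itself, this says that `α`
nearly solves the fixed-point equation; the map `deltaMap` contracts towards a solution `δ` with
ratio `δ/(1+δ)`, so `α` is near `δ` (`IsDelta.abs_sub_le`).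

For `Q²` the same expansion produces the mean `b` of `sᵀQ₋²s/T`
(`HasMomentBounds.abs_integral_fullRes_sq_sub_equivalent_le`), which nearly solves the scalar
equation `b = t1 + b t2` with `t1 = tr(ΦQ̄²)/T` and `t2 = tr((ΨQ̄)²)/n`. Since `1 - t2 ≥ 1/(1+δ)`,
`b/(1+δ)` is close to the fraction in the deterministic equivalent.

A difficulty is that the mean of a row may have norm of order `√T`, so `Φ` is not bounded in
operator norm. The second moment of `sᵀQx` comes instead from exchangeability of the rows and the
deterministic inequality `(1/T) ∑ᵢ (sᵢᵀQx)² ≤ ‖x‖²/γ`; that of `sᵀQ̄u` comes from the bound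
`(Q̄u)ᵀΨ(Q̄u) ≤ ‖u‖²/γ`. -/

namespace RandomFeatures

/-! ### Gaussian concentration: the Maurey–Pisier inequality and even central moments. -/

section GaussianConcentration

variable {E : Type*} [NormedAddCommGroup E] [InnerProductSpace ℝ E] [FiniteDimensional ℝ E]
  [MeasurableSpace E] [BorelSpace E]

theorem lintegral_exp_dual_stdGaussian (l : StrongDual ℝ E) (c : ℝ) :
    ∫⁻ x, ENNReal.ofReal (Real.exp (c * l x)) ∂(stdGaussian E)
      = ENNReal.ofReal (Real.exp (‖l‖ ^ 2 * c ^ 2 / 2)) := by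
  have hmap : (stdGaussian E).map l = gaussianReal 0 (Real.toNNReal (‖l‖ ^ 2)) := by
    rw [IsGaussian.map_eq_gaussianReal, integral_strongDual_stdGaussian, variance_dual_stdGaussian]
  have h := mgf_gaussianReal hmap c
  rw [zero_mul, zero_add, Real.coe_toNNReal _ (by positivity)] at h
  rw [← h, mgf, ofReal_integral_eq_lintegral_ofReal]
  · have h1 := integrable_exp_mul_gaussianReal (μ := 0) (v := Real.toNNReal (‖l‖ ^ 2)) c
    rw [← hmap, integrable_map_measure (by fun_prop) (by fun_prop)] at h1
    exact h1
  · exact Eventually.of_forall fun x => (Real.exp_pos _).le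

theorem hasDerivAt_rotation_path {E : Type*} [NormedAddCommGroup E] [InnerProductSpace ℝ E]
    (F : E → ℝ) (hF : ContDiff ℝ 1 F) (x y : E) (θ : ℝ) :
    HasDerivAt (fun θ : ℝ => F (Real.cos θ • x + Real.sin θ • y))
      (fderiv ℝ F (Real.cos θ • x + Real.sin θ • y) (-Real.sin θ • x + Real.cos θ • y)) θ := by
  have h1 : HasFDerivAt F (fderiv ℝ F (Real.cos θ • x + Real.sin θ • y))
      (Real.cos θ • x + Real.sin θ • y) :=
    (hF.differentiable (by norm_num) _).hasFDerivAt
  have h2 : HasDerivAt (fun θ : ℝ => Real.cos θ • x + Real.sin θ • y)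
      (-Real.sin θ • x + Real.cos θ • y) θ :=
    ((Real.hasDerivAt_cos θ).smul_const x).add ((Real.hasDerivAt_sin θ).smul_const y)
  exact h1.comp_hasDerivAt θ h2

/-- The Maurey–Pisier inequality for continuously differentiable functions. -/
theorem lintegral_exp_sub_le_of_contDiff (F : E → ℝ) (hF : ContDiff ℝ 1 F)
    (hL : ∀ x, ‖fderiv ℝ F x‖ ≤ 1) :
    ∫⁻ z, ENNReal.ofReal (Real.exp (F z.2 - F z.1)) ∂((stdGaussian E).prod (stdGaussian E))
      ≤ ENNReal.ofReal (Real.exp (Real.pi ^ 2 / 8)) := by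
  -- `ρ` is the uniform law on `[0, π/2]`. Normalizing it puts the factor `π/2` in the velocity `g`,
  -- and `(π/2)²/2` is the exponent `π²/8`.
  set ρ : Measure ℝ := ENNReal.ofReal (2 / Real.pi) • volume.restrict (Set.Ioc 0 (Real.pi / 2))
  have hρ : IsProbabilityMeasure ρ := ⟨by
    simp only [ρ, Measure.smul_apply, Measure.restrict_apply MeasurableSet.univ, Set.univ_inter,
      Real.volume_Ioc, smul_eq_mul, sub_zero]
    rw [← ENNReal.ofReal_mul (by positivity)]
    rw [show 2 / Real.pi * (Real.pi / 2) = 1 by field_simp]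
    simp⟩
  obtain ⟨g, hg⟩ : ∃ g : (E × E) → ℝ → ℝ, g = fun z θ => Real.pi / 2 *
    fderiv ℝ F (Real.cos θ • z.1 + Real.sin θ • z.2) (-Real.sin θ • z.1 + Real.cos θ • z.2) :=
    ⟨_, rfl⟩
  have hdF : Continuous (fderiv ℝ F) := hF.continuous_fderiv (by norm_num)
  have hgc : Continuous (Function.uncurry g) := by
    simp only [hg, Function.uncurry_def]
    fun_prop
  have hint : ∀ f : ℝ → ℝ, Continuous f → Integrable f ρ := fun f hf =>
    Integrable.smul_measure (hf.integrableOn_Ioc (a := 0) (b := Real.pi / 2)) ENNReal.ofReal_ne_top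
  have hpt : ∀ z : E × E, ENNReal.ofReal (Real.exp (F z.2 - F z.1)) ≤
      ∫⁻ θ, ENNReal.ofReal (Real.exp (g z θ)) ∂ρ := by
    intro z
    have hgz : Continuous (g z) := hgc.uncurry_left z
    have h1 : F z.2 - F z.1 = ∫ θ, g z θ ∂ρ := by
      have := intervalIntegral.integral_eq_sub_of_hasDerivAt (a := 0) (b := Real.pi / 2)
        (fun θ _ => hasDerivAt_rotation_path F hF z.1 z.2 θ)
        (Continuous.intervalIntegrable (by fun_prop) _ _)
      simp only [Real.cos_pi_div_two, Real.sin_pi_div_two, Real.cos_zero, Real.sin_zero, zero_smul,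
        one_smul, zero_add, add_zero] at this
      rw [← this, intervalIntegral.integral_of_le (by positivity), integral_smul_measure,
        ENNReal.toReal_ofReal (by positivity)]
      simp only [hg]
      rw [integral_const_mul, smul_eq_mul, ← mul_assoc,
        show 2 / Real.pi * (Real.pi / 2) = 1 by field_simp, one_mul]
    have h2 : Real.exp (∫ θ, g z θ ∂ρ) ≤ ∫ θ, Real.exp (g z θ) ∂ρ :=
      convexOn_exp.map_integral_le Real.continuousOn_exp isClosed_univ (by simp)
        (hint _ hgz) (hint _ (by exact Real.continuous_exp.comp hgz))
    rw [h1, ← ofReal_integral_eq_lintegral_ofReal (hint _ (by fun_prop))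
      (Eventually.of_forall fun x => (Real.exp_pos _).le)]
    exact ENNReal.ofReal_le_ofReal h2
  have hrot : ∀ θ : ℝ, ∫⁻ z, ENNReal.ofReal (Real.exp (g z θ))
      ∂((stdGaussian E).prod (stdGaussian E)) ≤ ENNReal.ofReal (Real.exp (Real.pi ^ 2 / 8)) := by
    intro θ
    -- The rotation of angle `θ` preserves the product law, so the position on the path and its
    -- velocity are again independent standard Gaussians. With the position frozen, `g` is a linear
    -- form of norm at most `π/2` in a Gaussian vector.
    have hmp := IsGaussian.map_rotation_eq_self (μ := stdGaussian E) (by simp) θ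
    have hm : Measurable fun z : E × E =>
        ENNReal.ofReal (Real.exp (Real.pi / 2 * fderiv ℝ F z.1 z.2)) := by
      refine ENNReal.measurable_ofReal.comp (Continuous.measurable ?_)
      fun_prop
    have : ∫⁻ z, ENNReal.ofReal (Real.exp (g z θ)) ∂((stdGaussian E).prod (stdGaussian E))
        = ∫⁻ z, ENNReal.ofReal (Real.exp (Real.pi / 2 * fderiv ℝ F z.1 z.2))
          ∂((stdGaussian E).prod (stdGaussian E)) := by
      conv_rhs => rw [← hmp]
      rw [lintegral_map hm (by fun_prop)]
      simp only [hg]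
      rfl
    rw [this, lintegral_prod _ hm.aemeasurable]
    calc _ ≤ ∫⁻ x, ENNReal.ofReal (Real.exp (Real.pi ^ 2 / 8)) ∂(stdGaussian E) := by
          refine lintegral_mono fun x => ?_
          refine (lintegral_exp_dual_stdGaussian (fderiv ℝ F x) (Real.pi / 2)).trans_le ?_
          refine ENNReal.ofReal_le_ofReal (Real.exp_le_exp.2 ?_)
          have h0 := hL x
          have : ‖fderiv ℝ F x‖ ^ 2 ≤ 1 := pow_le_one₀ (norm_nonneg _) h0
          have := mul_le_mul_of_nonneg_right this (show 0 ≤ Real.pi ^ 2 / 8 by positivity)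
          nlinarith
      _ = _ := by simp
  calc _ ≤ ∫⁻ z, ∫⁻ θ, ENNReal.ofReal (Real.exp (g z θ)) ∂ρ
        ∂((stdGaussian E).prod (stdGaussian E)) := lintegral_mono hpt
    _ = ∫⁻ θ, ∫⁻ z, ENNReal.ofReal (Real.exp (g z θ)) ∂((stdGaussian E).prod (stdGaussian E)) ∂ρ := by
        refine lintegral_lintegral_swap (Measurable.aemeasurable ?_)
        refine ENNReal.measurable_ofReal.comp (Continuous.measurable ?_)
        exact Real.continuous_exp.comp hgc
    _ ≤ ∫⁻ θ, ENNReal.ofReal (Real.exp (Real.pi ^ 2 / 8)) ∂ρ := lintegral_mono hrot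
    _ = _ := by simp

/-- The Maurey–Pisier inequality for Lipschitz functions. -/
theorem lintegral_exp_sub_le_of_lipschitz (F : E → ℝ) (hF : LipschitzWith 1 F) :
    ∫⁻ z, ENNReal.ofReal (Real.exp (F z.2 - F z.1)) ∂((stdGaussian E).prod (stdGaussian E))
      ≤ ENNReal.ofReal (Real.exp (Real.pi ^ 2 / 8 + 2)) := by
  -- Mollifying at scale 1 keeps the Lipschitz constant and moves `F` by at most 1. The difference
  -- of two values then moves by at most 2, whence the extra `e²`.
  let φ : ContDiffBump (0 : E) := ⟨1 / 2, 1, by norm_num, by norm_num⟩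
  let G : E → ℝ := MeasureTheory.convolution (φ.normed volume) F (ContinuousLinearMap.lsmul ℝ ℝ)
    volume
  have hFc : Continuous F := hF.continuous
  have hGC : ContDiff ℝ 1 G := φ.hasCompactSupport_normed.contDiff_convolution_left
    (n := 1) _ φ.contDiff_normed hFc.locallyIntegrable
  have hclose : ∀ x, |G x - F x| ≤ 1 := by
    intro x
    rw [← Real.dist_eq]
    refine φ.dist_normed_convolution_le hFc.aestronglyMeasurable fun y hy => ?_
    refine (hF.dist_le_mul y x).trans ?_
    rw [Metric.mem_ball] at hy
    simpa using hy.le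
  have hconv : ∀ x, MeasureTheory.ConvolutionExistsAt (φ.normed volume) F x
      (ContinuousLinearMap.lsmul ℝ ℝ) volume := fun x =>
    φ.hasCompactSupport_normed.convolutionExists_left _ φ.continuous_normed
      hFc.locallyIntegrable x
  have hGL : LipschitzWith 1 G := by
    refine LipschitzWith.of_dist_le_mul fun x y => ?_
    simp only [NNReal.coe_one, one_mul]
    have hx := (hconv x).integrable
    have hy := (hconv y).integrable
    simp only [ContinuousLinearMap.lsmul_apply, smul_eq_mul] at hx hy
    have e : G x - G y = ∫ t, φ.normed volume t * (F (x - t) - F (y - t)) := by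
      simp only [mul_sub]
      rw [integral_sub hx hy]
      rfl
    rw [Real.dist_eq, e]
    have hn : Integrable (φ.normed volume) (volume : Measure E) := φ.integrable_normed
    calc _ ≤ ∫ t, φ.normed volume t * dist x y := by
          rw [← Real.norm_eq_abs]
          refine norm_integral_le_of_norm_le (hn.mul_const _) (Eventually.of_forall fun t => ?_)
          rw [norm_mul, Real.norm_of_nonneg (φ.nonneg_normed t)]
          refine mul_le_mul_of_nonneg_left ?_ (φ.nonneg_normed t)
          have := hF.dist_le_mul (x - t) (y - t)
          simpa [Real.dist_eq, dist_sub_right] using this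
      _ = dist x y := by
          rw [integral_mul_const, φ.integral_normed, one_mul]
  have hbound := lintegral_exp_sub_le_of_contDiff G hGC fun x => by
    simpa using norm_fderiv_le_of_lipschitz ℝ hGL (x₀ := x)
  calc _ ≤ ∫⁻ z, ENNReal.ofReal (Real.exp 2) * ENNReal.ofReal (Real.exp (G z.2 - G z.1))
        ∂((stdGaussian E).prod (stdGaussian E)) := by
        refine lintegral_mono fun z => ?_
        dsimp only
        rw [← ENNReal.ofReal_mul (Real.exp_pos _).le, ← Real.exp_add]
        refine ENNReal.ofReal_le_ofReal (Real.exp_le_exp.2 ?_)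
        have h1 := abs_le.1 (hclose z.1)
        have h2 := abs_le.1 (hclose z.2)
        linarith
    _ ≤ _ := by
        rw [lintegral_const_mul' _ _ ENNReal.ofReal_ne_top, add_comm, Real.exp_add,
          ENNReal.ofReal_mul (Real.exp_pos _).le]
        gcongr

/-- The constant in the even central moments of Lipschitz functions of a Gaussian vector. -/
noncomputable def momentConst (k : ℕ) : ℝ :=
  2 * (2 * k).factorial * Real.exp (Real.pi ^ 2 / 8 + 2)

theorem one_le_momentConst (k : ℕ) : 1 ≤ momentConst k := by
  have h1 : (1 : ℝ) ≤ (2 * k).factorial := by exact_mod_cast Nat.one_le_iff_ne_zero.2 (Nat.factorial_ne_zero _)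
  have h2 : 1 ≤ Real.exp (Real.pi ^ 2 / 8 + 2) := Real.one_le_exp (by positivity)
  unfold momentConst
  nlinarith

theorem momentConst_pos (k : ℕ) : 0 < momentConst k := zero_lt_one.trans_le (one_le_momentConst k)

theorem even_pow_le_factorial_mul_exp (k : ℕ) (t : ℝ) :
    t ^ (2 * k) ≤ (2 * k).factorial * (Real.exp t + Real.exp (-t)) := by
  have h := Real.pow_div_factorial_le_exp |t| (abs_nonneg t) (2 * k)
  rw [div_le_iff₀ (by positivity), pow_mul, sq_abs, ← pow_mul] at h
  refine h.trans ?_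
  rw [mul_comm]
  gcongr
  rcases abs_cases t with ⟨h, _⟩ | ⟨h, _⟩ <;> rw [h]
  · linarith [Real.exp_pos (-t)]
  · linarith [Real.exp_pos t]

/-- Symmetrization: the mean is an average over an independent copy, and Jensen's inequality for the
even power takes that average outside. -/
theorem integral_pow_sub_integral_le {S : Type*} [MeasurableSpace S] (μ : Measure S)
    [IsProbabilityMeasure μ] (f : S → ℝ) (k : ℕ) (hf : ∀ q : ℕ, MemLp f q μ) :
    ∫ x, (f x - ∫ y, f y ∂μ) ^ (2 * k) ∂μ ≤
      ∫ z, (f z.2 - f z.1) ^ (2 * k) ∂(μ.prod μ) := by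
  have hfi : Integrable f μ := (hf 1).integrable (by simp)
  have hpow : ∀ c, Integrable (fun x => (f x - c) ^ (2 * k)) μ := fun c => by
    have := ((hf (2 * k)).sub (memLp_const c)).integrable_norm_pow'
    refine this.congr (Eventually.of_forall fun x => ?_)
    simp [pow_mul, sq_abs]
  have hprod : Integrable (fun z : S × S => (f z.2 - f z.1) ^ (2 * k)) (μ.prod μ) := by
    have h2 : MemLp (fun z : S × S => f z.2) (2 * k : ℕ) (μ.prod μ) :=
      (hf (2 * k)).comp_measurePreserving measurePreserving_snd
    have h1 : MemLp (fun z : S × S => f z.1) (2 * k : ℕ) (μ.prod μ) :=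
      (hf (2 * k)).comp_measurePreserving measurePreserving_fst
    refine (h2.sub h1).integrable_norm_pow'.congr (Eventually.of_forall fun x => ?_)
    simp [pow_mul, sq_abs]
  rw [integral_prod_symm _ hprod]
  refine integral_mono (hpow _) hprod.swap.integral_prod_left fun x => ?_
  have hi : Integrable (fun y => f x - f y) μ := (integrable_const _).sub hfi
  have e : f x - ∫ y, f y ∂μ = ∫ y, (f x - f y) ∂μ := by
    rw [integral_sub (integrable_const _) hfi]; simp
  dsimp only
  rw [e]
  refine (even_two_mul k).convexOn_pow.map_integral_le (continuous_pow _).continuousOn isClosed_univ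
    (by simp) hi ?_
  refine (hpow (f x)).congr (Eventually.of_forall fun y => ?_)
  simp only [Function.comp_apply, pow_mul]
  congr 1; ring

theorem memLp_lipschitz_stdGaussian (F : E → ℝ) (L : ℝ≥0) (hF : LipschitzWith L F) (q : ℕ) :
    MemLp F q (stdGaussian E) := by
  have h : MemLp (fun x : E => x) (q : ℝ≥0∞) (stdGaussian E) :=
    IsGaussian.memLp_id (stdGaussian E) (q : ℝ≥0∞) (ENNReal.natCast_ne_top q)
  have h1 : MemLp (fun x : E => |F 0| + L * ‖x‖) q (stdGaussian E) :=
    (memLp_const |F 0|).add (h.norm.const_mul (L : ℝ))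
  refine h1.mono hF.continuous.aestronglyMeasurable (Eventually.of_forall fun x => ?_)
  have := hF.dist_le_mul x 0
  rw [Real.dist_eq, dist_zero_right] at this
  rw [Real.norm_eq_abs, Real.norm_of_nonneg (by positivity)]
  have h3 := abs_add_le (F x - F 0) (F 0)
  rw [sub_add_cancel] at h3
  linarith

theorem lintegral_pow_sub_le (F : E → ℝ) (hF : LipschitzWith 1 F) (k : ℕ) :
    ∫⁻ z, ENNReal.ofReal ((F z.2 - F z.1) ^ (2 * k)) ∂((stdGaussian E).prod (stdGaussian E))
      ≤ ENNReal.ofReal (momentConst k) := by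
  have hneg : LipschitzWith 1 (fun x => - F x) := hF.neg
  have hFc := hF.continuous
  have h1 := lintegral_exp_sub_le_of_lipschitz F hF
  have h2 := lintegral_exp_sub_le_of_lipschitz _ hneg
  calc _ ≤ ∫⁻ z, ENNReal.ofReal (2 * k).factorial * (ENNReal.ofReal (Real.exp (F z.2 - F z.1)) +
        ENNReal.ofReal (Real.exp (-F z.2 - -F z.1)))
        ∂((stdGaussian E).prod (stdGaussian E)) := by
        refine lintegral_mono fun z => ?_
        rw [← ENNReal.ofReal_add (Real.exp_pos _).le (Real.exp_pos _).le,
          ← ENNReal.ofReal_mul (by positivity)]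
        refine ENNReal.ofReal_le_ofReal ?_
        convert even_pow_le_factorial_mul_exp k (F z.2 - F z.1) using 4
        ring
    _ ≤ _ := by
        rw [lintegral_const_mul' _ _ ENNReal.ofReal_ne_top, lintegral_add_left (by fun_prop)]
        refine (mul_le_mul_right (add_le_add h1 h2) _).trans ?_
        rw [← ENNReal.ofReal_add (Real.exp_pos _).le (Real.exp_pos _).le,
          ← ENNReal.ofReal_mul (by positivity)]
        refine ENNReal.ofReal_le_ofReal (le_of_eq ?_)
        unfold momentConst
        ring

theorem integral_pow_sub_integral_stdGaussian_le_of_one (F : E → ℝ) (hF : LipschitzWith 1 F)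
    (k : ℕ) : ∫ x, (F x - ∫ y, F y ∂(stdGaussian E)) ^ (2 * k) ∂(stdGaussian E) ≤
      momentConst k := by
  refine (integral_pow_sub_integral_le _ F k (memLp_lipschitz_stdGaussian F 1 hF)).trans ?_
  have hFc := hF.continuous
  rw [integral_eq_lintegral_of_nonneg_ae
    (Eventually.of_forall fun z => (even_two_mul k).pow_nonneg _) (by fun_prop)]
  exact ENNReal.toReal_le_of_le_ofReal (momentConst_pos k).le (lintegral_pow_sub_le F hF k)

theorem integral_pow_sub_integral_stdGaussian_le (F : E → ℝ) (L : ℝ≥0) (hF : LipschitzWith L F)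
    (k : ℕ) : ∫ x, (F x - ∫ y, F y ∂(stdGaussian E)) ^ (2 * k) ∂(stdGaussian E) ≤
      momentConst k * L ^ (2 * k) := by
  -- A zero constant cannot be scaled out. Here `F` is constant, and at `k = 0` both powers are `0 ^
  -- 0 = 1`, so the bound rests on `momentConst k ≥ 1`.
  rcases eq_or_ne L 0 with rfl | hL
  · have hc : ∀ x, F x = F 0 := fun x => by
      have := hF.dist_le_mul x 0
      simpa using this
    simp only [hc, integral_const, probReal_univ, smul_eq_mul, one_mul, sub_self, NNReal.coe_zero]
    have := one_le_momentConst k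
    exact le_mul_of_one_le_left ((even_two_mul k).pow_nonneg _) this
  · have hL' : (L : ℝ) ≠ 0 := by exact_mod_cast hL
    have h1 : LipschitzWith 1 (fun x => (L : ℝ)⁻¹ * F x) := by
      refine LipschitzWith.of_dist_le_mul fun x y => ?_
      have := hF.dist_le_mul x y
      rw [Real.dist_eq] at this ⊢
      rw [← mul_sub, abs_mul, abs_of_nonneg (by positivity), NNReal.coe_one, one_mul,
        inv_mul_le_iff₀ (by positivity)]
      exact this
    have h2 := integral_pow_sub_integral_stdGaussian_le_of_one _ h1 k
    simp_rw [integral_const_mul, ← mul_sub, mul_pow, integral_const_mul] at h2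
    rwa [inv_pow, inv_mul_le_iff₀ (by positivity), mul_comm _ (momentConst k)] at h2

end GaussianConcentration

/-! ### Concentration for Lipschitz images of Gaussian vectors. -/

/-- `μ` satisfies, for the distance `d`, moment bounds of sub-Gaussian type for the Lipschitz
functions, with constants `C k`. -/
def Conc {S : Type*} [MeasurableSpace S] (μ : Measure S) (d : S → S → ℝ) (C : ℕ → ℝ) : Prop :=
  ∀ (F : S → ℝ) (L : ℝ), Measurable F → 0 ≤ L → (∀ x y, |F x - F y| ≤ L * d x y) →
    (∀ q : ℕ, MemLp F q μ) ∧ ∀ k : ℕ, ∫ x, (F x - ∫ y, F y ∂μ) ^ (2 * k) ∂μ ≤ C k * L ^ (2 * k)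

/-- A Lipschitz function of `g` is Lipschitz in the Gaussian vector, with the constants multiplied.
The bound does not involve the size of `ι`, which is what makes it usable for a whole matrix of
rows. -/
theorem conc_map_pi_gaussian {ι S : Type*} [Fintype ι] [MeasurableSpace S] (g : (ι → ℝ) → S)
    (hg : Measurable g) (d : S → S → ℝ) (κ : ℝ) (hκ : 0 ≤ κ)
    (hd : ∀ x y, d (g x) (g y) ≤ κ * ‖WithLp.toLp 2 (x - y)‖) :
    Conc ((Measure.pi fun _ : ι => gaussianReal 0 1).map g) d
      (fun k => momentConst k * κ ^ (2 * k)) := by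
  intro F L hF hL hFL
  have hmap : (Measure.pi fun _ : ι => gaussianReal 0 1) =
      (stdGaussian (EuclideanSpace ℝ ι)).map (WithLp.ofLp (p := 2)) := by
    rw [← map_pi_eq_stdGaussian, Measure.map_map (by fun_prop) (by fun_prop)]
    exact Measure.map_id.symm
  rw [hmap, Measure.map_map hg (by fun_prop)]
  have hgm : Measurable (g ∘ WithLp.ofLp (p := 2) : EuclideanSpace ℝ ι → S) :=
    hg.comp (by fun_prop)
  have hlip : LipschitzWith (Real.toNNReal (L * κ))
      (F ∘ (g ∘ WithLp.ofLp (p := 2)) : EuclideanSpace ℝ ι → ℝ) := by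
    refine LipschitzWith.of_dist_le_mul fun x y => ?_
    rw [Real.dist_eq, dist_eq_norm]
    refine (hFL _ _).trans ?_
    rw [Real.coe_toNNReal _ (mul_nonneg hL hκ), mul_assoc]
    exact mul_le_mul_of_nonneg_left (hd _ _) hL
  refine ⟨fun q => ?_, fun k => ?_⟩
  · rw [memLp_map_measure_iff hF.aestronglyMeasurable hgm.aemeasurable]
    exact memLp_lipschitz_stdGaussian _ _ hlip q
  · have := integral_pow_sub_integral_stdGaussian_le _ _ hlip k
    rw [integral_map hgm.aemeasurable (by fun_prop), integral_map hgm.aemeasurable (by fun_prop)]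
    refine this.trans (le_of_eq ?_)
    simp only [Real.coe_toNNReal _ (mul_nonneg hL hκ), mul_pow]
    ring

theorem le_of_sq_le_sq_of_nonneg {a b : ℝ} (h : a ^ 2 ≤ b ^ 2) (hb : 0 ≤ b) : a ≤ b :=
  le_of_abs_le (abs_le_of_sq_le_sq h hb)

/-! ### Euclidean and Frobenius norms on plain functions. -/

section EuclideanNorm

variable {ι : Type*} [Fintype ι]

/-- The Euclidean norm of a vector. -/
noncomputable def l2 (x : ι → ℝ) : ℝ := ‖WithLp.toLp 2 x‖

theorem l2_nonneg (x : ι → ℝ) : 0 ≤ l2 x := norm_nonneg _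

theorem l2_sq (x : ι → ℝ) : l2 x ^ 2 = x ⬝ᵥ x := by
  rw [l2, EuclideanSpace.real_norm_sq_eq, dotProduct]
  exact Finset.sum_congr rfl fun i _ => sq _

theorem abs_dotProduct_le (x y : ι → ℝ) : |x ⬝ᵥ y| ≤ l2 x * l2 y := by
  have := abs_real_inner_le_norm (WithLp.toLp 2 x : EuclideanSpace ℝ ι) (WithLp.toLp 2 y)
  rw [EuclideanSpace.inner_eq_star_dotProduct] at this
  rw [dotProduct_comm]
  simpa [l2] using this

theorem dotProduct_le (x y : ι → ℝ) : x ⬝ᵥ y ≤ l2 x * l2 y :=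
  (le_abs_self _).trans (abs_dotProduct_le x y)

theorem l2_sub_rev (x y : ι → ℝ) : l2 (x - y) = l2 (y - x) := by
  rw [l2, l2, WithLp.toLp_sub, WithLp.toLp_sub, norm_sub_rev]

theorem abs_l2_sub_l2_le (x y : ι → ℝ) : |l2 x - l2 y| ≤ l2 (x - y) := by
  simp only [l2, WithLp.toLp_sub]; exact abs_norm_sub_norm_le _ _

theorem l2_smul (c : ℝ) (x : ι → ℝ) : l2 (c • x) = |c| * l2 x := by
  rw [l2, WithLp.toLp_smul, norm_smul, Real.norm_eq_abs, l2]

theorem continuous_l2 : Continuous (l2 : (ι → ℝ) → ℝ) := by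
  unfold l2; fun_prop

theorem l2_mono {x y : ι → ℝ} (h : ∀ i, |x i| ≤ |y i|) : l2 x ≤ l2 y := by
  refine le_of_sq_le_sq_of_nonneg ?_ (l2_nonneg _)
  rw [l2_sq, l2_sq, dotProduct, dotProduct]
  exact Finset.sum_le_sum fun i _ => by
    rw [← sq, ← sq]; exact sq_le_sq.2 (h i)

variable {κ : Type*} [Fintype κ]

/-- The Frobenius norm of a matrix, as the norm of the vector of the norms of the rows. -/
noncomputable def fro (R : ι → κ → ℝ) : ℝ := l2 fun i => l2 (R i)

theorem fro_nonneg (R : ι → κ → ℝ) : 0 ≤ fro R := l2_nonneg _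

theorem fro_sq (R : ι → κ → ℝ) : fro R ^ 2 = ∑ i, R i ⬝ᵥ R i := by
  rw [fro, l2_sq, dotProduct]
  exact Finset.sum_congr rfl fun i _ => by rw [← l2_sq, sq]

theorem l2_mulVec_le (R : Matrix ι κ ℝ) (x : κ → ℝ) : l2 (R *ᵥ x) ≤ fro R * l2 x := by
  have h : l2 (R *ᵥ x) ≤ l2 (l2 x • fun i => l2 (R i)) := l2_mono fun i => by
    rw [Pi.smul_apply, smul_eq_mul, abs_of_nonneg (mul_nonneg (l2_nonneg x) (l2_nonneg _)),
      mul_comm]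
    exact abs_dotProduct_le _ _
  rwa [l2_smul, abs_of_nonneg (l2_nonneg x), mul_comm] at h

theorem l2_sq_mulVec (R : Matrix ι κ ℝ) (x : κ → ℝ) :
    l2 (R *ᵥ x) ^ 2 = ∑ i, (R i ⬝ᵥ x) ^ 2 := by
  rw [l2_sq, dotProduct]
  exact Finset.sum_congr rfl fun i _ => (sq _).symm

end EuclideanNorm

/-! ### The regularized inverse of a positive semidefinite matrix and rank-one updates. -/

section Resolvent

theorem dotProduct_mulVec_symm {ι : Type*} [Fintype ι] {A : Matrix ι ι ℝ} (hA : Aᵀ = A)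
    (x y : ι → ℝ) :
    x ⬝ᵥ A *ᵥ y = (A *ᵥ x) ⬝ᵥ y := by
  rw [Matrix.dotProduct_mulVec, ← Matrix.mulVec_transpose, hA]

theorem dotProduct_mulVec_nonneg {ι : Type*} [Fintype ι] {P : Matrix ι ι ℝ} (hP : P.PosSemidef)
    (x : ι → ℝ) : 0 ≤ x ⬝ᵥ P *ᵥ x := by
  simpa using hP.dotProduct_mulVec_nonneg x

theorem posSemidef_add_smul_vecMulVec {ι : Type*} [Fintype ι] {P : Matrix ι ι ℝ}
    (hP : P.PosSemidef) {τ : ℝ} (hτ : 0 ≤ τ) (s : ι → ℝ) :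
    (P + τ • Matrix.vecMulVec s s).PosSemidef := by
  have := Matrix.posSemidef_vecMulVec_self_star s
  exact hP.add (Matrix.PosSemidef.smul (by simpa using this) hτ)

variable {ι : Type*} [Fintype ι] [DecidableEq ι]

/-- The regularized inverse `(P + γ I)⁻¹`. -/
noncomputable def regInv (γ : ℝ) (P : Matrix ι ι ℝ) : Matrix ι ι ℝ :=
  (P + γ • (1 : Matrix ι ι ℝ))⁻¹

variable {γ : ℝ} {P : Matrix ι ι ℝ}

theorem isUnit_det_add_smul_one (hγ : 0 < γ) (hP : P.PosSemidef) :
    IsUnit (P + γ • (1 : Matrix ι ι ℝ)).det :=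
  (Matrix.isUnit_iff_isUnit_det _).1 ((Matrix.PosDef.one.smul hγ).posSemidef_add hP).isUnit

theorem mul_regInv (hγ : 0 < γ) (hP : P.PosSemidef) :
    (P + γ • (1 : Matrix ι ι ℝ)) * regInv γ P = 1 :=
  Matrix.mul_nonsing_inv _ (isUnit_det_add_smul_one hγ hP)

theorem regInv_mul (hγ : 0 < γ) (hP : P.PosSemidef) :
    regInv γ P * (P + γ • (1 : Matrix ι ι ℝ)) = 1 :=
  Matrix.nonsing_inv_mul _ (isUnit_det_add_smul_one hγ hP)

/-- This identity replaces spectral calculus: the bounds below come from pairing it with `z = regInv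
γ P *ᵥ x`, or from taking its squared norm, and using `zᵀPz ≥ 0`. -/
theorem mulVec_regInv_add (hγ : 0 < γ) (hP : P.PosSemidef) (x : ι → ℝ) :
    P *ᵥ (regInv γ P *ᵥ x) + γ • (regInv γ P *ᵥ x) = x := by
  have h := congrArg (· *ᵥ x) (mul_regInv hγ hP)
  simpa [← Matrix.mulVec_mulVec, Matrix.add_mulVec, Matrix.smul_mulVec] using h

theorem eq_regInv_mulVec (hγ : 0 < γ) (hP : P.PosSemidef) {x z : ι → ℝ}
    (h : P *ᵥ z + γ • z = x) : regInv γ P *ᵥ x = z := by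
  have h1 := congrArg (· *ᵥ z) (regInv_mul hγ hP)
  simp only [← Matrix.mulVec_mulVec, Matrix.add_mulVec, Matrix.smul_mulVec,
    Matrix.one_mulVec, h] at h1
  exact h1

theorem transpose_regInv (hP : P.PosSemidef) : (regInv γ P)ᵀ = regInv γ P := by
  have h : Pᵀ = P := by simpa using hP.isHermitian.eq
  rw [regInv, Matrix.transpose_nonsing_inv, Matrix.transpose_add, h, Matrix.transpose_smul,
    Matrix.transpose_one]

theorem dotProduct_regInv (hP : P.PosSemidef) (x y : ι → ℝ) :
    x ⬝ᵥ regInv γ P *ᵥ y = (regInv γ P *ᵥ x) ⬝ᵥ y :=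
  dotProduct_mulVec_symm (transpose_regInv hP) x y

theorem l2_regInv_le (hγ : 0 < γ) (hP : P.PosSemidef) (x : ι → ℝ) :
    l2 (regInv γ P *ᵥ x) ≤ l2 x / γ := by
  set z := regInv γ P *ᵥ x
  have h := congrArg (z ⬝ᵥ ·) (mulVec_regInv_add hγ hP x)
  simp only [dotProduct_add, dotProduct_smul, smul_eq_mul] at h
  rw [← l2_sq] at h
  have h1 := dotProduct_mulVec_nonneg hP z
  have h2 := dotProduct_le z x
  rw [le_div_iff₀ hγ]
  rcases (l2_nonneg z).eq_or_lt with h0 | h0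
  · rw [← h0, zero_mul]; exact l2_nonneg x
  · refine le_of_mul_le_mul_left ?_ h0
    nlinarith

theorem dotProduct_regInv_le (hγ : 0 < γ) (hP : P.PosSemidef) (x : ι → ℝ) :
    x ⬝ᵥ regInv γ P *ᵥ x ≤ l2 x ^ 2 / γ := by
  refine (dotProduct_le _ _).trans ?_
  have := mul_le_mul_of_nonneg_left (l2_regInv_le hγ hP x) (l2_nonneg x)
  rwa [← mul_div_assoc, ← sq] at this

theorem abs_dotProduct_regInv_le (hγ : 0 < γ) (hP : P.PosSemidef) (x y : ι → ℝ) :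
    |x ⬝ᵥ regInv γ P *ᵥ y| ≤ l2 x * l2 y / γ := by
  refine (abs_dotProduct_le _ _).trans ?_
  rw [mul_div_assoc]
  exact mul_le_mul_of_nonneg_left (l2_regInv_le hγ hP y) (l2_nonneg x)

theorem dotProduct_mulVec_regInv_le (hγ : 0 < γ) (hP : P.PosSemidef) (x : ι → ℝ) :
    (regInv γ P *ᵥ x) ⬝ᵥ P *ᵥ (regInv γ P *ᵥ x) ≤ l2 x ^ 2 / γ := by
  have h := congrArg ((regInv γ P *ᵥ x) ⬝ᵥ ·) (mulVec_regInv_add hγ hP x)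
  simp only [dotProduct_add, dotProduct_smul, smul_eq_mul] at h
  rw [← l2_sq, dotProduct_comm _ x] at h
  have := dotProduct_regInv_le hγ hP x
  nlinarith [sq_nonneg (l2 (regInv γ P *ᵥ x))]

theorem dotProduct_regInv_nonneg (hγ : 0 < γ) (hP : P.PosSemidef) (x : ι → ℝ) :
    0 ≤ x ⬝ᵥ regInv γ P *ᵥ x := by
  have h := congrArg ((regInv γ P *ᵥ x) ⬝ᵥ ·) (mulVec_regInv_add hγ hP x)
  simp only [dotProduct_add, dotProduct_smul, smul_eq_mul] at h
  rw [← l2_sq, dotProduct_comm _ x] at h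
  rw [← h]
  have := dotProduct_mulVec_nonneg hP (regInv γ P *ᵥ x)
  positivity

theorem dotProduct_regInv_sq_le (hγ : 0 < γ) (hP : P.PosSemidef) (x : ι → ℝ) :
    (regInv γ P *ᵥ x) ⬝ᵥ (regInv γ P *ᵥ x) ≤ (x ⬝ᵥ regInv γ P *ᵥ x) / γ := by
  have h := congrArg ((regInv γ P *ᵥ x) ⬝ᵥ ·) (mulVec_regInv_add hγ hP x)
  simp only [dotProduct_add, dotProduct_smul, smul_eq_mul] at h
  rw [dotProduct_comm _ x] at h
  rw [le_div_iff₀ hγ, ← h]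
  have := dotProduct_mulVec_nonneg hP (regInv γ P *ᵥ x)
  linarith

/-- In `‖Pz + γz‖² = ‖x‖²` the cross term `2γ zᵀPz` is nonnegative. -/
theorem l2_mulVec_regInv_le (hγ : 0 < γ) (hP : P.PosSemidef) (x : ι → ℝ) :
    l2 (P *ᵥ (regInv γ P *ᵥ x)) ≤ l2 x := by
  refine le_of_sq_le_sq_of_nonneg ?_ (l2_nonneg _)
  set z := regInv γ P *ᵥ x
  have h := mulVec_regInv_add hγ hP x
  have h1 := dotProduct_mulVec_nonneg hP z
  rw [← h, l2_sq, l2_sq]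
  simp only [dotProduct_add, add_dotProduct, dotProduct_smul, smul_dotProduct, smul_eq_mul]
  rw [show regInv γ P *ᵥ x = z from rfl, dotProduct_comm (P *ᵥ z) z, ← l2_sq z]
  nlinarith [sq_nonneg (γ * l2 z), mul_nonneg hγ.le h1]

/-- The Sherman–Morrison formula. -/
theorem regInv_add_smul_vecMulVec (hγ : 0 < γ) (hP : P.PosSemidef) {τ : ℝ} (hτ : 0 ≤ τ)
    (s x : ι → ℝ) :
    regInv γ (P + τ • Matrix.vecMulVec s s) *ᵥ x = regInv γ P *ᵥ x -
      (τ * (s ⬝ᵥ regInv γ P *ᵥ x) / (1 + τ * (s ⬝ᵥ regInv γ P *ᵥ s))) • regInv γ P *ᵥ s := by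
  refine eq_regInv_mulVec hγ (posSemidef_add_smul_vecMulVec hP hτ s) ?_
  have hx := mulVec_regInv_add hγ hP x
  have hs := mulVec_regInv_add hγ hP s
  have hD : 1 + τ * (s ⬝ᵥ regInv γ P *ᵥ s) ≠ 0 := by
    have := dotProduct_regInv_nonneg hγ hP s
    positivity
  set z := regInv γ P *ᵥ x
  set y := regInv γ P *ᵥ s
  set a := s ⬝ᵥ z
  set b := s ⬝ᵥ y
  have e : (P + τ • Matrix.vecMulVec s s) *ᵥ (z - (τ * a / (1 + τ * b)) • y) +
      γ • (z - (τ * a / (1 + τ * b)) • y) = (P *ᵥ z + γ • z) -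
      (τ * a / (1 + τ * b)) • (P *ᵥ y + γ • y) + (τ * (a - (τ * a / (1 + τ * b)) * b)) • s := by
    simp only [Matrix.add_mulVec, Matrix.mulVec_sub, Matrix.mulVec_smul, Matrix.smul_mulVec,
      Matrix.vecMulVec_mulVec]
    ext i
    simp only [Pi.add_apply, Pi.sub_apply, Pi.smul_apply, smul_eq_mul, MulOpposite.smul_eq_mul_unop,
      MulOpposite.unop_op]
    ring
  rw [e, hx, hs]
  ext i
  simp only [Pi.add_apply, Pi.sub_apply, Pi.smul_apply, smul_eq_mul]
  field_simp
  ring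

theorem continuous_regInv {X : Type*} [TopologicalSpace X] (hγ : 0 < γ) (f : X → Matrix ι ι ℝ)
    (hf : Continuous f) (hP : ∀ x, (f x).PosSemidef) : Continuous fun x => regInv γ (f x) := by
  unfold regInv
  simp only [Matrix.inv_def]
  have h : Continuous fun x => f x + γ • (1 : Matrix ι ι ℝ) := hf.add continuous_const
  have h2 := h.matrix_adjugate
  have e : ∀ x, Ring.inverse (f x + γ • (1 : Matrix ι ι ℝ)).det =
      ((f x + γ • (1 : Matrix ι ι ℝ)).det)⁻¹ := fun x => by simp
  simp only [e]
  exact (h.matrix_det.inv₀ fun x => (isUnit_det_add_smul_one hγ (hP x)).ne_zero).smul h2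

end Resolvent

/-! ### Lipschitz dependence of the resolvent on the feature matrix. -/

section Gram

variable {n T : ℕ}

/-- The normalized Gram matrix of the columns. -/
noncomputable def gram (S : Matrix (Fin n) (Fin T) ℝ) : Matrix (Fin T) (Fin T) ℝ :=
  (1 / (T : ℝ)) • (Sᵀ * S)

theorem resolvent_eq (γ : ℝ) (S : Matrix (Fin n) (Fin T) ℝ) :
    resolvent γ S = regInv γ (gram S) := rfl

theorem posSemidef_gram (S : Matrix (Fin n) (Fin T) ℝ) : (gram S).PosSemidef := by
  have := Matrix.posSemidef_conjTranspose_mul_self S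
  rw [Matrix.conjTranspose_eq_transpose_of_trivial] at this
  exact this.smul (by positivity)

theorem dotProduct_gram (S : Matrix (Fin n) (Fin T) ℝ) (x y : Fin T → ℝ) :
    x ⬝ᵥ gram S *ᵥ y = (1 / (T : ℝ)) * ((S *ᵥ x) ⬝ᵥ (S *ᵥ y)) := by
  rw [gram, Matrix.smul_mulVec, dotProduct_smul, smul_eq_mul, ← Matrix.mulVec_mulVec,
    Matrix.dotProduct_mulVec, Matrix.vecMul_transpose]

theorem continuous_gram : Continuous (gram : Matrix (Fin n) (Fin T) ℝ → _) := by
  unfold gram; fun_prop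

theorem gram_eq_add (S : Matrix (Fin (n + 1)) (Fin T) ℝ) (i : Fin (n + 1)) :
    gram S = gram (Matrix.of fun j => S (i.succAbove j)) +
      (1 / (T : ℝ)) • Matrix.vecMulVec (S i) (S i) := by
  ext a b
  change (1 / (T : ℝ)) * ∑ k, S k a * S k b = (1 / (T : ℝ)) * (∑ j, S (i.succAbove j) a *
    S (i.succAbove j) b) + (1 / (T : ℝ)) * (S i a * S i b)
  rw [Fin.sum_univ_succAbove _ i]
  ring

/-- The form of the Gram matrix at `Qx` is at most `‖x‖²/γ`. The bound on `SQ` is uniform in `S`,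
and it is why the resolvent is globally Lipschitz although the Gram matrix is quadratic in `S`. -/
theorem l2_mulVec_resolvent_le {γ : ℝ} (hγ : 0 < γ) (hT : 0 < T) (S : Matrix (Fin n) (Fin T) ℝ)
    (x : Fin T → ℝ) : l2 (S *ᵥ (resolvent γ S *ᵥ x)) ≤ √(T / γ) * l2 x := by
  have h := dotProduct_mulVec_regInv_le hγ (posSemidef_gram S) x
  rw [dotProduct_gram, ← l2_sq, ← resolvent_eq] at h
  refine le_of_sq_le_sq_of_nonneg ?_ (mul_nonneg (Real.sqrt_nonneg _) (l2_nonneg _))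
  have hT' : (0 : ℝ) < T := by exact_mod_cast hT
  rw [mul_pow, Real.sq_sqrt (by positivity)]
  rw [one_div, inv_mul_le_iff₀ hT'] at h
  refine h.trans (le_of_eq ?_)
  ring

/-- The resolvent identity `Q - Q' = Q (G' - G) Q'`, with `S'ᵀS' - SᵀS = (S' - S)ᵀS' + Sᵀ(S' - S)`.
Each term has one increment and one bounded factor `SQ` or `S'Q'`. -/
theorem resolvent_sub_eq {γ : ℝ} (hγ : 0 < γ) (S S' : Matrix (Fin n) (Fin T) ℝ)
    (u v : Fin T → ℝ) :
    u ⬝ᵥ resolvent γ S *ᵥ v - u ⬝ᵥ resolvent γ S' *ᵥ v =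
      (1 / (T : ℝ)) * (((S' - S) *ᵥ (resolvent γ S *ᵥ u)) ⬝ᵥ (S' *ᵥ (resolvent γ S' *ᵥ v)) +
        (S *ᵥ (resolvent γ S *ᵥ u)) ⬝ᵥ ((S' - S) *ᵥ (resolvent γ S' *ᵥ v))) := by
  have h1 := congrArg (· ⬝ᵥ (resolvent γ S' *ᵥ v)) (mulVec_regInv_add hγ (posSemidef_gram S) u)
  have h2 := congrArg ((resolvent γ S *ᵥ u) ⬝ᵥ ·) (mulVec_regInv_add hγ (posSemidef_gram S') v)
  simp only [← resolvent_eq, dotProduct_add, dotProduct_smul, add_dotProduct, smul_dotProduct,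
    dotProduct_gram] at h1 h2
  rw [dotProduct_comm (gram S *ᵥ _), dotProduct_gram] at h1
  have h3 : u ⬝ᵥ resolvent γ S *ᵥ v = (resolvent γ S *ᵥ u) ⬝ᵥ v :=
    dotProduct_regInv (posSemidef_gram S) u v
  rw [h3, ← h1, ← h2]
  simp only [Matrix.sub_mulVec, dotProduct_sub, sub_dotProduct]
  rw [dotProduct_comm (S *ᵥ _) (S *ᵥ _)]
  ring

/-- The Lipschitz constant of the resolvent as a function of the matrix of features. -/
noncomputable def lipConst (γ : ℝ) (T : ℕ) : ℝ := 2 / (γ * √(γ * T))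

theorem lipConst_nonneg {γ : ℝ} (hγ : 0 < γ) (T : ℕ) : 0 ≤ lipConst γ T := by
  unfold lipConst; positivity

theorem abs_resolvent_sub_le {γ : ℝ} (hγ : 0 < γ) (hT : 0 < T) (S S' : Matrix (Fin n) (Fin T) ℝ)
    (u v : Fin T → ℝ) :
    |u ⬝ᵥ resolvent γ S *ᵥ v - u ⬝ᵥ resolvent γ S' *ᵥ v| ≤
      lipConst γ T * (l2 u * l2 v) * fro (S - S') := by
  have hT' : (0 : ℝ) < T := by exact_mod_cast hT
  have hfro : fro (S' - S) = fro (S - S') := by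
    unfold fro
    congr 1; ext i; exact l2_sub_rev _ _
  have hu := l2_regInv_le hγ (posSemidef_gram S) u
  have hv := l2_regInv_le hγ (posSemidef_gram S') v
  rw [← resolvent_eq] at hu hv
  have hu2 := l2_mulVec_resolvent_le hγ hT S u
  have hv2 := l2_mulVec_resolvent_le hγ hT S' v
  have hu3 := l2_mulVec_le (S' - S) (resolvent γ S *ᵥ u)
  have hv3 := l2_mulVec_le (S' - S) (resolvent γ S' *ᵥ v)
  rw [hfro] at hu3 hv3
  have hf := fro_nonneg (S - S')
  have key : lipConst γ T * (l2 u * l2 v) * fro (S - S') =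
      (1 / (T : ℝ)) * ((fro (S - S') * (l2 u / γ)) * (√(T / γ) * l2 v) +
        (√(T / γ) * l2 u) * (fro (S - S') * (l2 v / γ))) := by
    have e : √(T / γ) = T / √(γ * T) := by
      rw [eq_div_iff (by positivity), ← Real.sqrt_mul (by positivity)]
      rw [show T / γ * (γ * T) = (T : ℝ) ^ 2 by field_simp, Real.sqrt_sq hT'.le]
    rw [e, lipConst]
    field_simp
    ring
  rw [resolvent_sub_eq hγ, key, abs_mul, abs_of_nonneg (by positivity : 0 ≤ 1 / (T : ℝ))]
  gcongr
  refine (abs_add_le _ _).trans (add_le_add ?_ ?_)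
  · refine (abs_dotProduct_le _ _).trans ?_
    refine mul_le_mul (hu3.trans (by gcongr)) hv2 (l2_nonneg _) ?_
    exact mul_nonneg hf (div_nonneg (l2_nonneg _) hγ.le)
  · refine (abs_dotProduct_le _ _).trans ?_
    refine mul_le_mul hu2 (hv3.trans (by gcongr)) (l2_nonneg _) ?_
    exact mul_nonneg (Real.sqrt_nonneg _) (l2_nonneg _)

/-- The two factors are changed one at a time; the factor left alone costs `1/γ`. -/
theorem abs_resolvent_sq_sub_le {γ : ℝ} (hγ : 0 < γ) (hT : 0 < T)
    (S S' : Matrix (Fin n) (Fin T) ℝ) (u v : Fin T → ℝ) :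
    |u ⬝ᵥ resolvent γ S *ᵥ (resolvent γ S *ᵥ v) - u ⬝ᵥ resolvent γ S' *ᵥ (resolvent γ S' *ᵥ v)| ≤
      2 / γ * lipConst γ T * (l2 u * l2 v) * fro (S - S') := by
  have h1 := abs_resolvent_sub_le hγ hT S S' u (resolvent γ S *ᵥ v)
  have h2 := abs_resolvent_sub_le hγ hT S S' (resolvent γ S' *ᵥ u) v
  have hu := l2_regInv_le hγ (posSemidef_gram S') u
  have hv := l2_regInv_le hγ (posSemidef_gram S) v
  rw [← resolvent_eq] at hu hv
  have hc := lipConst_nonneg hγ T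
  have hf := fro_nonneg (S - S')
  have e1 : u ⬝ᵥ resolvent γ S' *ᵥ (resolvent γ S *ᵥ v) =
      (resolvent γ S' *ᵥ u) ⬝ᵥ resolvent γ S *ᵥ v := dotProduct_regInv (posSemidef_gram S') _ _
  have e2 : u ⬝ᵥ resolvent γ S' *ᵥ (resolvent γ S' *ᵥ v) =
      (resolvent γ S' *ᵥ u) ⬝ᵥ resolvent γ S' *ᵥ v := dotProduct_regInv (posSemidef_gram S') _ _
  rw [← e1, ← e2] at h2
  have h3 : lipConst γ T * (l2 u * l2 (resolvent γ S *ᵥ v)) * fro (S - S') ≤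
      lipConst γ T * (l2 u * (l2 v / γ)) * fro (S - S') := by
    have := l2_nonneg u
    gcongr
  have h4 : lipConst γ T * (l2 (resolvent γ S' *ᵥ u) * l2 v) * fro (S - S') ≤
      lipConst γ T * (l2 u / γ * l2 v) * fro (S - S') := by
    have := l2_nonneg v
    gcongr
  have e3 : 2 / γ * lipConst γ T * (l2 u * l2 v) * fro (S - S') =
      lipConst γ T * (l2 u * (l2 v / γ)) * fro (S - S') +
      lipConst γ T * (l2 u / γ * l2 v) * fro (S - S') := by ring
  rw [e3]
  refine (abs_sub_le _ (u ⬝ᵥ resolvent γ S' *ᵥ (resolvent γ S *ᵥ v)) _).trans ?_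
  exact add_le_add (h1.trans h3) (h2.trans h4)

end Gram

/-! ### Elementary moment inequalities. -/

section Moments

variable {S : Type*} [MeasurableSpace S] {μ : Measure S}

/-- The Cauchy–Schwarz inequality for integrals. -/
theorem sq_integral_mul_le {f g : S → ℝ} (hf : Integrable (fun x => f x ^ 2) μ)
    (hg : Integrable (fun x => g x ^ 2) μ) (hfg : Integrable (fun x => f x * g x) μ) :
    (∫ x, f x * g x ∂μ) ^ 2 ≤ (∫ x, f x ^ 2 ∂μ) * ∫ x, g x ^ 2 ∂μ := by
  have h : ∀ t : ℝ, 0 ≤ (∫ x, f x ^ 2 ∂μ) * (t * t) + (2 * ∫ x, f x * g x ∂μ) * t +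
      ∫ x, g x ^ 2 ∂μ := by
    intro t
    have e : (∫ x, f x ^ 2 ∂μ) * (t * t) + (2 * ∫ x, f x * g x ∂μ) * t + ∫ x, g x ^ 2 ∂μ =
        ∫ x, (f x * t + g x) ^ 2 ∂μ := by
      have e1 : ∀ x, (f x * t + g x) ^ 2 = (f x ^ 2) * (t * t) + (f x * g x) * (2 * t) + g x ^ 2 :=
        fun x => by ring
      simp only [e1]
      have i1 := hf.mul_const (t * t)
      have i2 := hfg.mul_const (2 * t)
      have i3 : Integrable (fun x => f x ^ 2 * (t * t) + f x * g x * (2 * t)) μ := i1.add i2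
      rw [integral_add i3 hg, integral_add i1 i2, integral_mul_const, integral_mul_const]
      ring
    rw [e]
    exact integral_nonneg fun x => sq_nonneg _
  have := discrim_le_zero h
  unfold discrim at this
  nlinarith

theorem abs_integral_mul_le {f g : S → ℝ} (hf : Integrable (fun x => f x ^ 2) μ)
    (hg : Integrable (fun x => g x ^ 2) μ) (hfg : Integrable (fun x => f x * g x) μ) {a b : ℝ}
    (ha : 0 ≤ a) (hb : 0 ≤ b) (hfa : ∫ x, f x ^ 2 ∂μ ≤ a ^ 2) (hgb : ∫ x, g x ^ 2 ∂μ ≤ b ^ 2) :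
    |∫ x, f x * g x ∂μ| ≤ a * b := by
  refine abs_le_of_sq_le_sq ?_ (mul_nonneg ha hb)
  rw [mul_pow]
  exact (sq_integral_mul_le hf hg hfg).trans (mul_le_mul hfa hgb
    (integral_nonneg fun x => sq_nonneg _) (sq_nonneg _))

variable [IsProbabilityMeasure μ]

theorem pow_integral_le {f : S → ℝ} (hf : Integrable f μ) (k : ℕ)
    (hfk : Integrable (fun x => f x ^ (2 * k)) μ) :
    (∫ x, f x ∂μ) ^ (2 * k) ≤ ∫ x, f x ^ (2 * k) ∂μ :=
  (even_two_mul k).convexOn_pow.map_integral_le (continuous_pow _).continuousOn isClosed_univ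
    (by simp) hf hfk

theorem add_pow_four_le (a b : ℝ) : (a + b) ^ 4 ≤ 8 * (a ^ 4 + b ^ 4) := by
  nlinarith [sq_nonneg (a - b), sq_nonneg (a + b), sq_nonneg (a ^ 2 - b ^ 2),
    mul_self_nonneg (a * b), sq_nonneg (a ^ 2 - 2 * a * b + b ^ 2)]

/-- Concentration about any convenient constant suffices: by Jensen's inequality the mean is no
further from `c` than the fourth moment allows, and `16 = 8 + 8`. -/
theorem integral_sub_integral_pow_four_le {f : S → ℝ} (hf : Integrable f μ) (c : ℝ)
    (hfk : Integrable (fun x => (f x - c) ^ 4) μ) :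
    ∫ x, (f x - ∫ y, f y ∂μ) ^ 4 ∂μ ≤ 16 * ∫ x, (f x - c) ^ 4 ∂μ := by
  have h1 : (c - ∫ y, f y ∂μ) ^ 4 ≤ ∫ x, (f x - c) ^ 4 ∂μ := by
    have := pow_integral_le (hf.sub (integrable_const c)) 2 (by simpa using hfk)
    simp only [Pi.sub_apply, Nat.reduceMul] at this
    rw [integral_sub hf (integrable_const c)] at this
    refine le_trans (le_of_eq ?_) this
    simp only [integral_const, probReal_univ, smul_eq_mul, one_mul]
    ring
  calc _ ≤ ∫ x, (8 * ((f x - c) ^ 4 + (c - ∫ y, f y ∂μ) ^ 4)) ∂μ := by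
        refine integral_mono_of_nonneg (Eventually.of_forall fun x => by positivity)
          ((hfk.add (integrable_const _)).const_mul _) (Eventually.of_forall fun x => ?_)
        have := add_pow_four_le (f x - c) (c - ∫ y, f y ∂μ)
        rwa [sub_add_sub_cancel] at this
    _ ≤ _ := by
        rw [integral_const_mul, integral_add hfk (integrable_const _)]
        simp only [integral_const, probReal_univ, smul_eq_mul, one_mul]
        linarith

end Moments

/-! ### A class of functions of one row and the others that is closed under algebra and integrable.
-/

section PolynomialBound

variable {T : ℕ} {Y : Type*} [TopologicalSpace Y]

/-- Continuity and polynomial growth in the first variable, uniformly in the second one. -/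
def PolyBdd (f : (Fin T → ℝ) × Y → ℝ) : Prop :=
  Continuous f ∧ ∃ (A : ℝ) (k : ℕ), ∀ z, |f z| ≤ A * (1 + l2 z.1) ^ k

theorem PolyBdd.mul {f g : (Fin T → ℝ) × Y → ℝ} (hf : PolyBdd f) (hg : PolyBdd g) :
    PolyBdd fun z => f z * g z := by
  obtain ⟨hfc, A, k, hA⟩ := hf
  obtain ⟨hgc, B, l, hB⟩ := hg
  refine ⟨hfc.mul hgc, A * B, k + l, fun z => ?_⟩
  rw [abs_mul, pow_add]
  have := mul_le_mul (hA z) (hB z) (abs_nonneg _) ((abs_nonneg _).trans (hA z))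
  linarith

theorem PolyBdd.const (c : ℝ) : PolyBdd fun _ : (Fin T → ℝ) × Y => c :=
  ⟨continuous_const, |c|, 0, fun z => by simp⟩

theorem PolyBdd.add {f g : (Fin T → ℝ) × Y → ℝ} (hf : PolyBdd f) (hg : PolyBdd g) :
    PolyBdd fun z => f z + g z := by
  obtain ⟨hfc, A, k, hA⟩ := hf
  obtain ⟨hgc, B, l, hB⟩ := hg
  refine ⟨hfc.add hgc, |A| + |B|, k + l, fun z => ?_⟩
  have h1 : 1 ≤ 1 + l2 z.1 := by linarith [l2_nonneg z.1]
  have hk : (1 + l2 z.1) ^ k ≤ (1 + l2 z.1) ^ (k + l) := pow_le_pow_right₀ h1 (by omega)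
  have hl : (1 + l2 z.1) ^ l ≤ (1 + l2 z.1) ^ (k + l) := pow_le_pow_right₀ h1 (by omega)
  have hk0 : 0 ≤ (1 + l2 z.1) ^ k := by positivity
  have hl0 : 0 ≤ (1 + l2 z.1) ^ l := by positivity
  calc _ ≤ |f z| + |g z| := abs_add_le _ _
    _ ≤ |A| * (1 + l2 z.1) ^ k + |B| * (1 + l2 z.1) ^ l :=
        add_le_add ((hA z).trans (mul_le_mul_of_nonneg_right (le_abs_self A) hk0))
          ((hB z).trans (mul_le_mul_of_nonneg_right (le_abs_self B) hl0))
    _ ≤ |A| * (1 + l2 z.1) ^ (k + l) + |B| * (1 + l2 z.1) ^ (k + l) := by gcongr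
    _ = _ := by ring

theorem PolyBdd.const_mul {f : (Fin T → ℝ) × Y → ℝ} (c : ℝ) (hf : PolyBdd f) :
    PolyBdd fun z => c * f z := (PolyBdd.const c).mul hf

theorem PolyBdd.sub {f g : (Fin T → ℝ) × Y → ℝ} (hf : PolyBdd f) (hg : PolyBdd g) :
    PolyBdd fun z => f z - g z := by
  have := hf.add (hg.const_mul (-1))
  simpa only [neg_one_mul, ← sub_eq_add_neg] using this

theorem PolyBdd.pow {f : (Fin T → ℝ) × Y → ℝ} (hf : PolyBdd f) (k : ℕ) :
    PolyBdd fun z => f z ^ k := by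
  induction k with
  | zero => simpa using PolyBdd.const 1
  | succ k ih => simpa only [pow_succ] using ih.mul hf

theorem PolyBdd.of_bounded {f : (Fin T → ℝ) × Y → ℝ} (hf : Continuous f) (A : ℝ)
    (h : ∀ z, |f z| ≤ A) : PolyBdd f := ⟨hf, A, 0, by simpa using h⟩

theorem PolyBdd.of_le_l2 {f : (Fin T → ℝ) × Y → ℝ} (hf : Continuous f) (A : ℝ) (k : ℕ)
    (hA : 0 ≤ A) (h : ∀ z, |f z| ≤ A * l2 z.1 ^ k) : PolyBdd f := by
  refine ⟨hf, A, k, fun z => (h z).trans ?_⟩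
  have := l2_nonneg z.1
  gcongr
  linarith

variable {μ : Measure (Fin T → ℝ)} [IsProbabilityMeasure μ]

theorem integrable_one_add_l2_pow (hμ : ∀ q : ℕ, MemLp l2 q μ) (k : ℕ) :
    Integrable (fun s => (1 + l2 s) ^ k) μ := by
  have h : MemLp (fun s : Fin T → ℝ => 1 + l2 s) k μ := (memLp_const (1 : ℝ)).add (hμ k)
  refine h.integrable_norm_pow'.congr (Eventually.of_forall fun s => ?_)
  have : 0 ≤ 1 + l2 s := by linarith [l2_nonneg s]
  simp only [Real.norm_of_nonneg this]

theorem PolyBdd.integrable_left {f : (Fin T → ℝ) × Y → ℝ} (hf : PolyBdd f)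
    (hμ : ∀ q : ℕ, MemLp l2 q μ) (y : Y) : Integrable (fun s => f (s, y)) μ := by
  obtain ⟨hfc, A, k, hA⟩ := hf
  refine ((integrable_one_add_l2_pow hμ k).const_mul A).mono'
    (hfc.comp (Continuous.prodMk_left y)).aestronglyMeasurable
    (Eventually.of_forall fun s => hA (s, y))

theorem PolyBdd.integrable [MeasurableSpace Y] [BorelSpace Y] [SecondCountableTopology Y]
    {ν : Measure Y} [IsProbabilityMeasure ν] {f : (Fin T → ℝ) × Y → ℝ} (hf : PolyBdd f)
    (hμ : ∀ q : ℕ, MemLp l2 q μ) : Integrable f (μ.prod ν) := by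
  obtain ⟨hfc, A, k, hA⟩ := hf
  have h1 : Integrable (fun z : (Fin T → ℝ) × Y => (1 + l2 z.1) ^ k) (μ.prod ν) :=
    (integrable_one_add_l2_pow hμ k).comp_fst ν
  exact (h1.const_mul A).mono' hfc.aestronglyMeasurable (Eventually.of_forall hA)

/-- A form of Hölder's inequality with exponents `4, 4, 2`. -/
theorem PolyBdd.abs_integral_mul_mul_le [MeasurableSpace Y] [BorelSpace Y]
    [SecondCountableTopology Y] {ν : Measure Y} [IsProbabilityMeasure ν]
    {f g h : (Fin T → ℝ) × Y → ℝ} (hf : PolyBdd f) (hg : PolyBdd g) (hh : PolyBdd h)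
    (hμ : ∀ q : ℕ, MemLp l2 q μ) {a b c : ℝ} (ha : 0 ≤ a) (hb : 0 ≤ b) (hc : 0 ≤ c)
    (hfa : ∫ z, f z ^ 4 ∂(μ.prod ν) ≤ a ^ 4) (hgb : ∫ z, g z ^ 4 ∂(μ.prod ν) ≤ b ^ 4)
    (hhc : ∫ z, h z ^ 2 ∂(μ.prod ν) ≤ c ^ 2) :
    |∫ z, f z * g z * h z ∂(μ.prod ν)| ≤ a * b * c := by
  refine abs_integral_mul_le (((hf.mul hg).pow 2).integrable hμ) ((hh.pow 2).integrable hμ)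
    (((hf.mul hg).mul hh).integrable hμ) (mul_nonneg ha hb) hc ?_ hhc
  have e : ∀ z, (f z * g z) ^ 2 = f z ^ 2 * g z ^ 2 := fun z => mul_pow _ _ _
  simp only [e, mul_pow]
  refine (le_abs_self _).trans (abs_integral_mul_le (((hf.pow 2).pow 2).integrable hμ)
    (((hg.pow 2).pow 2).integrable hμ) (((hf.pow 2).mul (hg.pow 2)).integrable hμ) (sq_nonneg a)
    (sq_nonneg b) ?_ ?_)
  · simpa only [← pow_mul] using hfa
  · simpa only [← pow_mul] using hgb

theorem PolyBdd.abs_integral_mul_le [MeasurableSpace Y] [BorelSpace Y]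
    [SecondCountableTopology Y] {ν : Measure Y} [IsProbabilityMeasure ν]
    {f g : (Fin T → ℝ) × Y → ℝ} (hf : PolyBdd f) (hg : PolyBdd g)
    (hμ : ∀ q : ℕ, MemLp l2 q μ) {a b : ℝ} (ha : 0 ≤ a) (hb : 0 ≤ b)
    (hfa : ∫ z, f z ^ 2 ∂(μ.prod ν) ≤ a ^ 2) (hgb : ∫ z, g z ^ 2 ∂(μ.prod ν) ≤ b ^ 2) :
    |∫ z, f z * g z ∂(μ.prod ν)| ≤ a * b :=
  RandomFeatures.abs_integral_mul_le ((hf.pow 2).integrable hμ) ((hg.pow 2).integrable hμ)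
    ((hf.mul hg).integrable hμ) ha hb hfa hgb

end PolynomialBound

/-! ### Leave-one-out identities and exchangeability of the rows. -/

section LeaveOneOut

variable {T m : ℕ}

/-- The resolvent of the matrix whose rows are `z.1` and the rows of `z.2`. -/
noncomputable def fullRes (γ : ℝ) (z : (Fin T → ℝ) × (Fin m → Fin T → ℝ)) :
    Matrix (Fin T) (Fin T) ℝ :=
  regInv γ (gram (Matrix.of z.2) + (1 / (T : ℝ)) • Matrix.vecMulVec z.1 z.1)

/-- The form `sᵀ Q₋ x`, with `Q₋` the leave-one-out resolvent. -/
noncomputable def linQ (γ : ℝ) (x : Fin T → ℝ) (z : (Fin T → ℝ) × (Fin m → Fin T → ℝ)) : ℝ :=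
  z.1 ⬝ᵥ resolvent γ (Matrix.of z.2) *ᵥ x

/-- The form `sᵀ Q₋² x`, with `Q₋` the leave-one-out resolvent. -/
noncomputable def linQQ (γ : ℝ) (x : Fin T → ℝ) (z : (Fin T → ℝ) × (Fin m → Fin T → ℝ)) : ℝ :=
  z.1 ⬝ᵥ resolvent γ (Matrix.of z.2) *ᵥ (resolvent γ (Matrix.of z.2) *ᵥ x)

/-- The quadratic form `sᵀ Q₋ s / T`. -/
noncomputable def quadQ (γ : ℝ) (z : (Fin T → ℝ) × (Fin m → Fin T → ℝ)) : ℝ :=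
  1 / (T : ℝ) * linQ γ z.1 z

/-- The quadratic form `sᵀ Q₋² s / T`. -/
noncomputable def quadQQ (γ : ℝ) (z : (Fin T → ℝ) × (Fin m → Fin T → ℝ)) : ℝ :=
  1 / (T : ℝ) * linQQ γ z.1 z

/-- The ratio `sᵀ Q₋ x / (1 + sᵀ Q₋ s / T)`, that is `sᵀ Q x`. -/
noncomputable def linQD (γ : ℝ) (x : Fin T → ℝ) (z : (Fin T → ℝ) × (Fin m → Fin T → ℝ)) : ℝ :=
  linQ γ x z / (1 + quadQ γ z)

/-- The ratio `sᵀ Q₋² x / (1 + sᵀ Q₋ s / T)`. -/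
noncomputable def linQQD (γ : ℝ) (x : Fin T → ℝ) (z : (Fin T → ℝ) × (Fin m → Fin T → ℝ)) : ℝ :=
  linQQ γ x z / (1 + quadQ γ z)

/-- Whichever row is singled out, the rank-one update rebuilds the same resolvent. This turns sums
over the rows into forms of one matrix. -/
theorem fullRes_eq_resolvent (γ : ℝ) (S : Fin (m + 1) → Fin T → ℝ) (i : Fin (m + 1)) :
    fullRes γ (S i, fun j => S (i.succAbove j)) = resolvent γ (Matrix.of S) := by
  rw [fullRes, resolvent_eq, gram_eq_add (Matrix.of S) i]
  rfl

variable {γ : ℝ} (hγ : 0 < γ)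

theorem dotProduct_resolvent {n : ℕ} (S : Matrix (Fin n) (Fin T) ℝ) (x y : Fin T → ℝ) :
    x ⬝ᵥ resolvent γ S *ᵥ y = (resolvent γ S *ᵥ x) ⬝ᵥ y :=
  dotProduct_regInv (posSemidef_gram S) x y

theorem posSemidef_fullRes_arg (z : (Fin T → ℝ) × (Fin m → Fin T → ℝ)) :
    (gram (Matrix.of z.2) + (1 / (T : ℝ)) • Matrix.vecMulVec z.1 z.1).PosSemidef :=
  posSemidef_add_smul_vecMulVec (posSemidef_gram _) (by positivity) _

theorem quadQQ_nonneg (z : (Fin T → ℝ) × (Fin m → Fin T → ℝ)) : 0 ≤ quadQQ γ z := by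
  unfold quadQQ linQQ
  rw [dotProduct_resolvent, ← l2_sq]
  positivity

include hγ

theorem l2_resolvent_le {n : ℕ} (S : Matrix (Fin n) (Fin T) ℝ) (x : Fin T → ℝ) :
    l2 (resolvent γ S *ᵥ x) ≤ l2 x / γ := l2_regInv_le hγ (posSemidef_gram S) x

theorem quadQ_nonneg (z : (Fin T → ℝ) × (Fin m → Fin T → ℝ)) : 0 ≤ quadQ γ z :=
  mul_nonneg (by positivity) (dotProduct_regInv_nonneg hγ (posSemidef_gram _) _)

theorem one_add_quadQ_pos (z : (Fin T → ℝ) × (Fin m → Fin T → ℝ)) : 0 < 1 + quadQ γ z := by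
  linarith [quadQ_nonneg hγ z]

theorem quadQQ_le (z : (Fin T → ℝ) × (Fin m → Fin T → ℝ)) : quadQQ γ z ≤ quadQ γ z / γ := by
  unfold quadQQ linQQ quadQ linQ
  rw [dotProduct_resolvent, mul_div_assoc]
  exact mul_le_mul_of_nonneg_left (dotProduct_regInv_sq_le hγ (posSemidef_gram _) _)
    (by positivity)

theorem abs_linQ_le (x : Fin T → ℝ) (z : (Fin T → ℝ) × (Fin m → Fin T → ℝ)) :
    |linQ γ x z| ≤ l2 z.1 * (l2 x / γ) :=
  (abs_dotProduct_le _ _).trans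
    (mul_le_mul_of_nonneg_left (l2_resolvent_le hγ _ x) (l2_nonneg _))

theorem abs_linQQ_le (x : Fin T → ℝ) (z : (Fin T → ℝ) × (Fin m → Fin T → ℝ)) :
    |linQQ γ x z| ≤ l2 z.1 * (l2 x / γ / γ) := by
  refine (abs_dotProduct_le _ _).trans (mul_le_mul_of_nonneg_left ?_ (l2_nonneg _))
  exact (l2_resolvent_le hγ _ _).trans
    (div_le_div_of_nonneg_right (l2_resolvent_le hγ _ x) hγ.le)

theorem fullRes_mulVec (x : Fin T → ℝ) (z : (Fin T → ℝ) × (Fin m → Fin T → ℝ)) :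
    fullRes γ z *ᵥ x = resolvent γ (Matrix.of z.2) *ᵥ x -
      (1 / (T : ℝ) * linQD γ x z) • resolvent γ (Matrix.of z.2) *ᵥ z.1 := by
  rw [fullRes, regInv_add_smul_vecMulVec hγ (posSemidef_gram _) (by positivity), mul_div_assoc]
  rfl

theorem dotProduct_fullRes (w x : Fin T → ℝ) (z : (Fin T → ℝ) × (Fin m → Fin T → ℝ)) :
    w ⬝ᵥ fullRes γ z *ᵥ x = w ⬝ᵥ resolvent γ (Matrix.of z.2) *ᵥ x -
      1 / (T : ℝ) * (linQ γ w z * linQD γ x z) := by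
  rw [fullRes_mulVec hγ, dotProduct_sub, dotProduct_smul, smul_eq_mul, dotProduct_resolvent _ w z.1,
    dotProduct_comm _ z.1]
  unfold linQ
  ring

/-- Sherman–Morrison tested against the updating row itself: the correction combines with the main
term into division by `1 + sᵀQ₋s/T`. -/
theorem fst_dotProduct_fullRes (x : Fin T → ℝ) (z : (Fin T → ℝ) × (Fin m → Fin T → ℝ)) :
    z.1 ⬝ᵥ fullRes γ z *ᵥ x = linQD γ x z := by
  rw [dotProduct_fullRes hγ]
  have h := (one_add_quadQ_pos hγ z).ne'
  have e : linQ γ z.1 z / (T : ℝ) = quadQ γ z := by unfold quadQ; ring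
  have e2 : z.1 ⬝ᵥ resolvent γ (Matrix.of z.2) *ᵥ x = linQ γ x z := rfl
  rw [e2, one_div_mul_eq_div, mul_div_right_comm, e, linQD]
  field_simp
  ring

theorem fst_dotProduct_fullRes_sq (x : Fin T → ℝ) (z : (Fin T → ℝ) × (Fin m → Fin T → ℝ)) :
    z.1 ⬝ᵥ fullRes γ z *ᵥ (fullRes γ z *ᵥ x) =
      linQQD γ x z - quadQQ γ z / (1 + quadQ γ z) * linQD γ x z := by
  rw [fst_dotProduct_fullRes hγ, linQD, linQ, fullRes_mulVec hγ, Matrix.mulVec_sub, dotProduct_sub,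
    Matrix.mulVec_smul, dotProduct_smul, smul_eq_mul, sub_div]
  congr 1
  unfold quadQQ linQQ
  ring

theorem dotProduct_fullRes_sq (w x : Fin T → ℝ) (z : (Fin T → ℝ) × (Fin m → Fin T → ℝ)) :
    w ⬝ᵥ fullRes γ z *ᵥ (fullRes γ z *ᵥ x) =
      w ⬝ᵥ resolvent γ (Matrix.of z.2) *ᵥ (resolvent γ (Matrix.of z.2) *ᵥ x) -
      1 / (T : ℝ) * (linQ γ x z * linQQD γ w z) - 1 / (T : ℝ) * (linQ γ w z * linQQD γ x z) +
      1 / (T : ℝ) * (quadQQ γ z / (1 + quadQ γ z) * linQD γ w z * linQ γ x z) := by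
  have h1 : w ⬝ᵥ fullRes γ z *ᵥ (fullRes γ z *ᵥ x) = (fullRes γ z *ᵥ w) ⬝ᵥ (fullRes γ z *ᵥ x) :=
    dotProduct_regInv (posSemidef_fullRes_arg z) _ _
  have h2 : ∀ y : Fin T → ℝ, (resolvent γ (Matrix.of z.2) *ᵥ z.1) ⬝ᵥ (resolvent γ (Matrix.of z.2) *ᵥ y) = linQQ γ y z :=
    fun y => by rw [linQQ, dotProduct_resolvent _ z.1]
  have h3 : (resolvent γ (Matrix.of z.2) *ᵥ w) ⬝ᵥ (resolvent γ (Matrix.of z.2) *ᵥ x) =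
    w ⬝ᵥ resolvent γ (Matrix.of z.2) *ᵥ (resolvent γ (Matrix.of z.2) *ᵥ x) := by
    rw [dotProduct_resolvent _ w]
  rw [h1, fullRes_mulVec hγ, fullRes_mulVec hγ]
  simp only [sub_dotProduct, dotProduct_sub, smul_dotProduct, dotProduct_smul, smul_eq_mul]
  rw [dotProduct_comm (resolvent γ (Matrix.of z.2) *ᵥ w) (resolvent γ (Matrix.of z.2) *ᵥ z.1), h2, h2, h2, h3]
  unfold linQD linQQD quadQQ
  ring

/-- From `sᵀQ₋²s ≤ sᵀQ₋s/γ`; the denominator thus compensates the growth in `s`. -/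
theorem abs_quadQQ_div_le (z : (Fin T → ℝ) × (Fin m → Fin T → ℝ)) :
    |quadQQ γ z / (1 + quadQ γ z)| ≤ 1 / γ := by
  have hD := one_add_quadQ_pos hγ z
  rw [abs_of_nonneg (div_nonneg (quadQQ_nonneg z) hD.le), div_le_iff₀ hD]
  refine (quadQQ_le hγ z).trans ?_
  rw [div_mul_eq_mul_div, one_mul]
  gcongr
  linarith

theorem sum_sq_dotProduct_resolvent_le {n : ℕ} (S : Fin n → Fin T → ℝ) (x : Fin T → ℝ) :
    1 / (T : ℝ) * ∑ i, (S i ⬝ᵥ resolvent γ (Matrix.of S) *ᵥ x) ^ 2 ≤ l2 x ^ 2 / γ := by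
  have h := dotProduct_mulVec_regInv_le hγ (posSemidef_gram (Matrix.of S)) x
  rwa [dotProduct_gram, ← l2_sq, l2_sq_mulVec, ← resolvent_eq] at h

/-- The identity `gram S * Q = I - γQ`, with the Gram matrix written as a sum over the rows.
Averaged over the law, it gives the equation from which the bias is computed. -/
theorem sum_dotProduct_resolvent_eq {n : ℕ} (S : Fin n → Fin T → ℝ) (w x : Fin T → ℝ) :
    1 / (T : ℝ) * ∑ i, (S i ⬝ᵥ w) * (S i ⬝ᵥ resolvent γ (Matrix.of S) *ᵥ x) =
      w ⬝ᵥ x - γ * (w ⬝ᵥ resolvent γ (Matrix.of S) *ᵥ x) := by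
  have h := congrArg (w ⬝ᵥ ·) (mulVec_regInv_add hγ (posSemidef_gram (Matrix.of S)) x)
  simp only [dotProduct_add, dotProduct_smul, smul_eq_mul, dotProduct_gram, ← resolvent_eq] at h
  rw [← h, add_sub_cancel_right]
  rfl

theorem continuous_resolvent {X : Type*} [TopologicalSpace X] {n : ℕ}
    (f : X → Matrix (Fin n) (Fin T) ℝ) (hf : Continuous f) :
    Continuous fun x => resolvent γ (f x) := by
  simp only [resolvent_eq]
  exact continuous_regInv hγ _ (continuous_gram.comp hf) fun x => posSemidef_gram _

theorem polyBdd_linQ (x : Fin T → ℝ) : PolyBdd (linQ (m := m) γ x) := by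
  refine PolyBdd.of_le_l2 ?_ (l2 x / γ) 1 (div_nonneg (l2_nonneg _) hγ.le) fun z => ?_
  · have := continuous_resolvent (T := T) hγ
      (fun z : (Fin T → ℝ) × (Fin m → Fin T → ℝ) => Matrix.of z.2) continuous_snd
    exact continuous_fst.dotProduct (this.matrix_mulVec continuous_const)
  · rw [pow_one, mul_comm]; exact abs_linQ_le hγ x z

theorem polyBdd_linQQ (x : Fin T → ℝ) : PolyBdd (linQQ (m := m) γ x) := by
  refine PolyBdd.of_le_l2 ?_ (l2 x / γ / γ) 1 (by have := l2_nonneg x; positivity) fun z => ?_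
  · have := continuous_resolvent (T := T) hγ
      (fun z : (Fin T → ℝ) × (Fin m → Fin T → ℝ) => Matrix.of z.2) continuous_snd
    exact continuous_fst.dotProduct (this.matrix_mulVec (this.matrix_mulVec continuous_const))
  · rw [pow_one, mul_comm]; exact abs_linQQ_le hγ x z

theorem polyBdd_quadQ : PolyBdd (quadQ (T := T) (m := m) γ) := by
  refine PolyBdd.const_mul _ (PolyBdd.of_le_l2 ?_ (1 / γ) 2 (by positivity) fun z => ?_)
  · have := continuous_resolvent (T := T) hγ
      (fun z : (Fin T → ℝ) × (Fin m → Fin T → ℝ) => Matrix.of z.2) continuous_snd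
    exact continuous_fst.dotProduct (this.matrix_mulVec continuous_fst)
  · refine (abs_linQ_le hγ z.1 z).trans (le_of_eq ?_); ring

theorem polyBdd_quadQQ : PolyBdd (quadQQ (T := T) (m := m) γ) := by
  refine PolyBdd.const_mul _ (PolyBdd.of_le_l2 ?_ (1 / γ / γ) 2 (by positivity) fun z => ?_)
  · have := continuous_resolvent (T := T) hγ
      (fun z : (Fin T → ℝ) × (Fin m → Fin T → ℝ) => Matrix.of z.2) continuous_snd
    exact continuous_fst.dotProduct (this.matrix_mulVec (this.matrix_mulVec continuous_fst))
  · refine (abs_linQQ_le hγ z.1 z).trans (le_of_eq ?_); ring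

theorem polyBdd_inv_one_add_quadQ :
    PolyBdd fun z : (Fin T → ℝ) × (Fin m → Fin T → ℝ) => (1 + quadQ γ z)⁻¹ := by
  refine PolyBdd.of_bounded ((continuous_const.add (polyBdd_quadQ hγ).1).inv₀ fun z =>
    (one_add_quadQ_pos hγ z).ne') 1 fun z => ?_
  rw [abs_of_pos (inv_pos.2 (one_add_quadQ_pos hγ z))]
  exact inv_le_one_of_one_le₀ (by linarith [quadQ_nonneg hγ z])

theorem polyBdd_linQD (x : Fin T → ℝ) : PolyBdd (linQD (m := m) γ x) :=
  (polyBdd_linQ hγ x).mul (polyBdd_inv_one_add_quadQ hγ)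

theorem polyBdd_linQQD (x : Fin T → ℝ) : PolyBdd (linQQD (m := m) γ x) :=
  (polyBdd_linQQ hγ x).mul (polyBdd_inv_one_add_quadQ hγ)

theorem polyBdd_quadQQ_div :
    PolyBdd fun z : (Fin T → ℝ) × (Fin m → Fin T → ℝ) => quadQQ γ z / (1 + quadQ γ z) :=
  (polyBdd_quadQQ hγ).mul (polyBdd_inv_one_add_quadQ hγ)

omit hγ in
theorem polyBdd_fst_dotProduct (w : Fin T → ℝ) :
    PolyBdd fun z : (Fin T → ℝ) × (Fin m → Fin T → ℝ) => z.1 ⬝ᵥ w := by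
  refine PolyBdd.of_le_l2 (continuous_fst.dotProduct continuous_const) (l2 w) 1 (l2_nonneg w)
    fun z => ?_
  rw [pow_one, mul_comm]; exact abs_dotProduct_le _ _

theorem polyBdd_dotProduct_resolvent (w x : Fin T → ℝ) :
    PolyBdd fun z : (Fin T → ℝ) × (Fin m → Fin T → ℝ) => w ⬝ᵥ resolvent γ (Matrix.of z.2) *ᵥ x := by
  refine PolyBdd.of_bounded ?_ (l2 w * l2 x / γ) fun z =>
    abs_dotProduct_regInv_le hγ (posSemidef_gram _) w x
  have := continuous_resolvent (T := T) hγ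
      (fun z : (Fin T → ℝ) × (Fin m → Fin T → ℝ) => Matrix.of z.2) continuous_snd
  exact continuous_const.dotProduct (this.matrix_mulVec continuous_const)

theorem polyBdd_dotProduct_resolvent_sq (w x : Fin T → ℝ) :
    PolyBdd fun z : (Fin T → ℝ) × (Fin m → Fin T → ℝ) =>
      w ⬝ᵥ resolvent γ (Matrix.of z.2) *ᵥ (resolvent γ (Matrix.of z.2) *ᵥ x) := by
  refine PolyBdd.of_bounded ?_ (l2 w * (l2 x / γ / γ)) fun z => ?_
  · have := continuous_resolvent (T := T) hγ
      (fun z : (Fin T → ℝ) × (Fin m → Fin T → ℝ) => Matrix.of z.2) continuous_snd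
    exact continuous_const.dotProduct (this.matrix_mulVec (this.matrix_mulVec continuous_const))
  · refine (abs_dotProduct_le _ _).trans (mul_le_mul_of_nonneg_left ?_ (l2_nonneg _))
    exact (l2_resolvent_le hγ _ _).trans
      (div_le_div_of_nonneg_right (l2_resolvent_le hγ _ x) hγ.le)

theorem polyBdd_dotProduct_fullRes (w x : Fin T → ℝ) :
    PolyBdd fun z : (Fin T → ℝ) × (Fin m → Fin T → ℝ) => w ⬝ᵥ fullRes γ z *ᵥ x := by
  simp only [dotProduct_fullRes hγ]
  exact (polyBdd_dotProduct_resolvent hγ w x).sub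
    (((polyBdd_linQ hγ w).mul (polyBdd_linQD hγ x)).const_mul _)

theorem polyBdd_dotProduct_fullRes_sq (w x : Fin T → ℝ) :
    PolyBdd fun z : (Fin T → ℝ) × (Fin m → Fin T → ℝ) =>
      w ⬝ᵥ fullRes γ z *ᵥ (fullRes γ z *ᵥ x) := by
  simp only [dotProduct_fullRes_sq hγ]
  exact (((polyBdd_dotProduct_resolvent_sq hγ w x).sub
    (((polyBdd_linQ hγ x).mul (polyBdd_linQQD hγ w)).const_mul _)).sub
    (((polyBdd_linQ hγ w).mul (polyBdd_linQQD hγ x)).const_mul _)).add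
    ((((polyBdd_quadQQ_div hγ).mul (polyBdd_linQD hγ w)).mul (polyBdd_linQ hγ x)).const_mul _)

omit hγ

variable {μ : Measure (Fin T → ℝ)} [IsProbabilityMeasure μ]

theorem integral_pi_succ (f : (Fin T → ℝ) × (Fin m → Fin T → ℝ) → ℝ) (i : Fin (m + 1)) :
    ∫ S, f (S i, fun j => S (i.succAbove j)) ∂(Measure.pi fun _ : Fin (m + 1) => μ) =
      ∫ z, f z ∂(μ.prod (Measure.pi fun _ : Fin m => μ)) := by
  have h := measurePreserving_piFinSuccAbove (fun _ : Fin (m + 1) => μ) i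
  exact h.integral_comp' f

theorem integrable_pi_succ {f : (Fin T → ℝ) × (Fin m → Fin T → ℝ) → ℝ}
    (hf : Integrable f (μ.prod (Measure.pi fun _ : Fin m => μ))) (i : Fin (m + 1)) :
    Integrable (fun S : Fin (m + 1) → Fin T → ℝ => f (S i, fun j => S (i.succAbove j)))
      (Measure.pi fun _ : Fin (m + 1) => μ) := by
  have h := measurePreserving_piFinSuccAbove (fun _ : Fin (m + 1) => μ) i
  exact h.integrable_comp_of_integrable hf

/-- Exchangeability of the rows. -/
theorem integral_sum_pi_succ {f : (Fin T → ℝ) × (Fin m → Fin T → ℝ) → ℝ}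
    (hf : Integrable f (μ.prod (Measure.pi fun _ : Fin m => μ))) :
    ((m + 1 : ℕ) : ℝ) / T * ∫ z, f z ∂(μ.prod (Measure.pi fun _ : Fin m => μ)) =
      ∫ S, 1 / (T : ℝ) * ∑ i, f (S i, fun j => S (i.succAbove j))
        ∂(Measure.pi fun _ : Fin (m + 1) => μ) := by
  rw [integral_const_mul, integral_finsetSum _ fun i _ => integrable_pi_succ hf i]
  simp only [integral_pi_succ, Finset.sum_const, Finset.card_univ, Fintype.card_fin, nsmul_eq_mul]
  ring

/-- By exchangeability the left side is the mean of `(1/T) ∑ᵢ (sᵢᵀQx)²`, which is bounded for every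
realization. No bound on the mean or covariance of a row enters. -/
theorem mul_integral_linQD_sq_le (hγ : 0 < γ) (hμ : ∀ q : ℕ, MemLp l2 q μ) (x : Fin T → ℝ) :
    ((m + 1 : ℕ) : ℝ) / T * ∫ z, linQD γ x z ^ 2 ∂(μ.prod (Measure.pi fun _ : Fin m => μ)) ≤
      l2 x ^ 2 / γ := by
  have hi := ((polyBdd_linQD (m := m) hγ x).pow 2).integrable
    (ν := Measure.pi fun _ : Fin m => μ) hμ
  rw [integral_sum_pi_succ hi]
  have : ∀ S : Fin (m + 1) → Fin T → ℝ,
      1 / (T : ℝ) * ∑ i, linQD γ x (S i, fun j => S (i.succAbove j)) ^ 2 ≤ l2 x ^ 2 / γ := by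
    intro S
    simp only [← fst_dotProduct_fullRes hγ, fullRes_eq_resolvent]
    exact sum_sq_dotProduct_resolvent_le hγ S x
  refine (integral_mono ((integrable_finsetSum _ fun i _ =>
    integrable_pi_succ hi i).const_mul _) (integrable_const (l2 x ^ 2 / γ)) this).trans ?_
  simp

/-- The same argument applied to `Qx` in place of `x`, whose norm is at most `‖x‖/γ`. -/
theorem mul_integral_fullRes_sq_sq_le (hγ : 0 < γ) (hμ : ∀ q : ℕ, MemLp l2 q μ)
    (x : Fin T → ℝ) :
    ((m + 1 : ℕ) : ℝ) / T * ∫ z, (z.1 ⬝ᵥ fullRes γ z *ᵥ (fullRes γ z *ᵥ x)) ^ 2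
      ∂(μ.prod (Measure.pi fun _ : Fin m => μ)) ≤ l2 x ^ 2 / γ ^ 3 := by
  have hp : PolyBdd fun z : (Fin T → ℝ) × (Fin m → Fin T → ℝ) =>
      (z.1 ⬝ᵥ fullRes γ z *ᵥ (fullRes γ z *ᵥ x)) ^ 2 := by
    simp only [fst_dotProduct_fullRes_sq hγ]
    exact ((polyBdd_linQQD hγ x).sub ((polyBdd_quadQQ_div hγ).mul (polyBdd_linQD hγ x))).pow 2
  have hi := hp.integrable (ν := Measure.pi fun _ : Fin m => μ) hμ
  rw [integral_sum_pi_succ hi]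
  have : ∀ S : Fin (m + 1) → Fin T → ℝ,
      1 / (T : ℝ) * ∑ i, (S i ⬝ᵥ fullRes γ (S i, fun j => S (i.succAbove j)) *ᵥ
        (fullRes γ (S i, fun j => S (i.succAbove j)) *ᵥ x)) ^ 2 ≤ l2 x ^ 2 / γ ^ 3 := by
    intro S
    simp only [fullRes_eq_resolvent]
    have h1 := sum_sq_dotProduct_resolvent_le hγ S (resolvent γ (Matrix.of S) *ᵥ x)
    have h2 := l2_resolvent_le hγ (Matrix.of S) x
    have h3 : l2 (resolvent γ (Matrix.of S) *ᵥ x) ^ 2 / γ ≤ (l2 x / γ) ^ 2 / γ := by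
      have := l2_nonneg (resolvent γ (Matrix.of S) *ᵥ x)
      gcongr
    exact h1.trans (h3.trans (le_of_eq (by field_simp)))
  refine (integral_mono ((integrable_finsetSum _ fun i _ =>
    integrable_pi_succ hi i).const_mul _) (integrable_const (l2 x ^ 2 / γ ^ 3)) this).trans ?_
  simp

theorem mul_integral_dotProduct_linQD (hγ : 0 < γ) (hμ : ∀ q : ℕ, MemLp l2 q μ)
    (w x : Fin T → ℝ) :
    ((m + 1 : ℕ) : ℝ) / T * ∫ z, (z.1 ⬝ᵥ w) * linQD γ x z
      ∂(μ.prod (Measure.pi fun _ : Fin m => μ)) =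
      w ⬝ᵥ x - γ * ∫ z, w ⬝ᵥ fullRes γ z *ᵥ x ∂(μ.prod (Measure.pi fun _ : Fin m => μ)) := by
  have hi := ((polyBdd_fst_dotProduct w).mul (polyBdd_linQD (m := m) hγ x)).integrable
    (ν := Measure.pi fun _ : Fin m => μ) hμ
  have hi2 := (polyBdd_dotProduct_fullRes (m := m) hγ w x).integrable
    (ν := Measure.pi fun _ : Fin m => μ) hμ
  rw [integral_sum_pi_succ hi]
  have : ∀ S : Fin (m + 1) → Fin T → ℝ,
      1 / (T : ℝ) * ∑ i, (S i ⬝ᵥ w) * linQD γ x (S i, fun j => S (i.succAbove j)) =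
      w ⬝ᵥ x - γ * (w ⬝ᵥ fullRes γ (S 0, fun j => S ((0 : Fin (m + 1)).succAbove j)) *ᵥ x) := by
    intro S
    simp only [← fst_dotProduct_fullRes hγ, fullRes_eq_resolvent]
    exact sum_dotProduct_resolvent_eq hγ S w x
  simp only [this]
  rw [integral_sub (integrable_const _) ((integrable_pi_succ hi2 0).const_mul _),
    integral_const_mul, integral_pi_succ (fun z => w ⬝ᵥ fullRes γ z *ᵥ x) 0]
  simp

theorem mul_integral_dotProduct_fullRes_sq (hγ : 0 < γ) (hμ : ∀ q : ℕ, MemLp l2 q μ)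
    (w x : Fin T → ℝ) :
    ((m + 1 : ℕ) : ℝ) / T * ∫ z, (z.1 ⬝ᵥ w) * (z.1 ⬝ᵥ fullRes γ z *ᵥ (fullRes γ z *ᵥ x))
      ∂(μ.prod (Measure.pi fun _ : Fin m => μ)) =
      (∫ z, w ⬝ᵥ fullRes γ z *ᵥ x ∂(μ.prod (Measure.pi fun _ : Fin m => μ))) -
      γ * ∫ z, w ⬝ᵥ fullRes γ z *ᵥ (fullRes γ z *ᵥ x)
        ∂(μ.prod (Measure.pi fun _ : Fin m => μ)) := by
  have hp : PolyBdd fun z : (Fin T → ℝ) × (Fin m → Fin T → ℝ) =>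
      (z.1 ⬝ᵥ w) * (z.1 ⬝ᵥ fullRes γ z *ᵥ (fullRes γ z *ᵥ x)) := by
    simp only [fst_dotProduct_fullRes_sq hγ]
    exact (polyBdd_fst_dotProduct w).mul
      ((polyBdd_linQQD hγ x).sub ((polyBdd_quadQQ_div hγ).mul (polyBdd_linQD hγ x)))
  have hi := hp.integrable (ν := Measure.pi fun _ : Fin m => μ) hμ
  have hi1 := (polyBdd_dotProduct_fullRes (m := m) hγ w x).integrable
    (ν := Measure.pi fun _ : Fin m => μ) hμ
  have hi2 := (polyBdd_dotProduct_fullRes_sq (m := m) hγ w x).integrable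
    (ν := Measure.pi fun _ : Fin m => μ) hμ
  rw [integral_sum_pi_succ hi]
  have : ∀ S : Fin (m + 1) → Fin T → ℝ,
      1 / (T : ℝ) * ∑ i, (S i ⬝ᵥ w) * (S i ⬝ᵥ fullRes γ (S i, fun j => S (i.succAbove j)) *ᵥ
        (fullRes γ (S i, fun j => S (i.succAbove j)) *ᵥ x)) =
      w ⬝ᵥ fullRes γ (S 0, fun j => S ((0 : Fin (m + 1)).succAbove j)) *ᵥ x -
      γ * (w ⬝ᵥ fullRes γ (S 0, fun j => S ((0 : Fin (m + 1)).succAbove j)) *ᵥ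
        (fullRes γ (S 0, fun j => S ((0 : Fin (m + 1)).succAbove j)) *ᵥ x)) := by
    intro S
    simp only [fullRes_eq_resolvent]
    exact sum_dotProduct_resolvent_eq hγ S w _
  simp only [this]
  rw [integral_sub (integrable_pi_succ hi1 0) ((integrable_pi_succ hi2 0).const_mul _),
    integral_const_mul, integral_pi_succ (fun z => w ⬝ᵥ fullRes γ z *ᵥ x) 0,
    integral_pi_succ (fun z => w ⬝ᵥ fullRes γ z *ᵥ (fullRes γ z *ᵥ x)) 0]

end LeaveOneOut

/-! ### Moment estimates for a row satisfying concentration. -/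

/-- The properties of the law `μ` of a row of the matrix of features used in the analysis of the
resolvent: concentration of Lipschitz functions of one row and of `m` independent rows, and a
bound for the second moment, together with bounds for the aspect ratio. -/
structure IsFeatureLaw (M κ : ℝ) (C : ℕ → ℝ) (T m : ℕ) (μ : Measure (Fin T → ℝ)) : Prop where
  T_pos : 0 < T
  conc : Conc μ (fun x y => l2 (x - y)) C
  conc_pi : Conc (Measure.pi fun _ : Fin m => μ) (fun R R' => fro (R - R')) C
  second_moment : ∫ s, l2 s ^ 2 ∂μ ≤ M * T
  ratio_le : ((m + 1 : ℕ) : ℝ) / T ≤ κ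
  inv_ratio_le : T / ((m + 1 : ℕ) : ℝ) ≤ κ

open scoped MatrixOrder Matrix.Norms.L2Operator in
theorem exists_sq_eq_quadForm {ι : Type*} [Fintype ι] {A : Matrix ι ι ℝ} (hA : A.PosSemidef) :
    ∃ B : Matrix ι ι ℝ, ∀ z : ι → ℝ, z ⬝ᵥ A *ᵥ z = l2 (B *ᵥ z) ^ 2 := by
  classical
  obtain ⟨B, rfl⟩ := CStarAlgebra.nonneg_iff_eq_star_mul_self.mp hA.nonneg
  refine ⟨B, fun z => ?_⟩
  rw [Matrix.star_eq_conjTranspose, ← Matrix.mulVec_mulVec, Matrix.dotProduct_mulVec,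
    Matrix.conjTranspose_eq_transpose_of_trivial, Matrix.vecMul_transpose, l2_sq]

/-- With `A = BᵀB` the square root of the form is `‖Bx‖`, a seminorm. A quadratic form is not
Lipschitz but its root is, so concentration applies to the root. -/
theorem abs_sqrt_quadForm_sub_le {ι : Type*} [Fintype ι] {A : Matrix ι ι ℝ}
    (hA : A.PosSemidef) {a : ℝ} (hAa : ∀ x, x ⬝ᵥ A *ᵥ x ≤ a * l2 x ^ 2) (ha : 0 ≤ a)
    (x y : ι → ℝ) : |√(x ⬝ᵥ A *ᵥ x) - √(y ⬝ᵥ A *ᵥ y)| ≤ √a * l2 (x - y) := by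
  obtain ⟨B, h⟩ := exists_sq_eq_quadForm hA
  rw [h, h, Real.sqrt_sq (l2_nonneg _), Real.sqrt_sq (l2_nonneg _)]
  refine (abs_l2_sub_l2_le _ _).trans ?_
  rw [← Matrix.mulVec_sub]
  refine le_of_sq_le_sq_of_nonneg ?_ (mul_nonneg (Real.sqrt_nonneg _) (l2_nonneg _))
  rw [← h, mul_pow, Real.sq_sqrt ha]
  exact hAa _

section Law

variable {γ M κ : ℝ} {C : ℕ → ℝ} {T m : ℕ} {μ : Measure (Fin T → ℝ)} [IsProbabilityMeasure μ]

omit [IsProbabilityMeasure μ] in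
theorem Conc.memLp_l2 (h : Conc μ (fun x y => l2 (x - y)) C) (q : ℕ) : MemLp l2 q μ :=
  (h l2 1 continuous_l2.measurable zero_le_one fun x y => by
    simpa using abs_l2_sub_l2_le x y).1 q

theorem Conc.integrable_l2_pow (h : Conc μ (fun x y => l2 (x - y)) C) (q : ℕ) :
    Integrable (fun s => l2 s ^ q) μ := by
  refine (h.memLp_l2 q).integrable_norm_pow'.congr (Eventually.of_forall fun s => ?_)
  simp only [Real.norm_of_nonneg (l2_nonneg s)]

theorem integrable_pow_of_memLp {f : (Fin T → ℝ) → ℝ} (h : ∀ q : ℕ, MemLp f q μ) (c : ℝ) (k : ℕ) :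
    Integrable (fun s => (f s - c) ^ (2 * k)) μ := by
  refine ((h (2 * k)).sub (memLp_const c)).integrable_norm_pow'.congr
    (Eventually.of_forall fun s => ?_)
  simp [pow_mul, sq_abs]

omit [IsProbabilityMeasure μ] in
theorem Conc.linear (h : Conc μ (fun x y => l2 (x - y)) C) (v : Fin T → ℝ) :
    (∀ q : ℕ, MemLp (fun s => s ⬝ᵥ v) q μ) ∧ ∀ k : ℕ,
      ∫ s, (s ⬝ᵥ v - ∫ y, y ⬝ᵥ v ∂μ) ^ (2 * k) ∂μ ≤ C k * l2 v ^ (2 * k) := by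
  refine h (fun s => s ⬝ᵥ v) (l2 v) ?_ (l2_nonneg v) fun x y => ?_
  · exact (continuous_id.dotProduct continuous_const).measurable
  · rw [← sub_dotProduct, mul_comm]
    exact abs_dotProduct_le _ _

/-- The variance is controlled by concentration. The squared mean must be kept, since the mean of a
row is not assumed small. -/
theorem Conc.integral_linear_sq_le (h : Conc μ (fun x y => l2 (x - y)) C) (v : Fin T → ℝ) :
    ∫ s, (s ⬝ᵥ v) ^ 2 ∂μ ≤ C 1 * l2 v ^ 2 + (∫ s, s ⬝ᵥ v ∂μ) ^ 2 := by
  obtain ⟨h1, h2⟩ := h.linear v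
  have h3 := h2 1
  have hi : Integrable (fun s => s ⬝ᵥ v) μ := (h1 1).integrable (by simp)
  have hi2 : Integrable (fun s => (s ⬝ᵥ v) ^ 2) μ := by
    simpa using integrable_pow_of_memLp h1 0 1
  set e := ∫ s, s ⬝ᵥ v ∂μ with he
  have h4 : ∫ s, (s ⬝ᵥ v - e) ^ (2 * 1) ∂μ = ∫ s, (s ⬝ᵥ v) ^ 2 ∂μ - e ^ 2 := by
    have : ∀ s : Fin T → ℝ, (s ⬝ᵥ v - e) ^ (2 * 1) = (s ⬝ᵥ v) ^ 2 - (2 * e) * (s ⬝ᵥ v) + e ^ 2 :=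
      fun s => by ring
    simp only [this]
    have i1 : Integrable (fun s : Fin T → ℝ => (s ⬝ᵥ v) ^ 2 - (2 * e) * (s ⬝ᵥ v)) μ :=
      hi2.sub (hi.const_mul _)
    rw [integral_add i1 (integrable_const _), integral_sub hi2 (hi.const_mul _),
      integral_const_mul, ← he]
    simp only [integral_const, probReal_univ, smul_eq_mul, one_mul]
    ring
  rw [h4, mul_one] at h3
  linarith

theorem integral_pow_four_le {f : (Fin T → ℝ) → ℝ} (h : ∀ q : ℕ, MemLp f q μ) (c : ℝ) :
    ∫ s, f s ^ 4 ∂μ ≤ 8 * (∫ s, (f s - c) ^ 4 ∂μ + c ^ 4) := by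
  have hi := integrable_pow_of_memLp h c 2
  have hi0 := integrable_pow_of_memLp h 0 2
  simp only [Nat.reduceMul, sub_zero] at hi hi0
  calc _ ≤ ∫ s, 8 * ((f s - c) ^ 4 + c ^ 4) ∂μ := by
        refine integral_mono hi0 ((hi.add (integrable_const _)).const_mul _) fun s => ?_
        have := add_pow_four_le (f s - c) c
        rwa [sub_add_cancel] at this
    _ = _ := by
        rw [integral_const_mul, integral_add hi (integrable_const _)]
        simp

theorem Conc.integral_linear_pow_four_le (h : Conc μ (fun x y => l2 (x - y)) C)
    (v : Fin T → ℝ) :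
    ∫ s, (s ⬝ᵥ v) ^ 4 ∂μ ≤ 8 * (C 2 * l2 v ^ 4 + (∫ s, (s ⬝ᵥ v) ^ 2 ∂μ) ^ 2) := by
  obtain ⟨h1, h2⟩ := h.linear v
  have h3 := h2 2
  have hi : Integrable (fun s => s ⬝ᵥ v) μ := (h1 1).integrable (by simp)
  have hi2 := integrable_pow_of_memLp h1 0 1
  simp only [mul_one, sub_zero] at hi2
  have h4 := integral_pow_four_le h1 (∫ s, s ⬝ᵥ v ∂μ)
  have h5 := pow_integral_le hi 1 (by simpa using hi2)
  simp only [mul_one] at h5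
  have h6 : (∫ s, s ⬝ᵥ v ∂μ) ^ 4 ≤ (∫ s, (s ⬝ᵥ v) ^ 2 ∂μ) ^ 2 := by
    have := pow_le_pow_left₀ (sq_nonneg _) h5 2
    rwa [← pow_mul] at this
  simp only [Nat.reduceMul] at h3
  linarith

theorem Conc.integral_l2_pow_four_le (h : Conc μ (fun x y => l2 (x - y)) C) {B : ℝ}
    (hB : ∫ s, l2 s ^ 2 ∂μ ≤ B) :
    ∫ s, l2 s ^ 4 ∂μ ≤ 8 * (C 2 + B ^ 2) := by
  have h2 := (h l2 1 continuous_l2.measurable zero_le_one fun x y => by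
    simpa using abs_l2_sub_l2_le x y).2 2
  have h1 := h.memLp_l2
  have hi : Integrable (l2 : (Fin T → ℝ) → ℝ) μ := (h1 1).integrable (by simp)
  have h4 := integral_pow_four_le h1 (∫ s, l2 s ∂μ)
  have h5 := pow_integral_le hi 1 (by simpa using h.integrable_l2_pow 2)
  simp only [mul_one] at h5
  have h6 : (∫ s, l2 s ∂μ) ^ 4 ≤ B ^ 2 := by
    have := pow_le_pow_left₀ (sq_nonneg _) (h5.trans hB) 2
    rwa [← pow_mul] at this
  simp only [Nat.reduceMul, one_pow, mul_one] at h2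
  linarith

/-- Concentration of quadratic forms. -/
theorem Conc.quadForm (h : Conc μ (fun x y => l2 (x - y)) C) {A : Matrix (Fin T) (Fin T) ℝ}
    (hA : A.PosSemidef) {a b : ℝ} (hAa : ∀ x, x ⬝ᵥ A *ᵥ x ≤ a * l2 x ^ 2) (ha : 0 ≤ a)
    (hb : ∫ s, s ⬝ᵥ A *ᵥ s ∂μ ≤ b) :
    ∫ s, (s ⬝ᵥ A *ᵥ s - ∫ y, y ⬝ᵥ A *ᵥ y ∂μ) ^ 4 ∂μ ≤
      128 * (16 * b ^ 2 * a ^ 2 * C 2 + a ^ 4 * C 4) := by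
  set G : (Fin T → ℝ) → ℝ := fun s => √(s ⬝ᵥ A *ᵥ s) with hG
  have hq : Continuous fun s : Fin T → ℝ => s ⬝ᵥ A *ᵥ s :=
    continuous_id.dotProduct (continuous_const.matrix_mulVec continuous_id)
  have hGc : Continuous G := hq.sqrt
  have hGsq : ∀ s, s ⬝ᵥ A *ᵥ s = G s ^ 2 := fun s =>
    (Real.sq_sqrt (dotProduct_mulVec_nonneg hA s)).symm
  obtain ⟨h1, h2⟩ := h G (√a) hGc.measurable (Real.sqrt_nonneg _)
    (abs_sqrt_quadForm_sub_le hA hAa ha)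
  have hGi : Integrable G μ := (h1 1).integrable (by simp)
  set e := ∫ s, G s ∂μ with he
  have ha4 : √a ^ 4 = a ^ 2 := by
    rw [show 4 = 2 * 2 from rfl, pow_mul, Real.sq_sqrt ha]
  have ha8 : √a ^ 8 = a ^ 4 := by
    rw [show 8 = 2 * 4 from rfl, pow_mul, Real.sq_sqrt ha]
  have h4 := h2 2
  have h8 := h2 4
  simp only [Nat.reduceMul, ha4, ha8] at h4 h8
  have hi4 := integrable_pow_of_memLp h1 e 2
  have hi8 := integrable_pow_of_memLp h1 e 4
  have hi2 := integrable_pow_of_memLp h1 0 1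
  simp only [Nat.reduceMul, sub_zero] at hi4 hi8 hi2
  have he2 : e ^ 2 ≤ b := by
    have := pow_integral_le hGi 1 (by simpa using hi2)
    simp only [mul_one] at this
    refine this.trans ?_
    simpa only [← hGsq] using hb
  have he4 : e ^ 4 ≤ b ^ 2 := by
    have := pow_le_pow_left₀ (sq_nonneg _) he2 2
    rwa [← pow_mul] at this
  -- `G² - e² = 2e(G - e) + (G - e)²`: the first term brings the fourth moment of the root times `e⁴
  -- ≤ b²`, the second its eighth moment.
  have hpt : ∀ s, (G s ^ 2 - e ^ 2) ^ 4 ≤ 8 * (16 * e ^ 4 * (G s - e) ^ 4 + (G s - e) ^ 8) := by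
    intro s
    have := add_pow_four_le (2 * e * (G s - e)) ((G s - e) ^ 2)
    calc _ = (2 * e * (G s - e) + (G s - e) ^ 2) ^ 4 := by ring
      _ ≤ _ := this
      _ = _ := by ring
  have hdom : Integrable (fun s => 8 * (16 * e ^ 4 * (G s - e) ^ 4 + (G s - e) ^ 8)) μ :=
    ((hi4.const_mul _).add hi8).const_mul _
  have hint : Integrable (fun s => (G s ^ 2 - e ^ 2) ^ 4) μ := by
    refine hdom.mono' (by fun_prop) (Eventually.of_forall fun s => ?_)
    rw [Real.norm_of_nonneg (by positivity)]
    exact hpt s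
  have hbd : ∫ s, (G s ^ 2 - e ^ 2) ^ 4 ∂μ ≤ 8 * (16 * b ^ 2 * a ^ 2 * C 2 + a ^ 4 * C 4) := by
    refine (integral_mono hint hdom hpt).trans ?_
    rw [integral_const_mul, integral_add (hi4.const_mul _) hi8, integral_const_mul]
    have h9 : 16 * e ^ 4 * ∫ s, (G s - e) ^ 4 ∂μ ≤ 16 * b ^ 2 * (C 2 * a ^ 2) :=
      mul_le_mul (by linarith) h4 (integral_nonneg fun s => by positivity) (by positivity)
    linarith
  simp only [hGsq]
  have := integral_sub_integral_pow_four_le hi2 (e ^ 2) hint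
  linarith

theorem continuous_fro {n : ℕ} : Continuous fun R : Fin n → Fin T → ℝ => fro R := by
  unfold fro
  exact continuous_l2.comp (continuous_pi fun i => continuous_l2.comp (continuous_apply i))

/-- Concentration of quadratic forms in a row, whose matrix depends on the other rows. -/
theorem Conc.quadForm_prod (h : Conc μ (fun x y => l2 (x - y)) C)
    (hpi : Conc (Measure.pi fun _ : Fin m => μ) (fun R R' => fro (R - R')) C) {B : ℝ}
    (hB : ∫ s, l2 s ^ 2 ∂μ ≤ B)
    {A : (Fin m → Fin T → ℝ) → Matrix (Fin T) (Fin T) ℝ} (hAc : Continuous A)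
    (hA : ∀ R, (A R).PosSemidef) {a l : ℝ} (ha : 0 ≤ a) (hl : 0 ≤ l)
    (hAa : ∀ R x, x ⬝ᵥ A R *ᵥ x ≤ a * l2 x ^ 2)
    (hAl : ∀ R R' x, |x ⬝ᵥ A R *ᵥ x - x ⬝ᵥ A R' *ᵥ x| ≤ l * l2 x ^ 2 * fro (R - R')) :
    ∫ z, (z.1 ⬝ᵥ A z.2 *ᵥ z.1 -
      ∫ z, z.1 ⬝ᵥ A z.2 *ᵥ z.1 ∂(μ.prod (Measure.pi fun _ : Fin m => μ))) ^ 4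
      ∂(μ.prod (Measure.pi fun _ : Fin m => μ)) ≤
      8 * (128 * (16 * (a * B) ^ 2 * a ^ 2 * C 2 + a ^ 4 * C 4) + C 2 * (l * B) ^ 4) := by
  set ν := Measure.pi fun _ : Fin m => μ
  have hμ := h.memLp_l2
  have hB0 : 0 ≤ B := le_trans (integral_nonneg fun s => sq_nonneg _) hB
  have hAabs : ∀ R x, |x ⬝ᵥ A R *ᵥ x| ≤ a * l2 x ^ 2 := fun R x => by
    rw [abs_of_nonneg (dotProduct_mulVec_nonneg (hA R) x)]; exact hAa R x
  have hq : PolyBdd fun z : (Fin T → ℝ) × (Fin m → Fin T → ℝ) => z.1 ⬝ᵥ A z.2 *ᵥ z.1 := by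
    refine PolyBdd.of_le_l2 (continuous_fst.dotProduct
      ((hAc.comp continuous_snd).matrix_mulVec continuous_fst)) a 2 ha fun z => hAabs _ _
  -- `f` is the mean of the form with the other rows frozen. The deviation splits into that of the
  -- form from `f`, by concentration in `s`, and that of `f` from its mean, by concentration in the
  -- other rows, on which `f` depends in a Lipschitz way.
  set f : (Fin m → Fin T → ℝ) → ℝ := fun R => ∫ s, s ⬝ᵥ A R *ᵥ s ∂μ with hf
  have hsl : ∀ R, Integrable (fun s => s ⬝ᵥ A R *ᵥ s) μ := fun R => hq.integrable_left hμ R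
  have hfl : ∀ R R', |f R - f R'| ≤ l * B * fro (R - R') := by
    intro R R'
    rw [hf]
    dsimp only
    rw [← integral_sub (hsl R) (hsl R')]
    have hpt : ∀ s, ‖s ⬝ᵥ A R *ᵥ s - s ⬝ᵥ A R' *ᵥ s‖ ≤ l * fro (R - R') * l2 s ^ 2 := fun s =>
      (hAl R R' s).trans (le_of_eq (by ring))
    refine (norm_integral_le_of_norm_le ((h.integrable_l2_pow 2).const_mul (l * fro (R - R')))
      (Eventually.of_forall hpt)).trans ?_
    rw [integral_const_mul]
    have := mul_le_mul_of_nonneg_left hB (mul_nonneg hl (fro_nonneg (R - R')))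
    linarith
  have hfc : Continuous f := by
    refine continuous_iff_continuousAt.2 fun R => ?_
    rw [ContinuousAt, tendsto_iff_norm_sub_tendsto_zero]
    have h0 : Tendsto (fun R' => l * B * fro (R' - R)) (𝓝 R) (𝓝 0) := by
      have : Continuous fun R' : Fin m → Fin T → ℝ => l * B * fro (R' - R) :=
        (continuous_fro.comp (continuous_id.sub continuous_const)).const_mul (l * B)
      convert this.tendsto R using 2
      have h2 : l2 (0 : Fin m → ℝ) = 0 := by simp [l2]
      have h3 : l2 (0 : Fin T → ℝ) = 0 := by simp [l2]
      rw [sub_self, fro]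
      simp only [Pi.zero_apply, h3]
      rw [show (fun _ : Fin m => (0 : ℝ)) = 0 from rfl, h2, mul_zero]
    exact squeeze_zero (fun R' => norm_nonneg _) (fun R' => hfl R' R) h0
  obtain ⟨hf1, hf2⟩ := hpi f (l * B) hfc.measurable (mul_nonneg hl hB0) hfl
  have hf4 := hf2 2
  simp only [Nat.reduceMul] at hf4
  set α := ∫ z, z.1 ⬝ᵥ A z.2 *ᵥ z.1 ∂(μ.prod ν) with hα
  have hαf : α = ∫ R, f R ∂ν := integral_prod_symm _ (hq.integrable hμ)
  have hfb : ∀ R, |f R| ≤ a * B := fun R => by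
    have hpt : ∀ s, ‖s ⬝ᵥ A R *ᵥ s‖ ≤ a * l2 s ^ 2 := hAabs R
    refine (norm_integral_le_of_norm_le ((h.integrable_l2_pow 2).const_mul a)
      (Eventually.of_forall hpt)).trans ?_
    rw [integral_const_mul]
    exact mul_le_mul_of_nonneg_left hB ha
  have hfp : PolyBdd fun z : (Fin T → ℝ) × (Fin m → Fin T → ℝ) => f z.2 :=
    PolyBdd.of_bounded (hfc.comp continuous_snd) (a * B) fun z => hfb z.2
  have hg1 := ((hq.sub hfp).pow 4)
  have hg2 := ((hfp.sub (PolyBdd.const α)).pow 4)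
  calc _ ≤ ∫ z, 8 * ((z.1 ⬝ᵥ A z.2 *ᵥ z.1 - f z.2) ^ 4 + (f z.2 - α) ^ 4) ∂(μ.prod ν) := by
        refine integral_mono (((hq.sub (PolyBdd.const α)).pow 4).integrable hμ)
          ((((hq.sub hfp).pow 4).add hg2).const_mul 8 |>.integrable hμ) fun z => ?_
        have := add_pow_four_le (z.1 ⬝ᵥ A z.2 *ᵥ z.1 - f z.2) (f z.2 - α)
        rwa [sub_add_sub_cancel] at this
    _ = 8 * (∫ z, (z.1 ⬝ᵥ A z.2 *ᵥ z.1 - f z.2) ^ 4 ∂(μ.prod ν) +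
          ∫ z, (f z.2 - α) ^ 4 ∂(μ.prod ν)) := by
        rw [integral_const_mul, integral_add (hg1.integrable hμ) (hg2.integrable hμ)]
    _ ≤ _ := by
        have e2 : ∫ z : (Fin T → ℝ) × (Fin m → Fin T → ℝ), (f z.2 - α) ^ 4 ∂(μ.prod ν) ≤
            C 2 * (l * B) ^ 4 := by
          rw [integral_prod_symm _ (hg2.integrable hμ)]
          simp only [integral_const, probReal_univ, smul_eq_mul, one_mul]
          rw [hαf]
          exact hf4
        have e1 : ∫ z, (z.1 ⬝ᵥ A z.2 *ᵥ z.1 - f z.2) ^ 4 ∂(μ.prod ν) ≤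
            128 * (16 * (a * B) ^ 2 * a ^ 2 * C 2 + a ^ 4 * C 4) := by
          rw [integral_prod_symm _ (hg1.integrable hμ)]
          refine (integral_mono (hg1.integrable hμ).integral_prod_right
            (integrable_const (128 * (16 * (a * B) ^ 2 * a ^ 2 * C 2 + a ^ 4 * C 4)))
            fun R => ?_).trans (by simp)
          exact h.quadForm (hA R) (hAa R) ha ((le_abs_self _).trans (hfb R))
        linarith

/-- A row and the others have finite moments: the bound for `1 + sᵀ Q₋ s / T`. -/
theorem IsFeatureLaw.integral_one_add_quadQ_sq_le (h : IsFeatureLaw M κ C T m μ) (hγ : 0 < γ)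
    (hC : ∀ k, 0 ≤ C k) (R : Fin m → Fin T → ℝ) :
    ∫ s, (1 + quadQ γ (s, R)) ^ 2 ∂μ ≤ 2 + 16 * (C 2 + M ^ 2) / γ ^ 2 := by
  have hT : (1 : ℝ) ≤ T := by exact_mod_cast h.T_pos
  have h4 := h.conc.integral_l2_pow_four_le h.second_moment
  have hi := h.conc.integrable_l2_pow 4
  have hp : PolyBdd fun z : (Fin T → ℝ) × (Fin m → Fin T → ℝ) => (1 + quadQ γ z) ^ 2 :=
    ((PolyBdd.const 1).add (polyBdd_quadQ hγ)).pow 2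
  calc _ ≤ ∫ s, (2 + 2 / (T * γ) ^ 2 * l2 s ^ 4) ∂μ := by
        refine integral_mono (hp.integrable_left h.conc.memLp_l2 R)
          ((integrable_const _).add (hi.const_mul _)) fun s => ?_
        have h1 : quadQ γ (s, R) ≤ l2 s ^ 2 / (T * γ) := by
          have := dotProduct_regInv_le hγ (posSemidef_gram (Matrix.of R)) s
          calc quadQ γ (s, R) = 1 / (T : ℝ) * (s ⬝ᵥ resolvent γ (Matrix.of R) *ᵥ s) := rfl
            _ ≤ 1 / (T : ℝ) * (l2 s ^ 2 / γ) := mul_le_mul_of_nonneg_left this (by positivity)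
            _ = _ := by field_simp
        have h0 := quadQ_nonneg hγ (s, R)
        have h2 : quadQ γ (s, R) ^ 2 ≤ (l2 s ^ 2 / (T * γ)) ^ 2 := pow_le_pow_left₀ h0 h1 2
        have e : 2 / (T * γ) ^ 2 * l2 s ^ 4 = 2 * (l2 s ^ 2 / (T * γ)) ^ 2 := by
          field_simp
        dsimp only
        rw [e]
        nlinarith [sq_nonneg (1 - quadQ γ (s, R))]
    _ = 2 + 2 / (T * γ) ^ 2 * ∫ s, l2 s ^ 4 ∂μ := by
        rw [integral_add (integrable_const _) (hi.const_mul _), integral_const_mul]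
        simp
    _ ≤ 2 + 2 / (T * γ) ^ 2 * (8 * (C 2 * T ^ 2 + (M * T) ^ 2)) := by
        have hc : C 2 ≤ C 2 * (T : ℝ) ^ 2 := le_mul_of_one_le_right (hC 2) (one_le_pow₀ hT)
        gcongr
        linarith
    _ = _ := by field_simp; ring

omit [IsProbabilityMeasure μ] in
theorem IsFeatureLaw.integral_le_of_mul_le (h : IsFeatureLaw M κ C T m μ) {x y : ℝ} (hy : 0 ≤ y)
    (hxy : ((m + 1 : ℕ) : ℝ) / T * x ≤ y) : x ≤ κ * y := by
  have hT : (0 : ℝ) < T := by exact_mod_cast h.T_pos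
  have hm : (0 : ℝ) < ((m + 1 : ℕ) : ℝ) := by positivity
  have h1 : x ≤ T / ((m + 1 : ℕ) : ℝ) * y := by
    rw [div_mul_eq_mul_div, le_div_iff₀ hm]
    rw [div_mul_eq_mul_div, div_le_iff₀ hT] at hxy
    linarith
  exact h1.trans (mul_le_mul_of_nonneg_right h.inv_ratio_le hy)

theorem IsFeatureLaw.integral_linQD_sq_le (h : IsFeatureLaw M κ C T m μ) (hγ : 0 < γ)
    (x : Fin T → ℝ) :
    ∫ z, linQD γ x z ^ 2 ∂(μ.prod (Measure.pi fun _ : Fin m => μ)) ≤ κ / γ * l2 x ^ 2 := by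
  refine (h.integral_le_of_mul_le (by positivity)
    (mul_integral_linQD_sq_le hγ h.conc.memLp_l2 x)).trans (le_of_eq ?_)
  ring

/-- By `fst_dotProduct_fullRes_sq`, this ratio is `sᵀQ²x` plus `linQD` times a factor at most `1/γ`,
and both have second moments bounded by exchangeability. -/
theorem IsFeatureLaw.integral_linQQD_sq_le (h : IsFeatureLaw M κ C T m μ) (hγ : 0 < γ)
    (x : Fin T → ℝ) :
    ∫ z, linQQD γ x z ^ 2 ∂(μ.prod (Measure.pi fun _ : Fin m => μ)) ≤
      4 * κ / γ ^ 3 * l2 x ^ 2 := by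
  have hμ := h.conc.memLp_l2
  have h1 := h.integral_linQD_sq_le hγ x
  have h2 := h.integral_le_of_mul_le (by positivity) (mul_integral_fullRes_sq_sq_le hγ hμ x)
  have hp1 := (polyBdd_linQD (m := m) hγ x).pow 2
  have hp2 : PolyBdd fun z : (Fin T → ℝ) × (Fin m → Fin T → ℝ) =>
      (z.1 ⬝ᵥ fullRes γ z *ᵥ (fullRes γ z *ᵥ x)) ^ 2 := by
    simp only [fst_dotProduct_fullRes_sq hγ]
    exact ((polyBdd_linQQD hγ x).sub ((polyBdd_quadQQ_div hγ).mul (polyBdd_linQD hγ x))).pow 2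
  calc _ ≤ ∫ z, (2 * (z.1 ⬝ᵥ fullRes γ z *ᵥ (fullRes γ z *ᵥ x)) ^ 2 +
        2 / γ ^ 2 * linQD γ x z ^ 2) ∂(μ.prod (Measure.pi fun _ : Fin m => μ)) := by
        refine integral_mono (((polyBdd_linQQD hγ x).pow 2).integrable hμ)
          (((hp2.const_mul 2).add (hp1.const_mul _)).integrable hμ) fun z => ?_
        have e := fst_dotProduct_fullRes_sq hγ x z
        have h3 := abs_quadQQ_div_le hγ z
        set r := quadQQ γ z / (1 + quadQ γ z)
        set q := linQD γ x z
        have h4 : r ^ 2 ≤ (1 / γ) ^ 2 := sq_le_sq' (abs_le.1 h3).1 (abs_le.1 h3).2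
        have h5 : r ^ 2 * q ^ 2 ≤ (1 / γ) ^ 2 * q ^ 2 :=
          mul_le_mul_of_nonneg_right h4 (sq_nonneg _)
        have e2 : linQQD γ x z = z.1 ⬝ᵥ fullRes γ z *ᵥ (fullRes γ z *ᵥ x) + r * q := by
          rw [e]; ring
        have e3 : 2 / γ ^ 2 * q ^ 2 = 2 * ((1 / γ) ^ 2 * q ^ 2) := by ring
        dsimp only
        rw [e2, e3]
        nlinarith [sq_nonneg (z.1 ⬝ᵥ fullRes γ z *ᵥ (fullRes γ z *ᵥ x) - r * q)]
    _ = _ := by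
        rw [integral_add ((hp2.const_mul 2).integrable hμ) ((hp1.const_mul _).integrable hμ),
          integral_const_mul, integral_const_mul]
    _ ≤ 2 * (κ * (l2 x ^ 2 / γ ^ 3)) + 2 / γ ^ 2 * (κ / γ * l2 x ^ 2) := by gcongr
    _ = _ := by field_simp; ring

/-- For fixed other rows the variance of `sᵀQ₋x` is bounded by concentration. Its mean is that of
`linQD · (1 + quadQ)`, and Cauchy–Schwarz reduces it to the second moment of `linQD`, already known
from exchangeability. This avoids any operator bound on `Φ`. -/
theorem IsFeatureLaw.integral_linQ_sq_le (h : IsFeatureLaw M κ C T m μ) (hγ : 0 < γ)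
    (hC : ∀ k, 0 ≤ C k) (x : Fin T → ℝ) :
    ∫ z, linQ γ x z ^ 2 ∂(μ.prod (Measure.pi fun _ : Fin m => μ)) ≤
      (C 1 / γ ^ 2 + (2 + 16 * (C 2 + M ^ 2) / γ ^ 2) * (κ / γ)) * l2 x ^ 2 := by
  have hμ := h.conc.memLp_l2
  set KD := 2 + 16 * (C 2 + M ^ 2) / γ ^ 2
  have hKD : 0 ≤ KD := by have := hC 2; positivity
  have hp := (polyBdd_linQ (m := m) hγ x).pow 2
  have hpD := (polyBdd_linQD (m := m) hγ x).pow 2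
  have h1 := h.integral_linQD_sq_le hγ x
  rw [integral_prod_symm _ (hpD.integrable hμ)] at h1
  rw [integral_prod_symm _ (hp.integrable hμ)]
  have hR : ∀ R : Fin m → Fin T → ℝ, ∫ s, linQ γ x (s, R) ^ 2 ∂μ ≤
      C 1 / γ ^ 2 * l2 x ^ 2 + KD * ∫ s, linQD γ x (s, R) ^ 2 ∂μ := by
    intro R
    have h2 := h.conc.integral_linear_sq_le (resolvent γ (Matrix.of R) *ᵥ x)
    have h3 := l2_resolvent_le hγ (Matrix.of R) x
    have h4 : C 1 * l2 (resolvent γ (Matrix.of R) *ᵥ x) ^ 2 ≤ C 1 * (l2 x / γ) ^ 2 :=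
      mul_le_mul_of_nonneg_left (pow_le_pow_left₀ (l2_nonneg _) h3 2) (hC 1)
    have hpD1 : PolyBdd fun z : (Fin T → ℝ) × (Fin m → Fin T → ℝ) => 1 + quadQ γ z :=
      (PolyBdd.const 1).add (polyBdd_quadQ hγ)
    have h5 := sq_integral_mul_le (hpD.integrable_left hμ R)
      ((hpD1.pow 2).integrable_left hμ R)
      (((polyBdd_linQD (m := m) hγ x).mul hpD1).integrable_left hμ R)
    have h6 : ∀ s, linQD γ x (s, R) * (1 + quadQ γ (s, R)) =
        s ⬝ᵥ resolvent γ (Matrix.of R) *ᵥ x := fun s =>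
      div_mul_cancel₀ _ (one_add_quadQ_pos hγ (s, R)).ne'
    simp only [h6] at h5
    have h7 := h.integral_one_add_quadQ_sq_le hγ hC R
    have h8 := mul_le_mul_of_nonneg_left h7
      (integral_nonneg fun s => sq_nonneg (linQD γ x (s, R)) : 0 ≤ ∫ s, linQD γ x (s, R) ^ 2 ∂μ)
    calc ∫ s, linQ γ x (s, R) ^ 2 ∂μ ≤ _ := h2
      _ ≤ C 1 * (l2 x / γ) ^ 2 + (∫ s, linQD γ x (s, R) ^ 2 ∂μ) * KD :=
          add_le_add h4 (h5.trans h8)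
      _ = _ := by ring
  have i1 := (hpD.integrable (ν := Measure.pi fun _ : Fin m => μ) hμ).integral_prod_right
  refine (integral_mono (hp.integrable hμ).integral_prod_right
    ((integrable_const (C 1 / γ ^ 2 * l2 x ^ 2)).add (i1.const_mul KD)) hR).trans ?_
  have e : ∫ R, (C 1 / γ ^ 2 * l2 x ^ 2 + KD * ∫ s, linQD γ x (s, R) ^ 2 ∂μ)
      ∂(Measure.pi fun _ : Fin m => μ) = C 1 / γ ^ 2 * l2 x ^ 2 +
      KD * ∫ R, ∫ s, linQD γ x (s, R) ^ 2 ∂μ ∂(Measure.pi fun _ : Fin m => μ) := by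
    rw [integral_add (integrable_const _) (i1.const_mul KD), integral_const_mul KD]
    simp only [integral_const, probReal_univ, smul_eq_mul, one_mul]
  refine (le_of_eq e).trans ?_
  have := mul_le_mul_of_nonneg_left h1 hKD
  nlinarith

theorem lipConst_pow_four (hγ : 0 < γ) : lipConst γ T ^ 4 = 16 / (γ ^ 6 * T ^ 2) := by
  unfold lipConst
  rw [div_pow, mul_pow, show 4 = 2 * 2 from rfl, pow_mul (√(γ * T)), Real.sq_sqrt (by positivity)]
  norm_num
  ring

/-- `Conc.quadForm_prod` applied to `Q₋/T`: its norm `1/(Tγ)` and its Lipschitz constant, of order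
`T^{-3/2}`, against `E‖s‖² ≤ MT` leave fluctuations of order `T^{-1/2}` in `L⁴`. -/
theorem IsFeatureLaw.integral_quadQ_sub_pow_four_le (h : IsFeatureLaw M κ C T m μ) (hγ : 0 < γ)
    (hC : ∀ k, 0 ≤ C k) :
    ∫ z, (quadQ γ z - ∫ z, quadQ γ z ∂(μ.prod (Measure.pi fun _ : Fin m => μ))) ^ 4
      ∂(μ.prod (Measure.pi fun _ : Fin m => μ)) ≤
      8 * (128 * (16 * (M / γ) ^ 2 * (1 / γ) ^ 2 * C 2 + (1 / γ) ^ 4 * C 4) +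
        C 2 * (16 / γ ^ 6) * M ^ 4) / (T : ℝ) ^ 2 := by
  have hT : (1 : ℝ) ≤ T := by exact_mod_cast h.T_pos
  have hT0 : (0 : ℝ) < T := by linarith
  have hsm : ∀ (R : Fin m → Fin T → ℝ) (x : Fin T → ℝ),
      x ⬝ᵥ ((1 / (T : ℝ)) • resolvent γ (Matrix.of R)) *ᵥ x =
        1 / (T : ℝ) * (x ⬝ᵥ resolvent γ (Matrix.of R) *ᵥ x) := fun R x => by
    rw [Matrix.smul_mulVec, dotProduct_smul, smul_eq_mul]
  have hpsd : ∀ R : Fin m → Fin T → ℝ, (resolvent γ (Matrix.of R)).PosSemidef := fun R =>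
    ((Matrix.PosDef.one.smul hγ).posSemidef_add (posSemidef_gram (Matrix.of R))).posSemidef.inv
  have key := h.conc.quadForm_prod h.conc_pi h.second_moment
    (A := fun R => (1 / (T : ℝ)) • resolvent γ (Matrix.of R))
    ((continuous_resolvent hγ (fun R : Fin m → Fin T → ℝ => Matrix.of R)
      continuous_id).const_smul (1 / (T : ℝ)))
    (fun R => (hpsd R).smul (by positivity))
    (a := 1 / (T * γ)) (l := 1 / T * lipConst γ T) (by positivity)
    (mul_nonneg (by positivity) (lipConst_nonneg hγ T))
    (fun R x => by
      rw [hsm]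
      refine (mul_le_mul_of_nonneg_left (dotProduct_regInv_le hγ (posSemidef_gram (Matrix.of R)) x)
        (by positivity)).trans (le_of_eq ?_)
      field_simp)
    (fun R R' x => by
      rw [hsm, hsm, ← mul_sub, abs_mul, abs_of_nonneg (by positivity : 0 ≤ 1 / (T : ℝ))]
      refine (mul_le_mul_of_nonneg_left (abs_resolvent_sub_le hγ h.T_pos (Matrix.of R)
        (Matrix.of R') x x) (by positivity)).trans (le_of_eq ?_)
      change 1 / (T : ℝ) * (lipConst γ T * (l2 x * l2 x) * fro (R - R')) = _
      ring)
  simp only [hsm] at key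
  refine key.trans ?_
  have e1 : 16 * (1 / (T * γ) * (M * T)) ^ 2 * (1 / (T * γ)) ^ 2 * C 2 =
      16 * (M / γ) ^ 2 * (1 / γ) ^ 2 * C 2 / (T : ℝ) ^ 2 := by field_simp
  have e2 : (1 / (T * γ)) ^ 4 * C 4 ≤ (1 / γ) ^ 4 * C 4 / (T : ℝ) ^ 2 := by
    have h2 : (T : ℝ) ^ 2 ≤ T ^ 4 := pow_le_pow_right₀ hT (by norm_num)
    have : (1 / (T * γ)) ^ 4 * C 4 = (1 / γ) ^ 4 * C 4 / (T : ℝ) ^ 4 := by field_simp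
    rw [this]
    have := hC 4
    gcongr
  have e3 : (1 / T * lipConst γ T * (M * T)) ^ 4 = 16 / γ ^ 6 * M ^ 4 / (T : ℝ) ^ 2 := by
    have : 1 / T * lipConst γ T * (M * T) = lipConst γ T * M := by field_simp
    rw [this, mul_pow, lipConst_pow_four hγ]
    field_simp
  rw [e1, e3]
  have : 8 * (128 * (16 * (M / γ) ^ 2 * (1 / γ) ^ 2 * C 2 / (T : ℝ) ^ 2 +
      (1 / γ) ^ 4 * C 4 / (T : ℝ) ^ 2) + C 2 * (16 / γ ^ 6 * M ^ 4 / (T : ℝ) ^ 2)) =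
      8 * (128 * (16 * (M / γ) ^ 2 * (1 / γ) ^ 2 * C 2 + (1 / γ) ^ 4 * C 4) +
        C 2 * (16 / γ ^ 6) * M ^ 4) / (T : ℝ) ^ 2 := by ring
  rw [← this]
  gcongr

end Law

/-! ### The second-moment matrix and its bilinear forms and traces. -/

section SecondMoment

variable {T : ℕ}

/-- The matrix of second moments of a law on `ℝ^T`. -/
noncomputable def momentMatrix (μ : Measure (Fin T → ℝ)) : Matrix (Fin T) (Fin T) ℝ :=
  Matrix.of fun i j => ∫ s, s i * s j ∂μ

variable {μ : Measure (Fin T → ℝ)}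

theorem integrable_apply_mul_apply (hμ : Integrable (fun s => l2 s ^ 2) μ) (i j : Fin T) :
    Integrable (fun s : Fin T → ℝ => s i * s j) μ := by
  have habs : ∀ (s : Fin T → ℝ) i, |s i| ≤ l2 s := fun s i => by
    have := abs_dotProduct_le s (Pi.single i 1)
    simpa [l2] using this
  refine hμ.mono' (by fun_prop) (Eventually.of_forall fun s => ?_)
  rw [norm_mul, sq]
  exact mul_le_mul (habs s i) (habs s j) (abs_nonneg _) (l2_nonneg _)

theorem dotProduct_momentMatrix (hμ : Integrable (fun s => l2 s ^ 2) μ) (w x : Fin T → ℝ) :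
    w ⬝ᵥ momentMatrix μ *ᵥ x = ∫ s, (s ⬝ᵥ w) * (s ⬝ᵥ x) ∂μ := by
  have e : ∀ s : Fin T → ℝ, (s ⬝ᵥ w) * (s ⬝ᵥ x) = ∑ i, ∑ j, w i * x j * (s i * s j) := fun s => by
    simp only [dotProduct, Finset.sum_mul_sum]
    exact Finset.sum_congr rfl fun i _ => Finset.sum_congr rfl fun j _ => by ring
  simp only [e]
  rw [integral_finsetSum _ fun i _ => integrable_finsetSum _ fun j _ =>
    (integrable_apply_mul_apply hμ i j).const_mul _]
  simp only [dotProduct, Matrix.mulVec, momentMatrix, Matrix.of_apply, Finset.mul_sum]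
  refine Finset.sum_congr rfl fun i _ => ?_
  rw [integral_finsetSum _ fun j _ => (integrable_apply_mul_apply hμ i j).const_mul _]
  refine Finset.sum_congr rfl fun j _ => ?_
  rw [integral_const_mul]
  ring

theorem trace_momentMatrix_mul (hμ : Integrable (fun s => l2 s ^ 2) μ)
    (B : Matrix (Fin T) (Fin T) ℝ) :
    (momentMatrix μ * B).trace = ∫ s, s ⬝ᵥ B *ᵥ s ∂μ := by
  have e : ∀ s : Fin T → ℝ, s ⬝ᵥ B *ᵥ s = ∑ i, ∑ j, B j i * (s i * s j) := fun s => by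
    simp only [dotProduct, Matrix.mulVec, Finset.mul_sum]
    rw [Finset.sum_comm]
    exact Finset.sum_congr rfl fun i _ => Finset.sum_congr rfl fun j _ => by ring
  simp only [e]
  rw [integral_finsetSum _ fun i _ => integrable_finsetSum _ fun j _ =>
    (integrable_apply_mul_apply hμ i j).const_mul _]
  simp only [Matrix.trace, Matrix.diag_apply, Matrix.mul_apply, momentMatrix, Matrix.of_apply]
  refine Finset.sum_congr rfl fun i _ => ?_
  rw [integral_finsetSum _ fun j _ => (integrable_apply_mul_apply hμ i j).const_mul _]
  refine Finset.sum_congr rfl fun j _ => ?_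
  rw [integral_const_mul]
  ring

theorem posSemidef_momentMatrix (hμ : Integrable (fun s => l2 s ^ 2) μ) :
    (momentMatrix μ).PosSemidef := by
  refine Matrix.PosSemidef.of_dotProduct_mulVec_nonneg ?_ fun x => ?_
  · ext i j
    simp only [momentMatrix, Matrix.conjTranspose_apply, Matrix.of_apply, star_trivial, mul_comm]
  · rw [star_trivial, dotProduct_momentMatrix hμ]
    exact integral_nonneg fun s => mul_self_nonneg _

end SecondMoment

/-! ### Basic bounds for `Ψ` and `Q̄` at an arbitrary parameter. -/

section Equivalent

variable {T : ℕ} {Φ : Matrix (Fin T) (Fin T) ℝ} {γ a : ℝ}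

theorem posSemidef_Psi (hΦ : Φ.PosSemidef) (N : ℕ) (ha : 0 ≤ a) : (Psi N Φ a).PosSemidef :=
  hΦ.smul (by positivity)

theorem Qbar_eq (N : ℕ) (γ : ℝ) (Φ : Matrix (Fin T) (Fin T) ℝ) (a : ℝ) :
    Qbar N γ Φ a = regInv γ (Psi N Φ a) := rfl

theorem l2_Qbar_le (hγ : 0 < γ) (hΦ : Φ.PosSemidef) (N : ℕ) (ha : 0 ≤ a) (x : Fin T → ℝ) :
    l2 (Qbar N γ Φ a *ᵥ x) ≤ l2 x / γ := l2_regInv_le hγ (posSemidef_Psi hΦ N ha) x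

theorem dotProduct_Qbar (hΦ : Φ.PosSemidef) (N : ℕ) (ha : 0 ≤ a) (x y : Fin T → ℝ) :
    x ⬝ᵥ Qbar N γ Φ a *ᵥ y = (Qbar N γ Φ a *ᵥ x) ⬝ᵥ y :=
  dotProduct_regInv (posSemidef_Psi hΦ N ha) x y

theorem Psi_Qbar_add (hγ : 0 < γ) (hΦ : Φ.PosSemidef) (N : ℕ) (ha : 0 ≤ a) (x : Fin T → ℝ) :
    Psi N Φ a *ᵥ (Qbar N γ Φ a *ᵥ x) + γ • (Qbar N γ Φ a *ᵥ x) = x :=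
  mulVec_regInv_add hγ (posSemidef_Psi hΦ N ha) x

theorem l2_Psi_Qbar_le (hγ : 0 < γ) (hΦ : Φ.PosSemidef) (N : ℕ) (ha : 0 ≤ a) (x : Fin T → ℝ) :
    l2 (Psi N Φ a *ᵥ (Qbar N γ Φ a *ᵥ x)) ≤ l2 x :=
  l2_mulVec_regInv_le hγ (posSemidef_Psi hΦ N ha) x

end Equivalent

/-! ### One constant for all moment bounds. -/

section Bias

/-- Bounds, by a constant `K`, for the moments that occur in the analysis of the resolvent. -/
structure HasMomentBounds (γ M K : ℝ) (T m : ℕ) (μ : Measure (Fin T → ℝ)) : Prop where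
  T_pos : 0 < T
  memLp_l2 : ∀ q : ℕ, MemLp l2 q μ
  second_moment : ∫ s, l2 s ^ 2 ∂μ ≤ M * T
  one_le : 1 ≤ K
  M_le : M ≤ K
  M_div_le : M / γ ≤ K
  M_div_div_le : M / γ / γ ≤ K
  one_div_le : 1 / γ ≤ K
  ratio_le : ((m + 1 : ℕ) : ℝ) / T ≤ K
  linQ_bound : ∀ x, ∫ z, linQ γ x z ^ 2 ∂(μ.prod (Measure.pi fun _ : Fin m => μ)) ≤ (K * l2 x) ^ 2
  linQD_bound : ∀ x, ∫ z, linQD γ x z ^ 2 ∂(μ.prod (Measure.pi fun _ : Fin m => μ)) ≤ (K * l2 x) ^ 2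
  linQQD_bound : ∀ x, ∫ z, linQQD γ x z ^ 2 ∂(μ.prod (Measure.pi fun _ : Fin m => μ)) ≤ (K * l2 x) ^ 2
  fst_bound : ∀ a, 0 ≤ a → a ≤ M / γ → ∀ u,
    ∫ s, (s ⬝ᵥ Qbar (m + 1) γ (momentMatrix μ) a *ᵥ u) ^ 4 ∂μ ≤ (K * l2 u) ^ 4
  quadQ_bound : ∫ z, (quadQ γ z - ∫ z, quadQ γ z ∂(μ.prod (Measure.pi fun _ : Fin m => μ))) ^ 4
      ∂(μ.prod (Measure.pi fun _ : Fin m => μ)) ≤ (K / √T) ^ 4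
  quadQQ_bound : ∫ z, (quadQQ γ z - ∫ z, quadQQ γ z ∂(μ.prod (Measure.pi fun _ : Fin m => μ))) ^ 4
      ∂(μ.prod (Measure.pi fun _ : Fin m => μ)) ≤ (K / √T) ^ 4

variable {γ M κ K : ℝ} {C : ℕ → ℝ} {T m : ℕ} {μ : Measure (Fin T → ℝ)} [IsProbabilityMeasure μ]

/-- The argument for `quadQ`, with `Q₋²/T` in place of `Q₋/T`; the square costs a factor `1/γ` in
norm and `2/γ` in Lipschitz constant. -/
theorem IsFeatureLaw.integral_quadQQ_sub_pow_four_le (h : IsFeatureLaw M κ C T m μ) (hγ : 0 < γ)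
    (hC : ∀ k, 0 ≤ C k) :
    ∫ z, (RandomFeatures.quadQQ γ z -
        ∫ z, RandomFeatures.quadQQ γ z ∂(μ.prod (Measure.pi fun _ : Fin m => μ))) ^ 4
      ∂(μ.prod (Measure.pi fun _ : Fin m => μ)) ≤
      8 * (128 * (16 * (M / γ ^ 2) ^ 2 * (1 / γ ^ 2) ^ 2 * C 2 + (1 / γ ^ 2) ^ 4 * C 4) +
        C 2 * (256 / γ ^ 10) * M ^ 4) / (T : ℝ) ^ 2 := by
  have hT : (1 : ℝ) ≤ T := by exact_mod_cast h.T_pos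
  have hT0 : (0 : ℝ) < T := by linarith
  have hsm : ∀ (R : Fin m → Fin T → ℝ) (x : Fin T → ℝ),
      x ⬝ᵥ ((1 / (T : ℝ)) • (resolvent γ (Matrix.of R) * resolvent γ (Matrix.of R))) *ᵥ x =
        1 / (T : ℝ) * (x ⬝ᵥ resolvent γ (Matrix.of R) *ᵥ (resolvent γ (Matrix.of R) *ᵥ x)) :=
    fun R x => by
      rw [Matrix.smul_mulVec, dotProduct_smul, smul_eq_mul, Matrix.mulVec_mulVec]
  have hpsd : ∀ R : Fin m → Fin T → ℝ,
      (resolvent γ (Matrix.of R) * resolvent γ (Matrix.of R)).PosSemidef := fun R => by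
    have := Matrix.posSemidef_conjTranspose_mul_self (resolvent γ (Matrix.of R))
    rwa [Matrix.conjTranspose_eq_transpose_of_trivial, resolvent_eq,
      transpose_regInv (posSemidef_gram _)] at this
  have hcont := continuous_resolvent hγ (fun R : Fin m → Fin T → ℝ => Matrix.of R) continuous_id
  have key := h.conc.quadForm_prod h.conc_pi h.second_moment
    (A := fun R => (1 / (T : ℝ)) • (resolvent γ (Matrix.of R) * resolvent γ (Matrix.of R)))
    ((hcont.matrix_mul hcont).const_smul (1 / (T : ℝ)))
    (fun R => (hpsd R).smul (by positivity))
    (a := 1 / (T * γ ^ 2)) (l := 1 / T * (2 / γ * lipConst γ T)) (by positivity)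
    (mul_nonneg (by positivity) (mul_nonneg (by positivity) (lipConst_nonneg hγ T)))
    (fun R x => by
      rw [hsm, dotProduct_resolvent, ← l2_sq]
      have h2 := pow_le_pow_left₀ (l2_nonneg _) (l2_resolvent_le hγ (Matrix.of R) x) 2
      refine (mul_le_mul_of_nonneg_left h2 (by positivity)).trans (le_of_eq ?_)
      field_simp)
    (fun R R' x => by
      rw [hsm, hsm, ← mul_sub, abs_mul, abs_of_nonneg (by positivity : 0 ≤ 1 / (T : ℝ))]
      refine (mul_le_mul_of_nonneg_left (abs_resolvent_sq_sub_le hγ h.T_pos (Matrix.of R)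
        (Matrix.of R') x x) (by positivity)).trans (le_of_eq ?_)
      change 1 / (T : ℝ) * (2 / γ * lipConst γ T * (l2 x * l2 x) * fro (R - R')) = _
      ring)
  simp only [hsm] at key
  refine key.trans ?_
  have e1 : 16 * (1 / (T * γ ^ 2) * (M * T)) ^ 2 * (1 / (T * γ ^ 2)) ^ 2 * C 2 =
      16 * (M / γ ^ 2) ^ 2 * (1 / γ ^ 2) ^ 2 * C 2 / (T : ℝ) ^ 2 := by field_simp
  have e2 : (1 / (T * γ ^ 2)) ^ 4 * C 4 ≤ (1 / γ ^ 2) ^ 4 * C 4 / (T : ℝ) ^ 2 := by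
    have h2 : (T : ℝ) ^ 2 ≤ T ^ 4 := pow_le_pow_right₀ hT (by norm_num)
    have : (1 / (T * γ ^ 2)) ^ 4 * C 4 = (1 / γ ^ 2) ^ 4 * C 4 / (T : ℝ) ^ 4 := by field_simp
    rw [this]
    have := hC 4
    gcongr
  have e3 : (1 / T * (2 / γ * lipConst γ T) * (M * T)) ^ 4 =
      256 / γ ^ 10 * M ^ 4 / (T : ℝ) ^ 2 := by
    have : 1 / T * (2 / γ * lipConst γ T) * (M * T) = lipConst γ T * (2 * M / γ) := by field_simp
    rw [this, mul_pow, lipConst_pow_four hγ]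
    field_simp
    norm_num
    ring
  rw [e1, e3]
  have : 8 * (128 * (16 * (M / γ ^ 2) ^ 2 * (1 / γ ^ 2) ^ 2 * C 2 / (T : ℝ) ^ 2 +
      (1 / γ ^ 2) ^ 4 * C 4 / (T : ℝ) ^ 2) + C 2 * (256 / γ ^ 10 * M ^ 4 / (T : ℝ) ^ 2)) =
      8 * (128 * (16 * (M / γ ^ 2) ^ 2 * (1 / γ ^ 2) ^ 2 * C 2 + (1 / γ ^ 2) ^ 4 * C 4) +
        C 2 * (256 / γ ^ 10) * M ^ 4) / (T : ℝ) ^ 2 := by ring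
  rw [← this]
  gcongr

theorem IsFeatureLaw.integral_dotProduct_Qbar_pow_four_le (h : IsFeatureLaw M κ C T m μ)
    (hγ : 0 < γ) (hC : ∀ k, 0 ≤ C k) (hκ : 0 ≤ κ) {a : ℝ} (ha : 0 ≤ a) (haM : a ≤ M / γ)
    (u : Fin T → ℝ) :
    ∫ s, (s ⬝ᵥ Qbar (m + 1) γ (momentMatrix μ) a *ᵥ u) ^ 4 ∂μ ≤
      8 * (C 2 / γ ^ 4 + ((1 + M / γ) * κ / γ) ^ 2) * l2 u ^ 4 := by
  have hi := h.conc.integrable_l2_pow 2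
  have hΦ := posSemidef_momentMatrix hi
  set w := Qbar (m + 1) γ (momentMatrix μ) a *ᵥ u with hw
  have h1 := h.conc.integral_linear_pow_four_le w
  have h2 : l2 w ≤ l2 u / γ := l2_Qbar_le hγ hΦ (m + 1) ha u
  -- Up to the factor `(n/T)/(1+a)`, with `n = m + 1`, this form is the second moment of `sᵀw`;
  -- boundedness of `a` and of `T/n` then gives `h5`.
  have h3 : w ⬝ᵥ Psi (m + 1) (momentMatrix μ) a *ᵥ w ≤ l2 u ^ 2 / γ :=
    dotProduct_mulVec_regInv_le hγ (posSemidef_Psi hΦ (m + 1) ha) u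
  have ha1 : 0 < 1 + a := by linarith
  rw [Psi, Matrix.smul_mulVec, dotProduct_smul, smul_eq_mul, dotProduct_momentMatrix hi,
    div_mul_eq_mul_div, div_le_iff₀ ha1] at h3
  have h4 := h.integral_le_of_mul_le (by positivity) h3
  simp only [← sq] at h4
  have h5 : ∫ s, (s ⬝ᵥ w) ^ 2 ∂μ ≤ (1 + M / γ) * κ / γ * l2 u ^ 2 := by
    refine h4.trans ?_
    have : κ * (l2 u ^ 2 / γ * (1 + a)) ≤ κ * (l2 u ^ 2 / γ * (1 + M / γ)) := by gcongr
    refine this.trans (le_of_eq ?_)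
    ring
  have h6 : (∫ s, (s ⬝ᵥ w) ^ 2 ∂μ) ^ 2 ≤ ((1 + M / γ) * κ / γ * l2 u ^ 2) ^ 2 :=
    pow_le_pow_left₀ (integral_nonneg fun s => sq_nonneg _) h5 2
  have h7 : C 2 * l2 w ^ 4 ≤ C 2 * (l2 u / γ) ^ 4 :=
    mul_le_mul_of_nonneg_left (pow_le_pow_left₀ (l2_nonneg _) h2 4) (hC 2)
  refine (h1.trans (mul_le_mul_of_nonneg_left (add_le_add h7 h6) (by norm_num))).trans
    (le_of_eq ?_)
  ring

/-- The moment bounds hold with a constant that does not depend on the dimensions. -/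
theorem exists_hasMomentBounds (hγ : 0 < γ) (hM : 0 ≤ M) (hκ : 0 ≤ κ) (hC : ∀ k, 0 ≤ C k) :
    ∃ K : ℝ, ∀ (T m : ℕ) (μ : Measure (Fin T → ℝ)) [IsProbabilityMeasure μ],
      IsFeatureLaw M κ C T m μ → HasMomentBounds γ M K T m μ := by
  have h1 := hC 1
  have h2 := hC 2
  have h4 := hC 4
  obtain ⟨c1, hc1⟩ : ∃ c, c = C 1 / γ ^ 2 + (2 + 16 * (C 2 + M ^ 2) / γ ^ 2) * (κ / γ) := ⟨_, rfl⟩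
  obtain ⟨c2, hc2⟩ : ∃ c, c = κ / γ := ⟨_, rfl⟩
  obtain ⟨c3, hc3⟩ : ∃ c, c = 4 * κ / γ ^ 3 := ⟨_, rfl⟩
  obtain ⟨c4, hc4⟩ : ∃ c, c = 8 * (C 2 / γ ^ 4 + ((1 + M / γ) * κ / γ) ^ 2) := ⟨_, rfl⟩
  obtain ⟨c5, hc5⟩ : ∃ c, c = 8 * (128 * (16 * (M / γ) ^ 2 * (1 / γ) ^ 2 * C 2 +
    (1 / γ) ^ 4 * C 4) + C 2 * (16 / γ ^ 6) * M ^ 4) := ⟨_, rfl⟩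
  obtain ⟨c6, hc6⟩ : ∃ c, c = 8 * (128 * (16 * (M / γ ^ 2) ^ 2 * (1 / γ ^ 2) ^ 2 * C 2 +
    (1 / γ ^ 2) ^ 4 * C 4) + C 2 * (256 / γ ^ 10) * M ^ 4) := ⟨_, rfl⟩
  have p1 : 0 ≤ c1 := by rw [hc1]; positivity
  have p2 : 0 ≤ c2 := by rw [hc2]; positivity
  have p3 : 0 ≤ c3 := by rw [hc3]; positivity
  have p4 : 0 ≤ c4 := by rw [hc4]; positivity
  have p5 : 0 ≤ c5 := by rw [hc5]; positivity
  have p6 : 0 ≤ c6 := by rw [hc6]; positivity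
  have q1 : 0 ≤ M / γ := by positivity
  have q2 : 0 ≤ M / γ / γ := by positivity
  have q3 : 0 ≤ 1 / γ := by positivity
  -- The sum dominates each constant, and the summand 1 makes `K ≥ 1`, so each constant is also at
  -- most any positive power of `K`.
  obtain ⟨K, hK⟩ : ∃ K, K = 1 + M + M / γ + M / γ / γ + 1 / γ + κ + c1 + c2 + c3 + c4 + c5 + c6 :=
    ⟨_, rfl⟩
  have hK1 : 1 ≤ K := by linarith
  have hsq : ∀ c, c ≤ K → ∀ x : ℝ, c * x ^ 2 ≤ (K * x) ^ 2 := fun c hc x => by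
    rw [mul_pow]
    exact mul_le_mul_of_nonneg_right (hc.trans (le_self_pow₀ hK1 two_ne_zero)) (sq_nonneg _)
  have hT2 : ∀ c, c ≤ K → ∀ T : ℕ, c / (T : ℝ) ^ 2 ≤ (K / √T) ^ 4 := fun c hc T => by
    rw [div_pow, show √(T : ℝ) ^ 4 = (T : ℝ) ^ 2 by
      rw [show 4 = 2 * 2 from rfl, pow_mul, Real.sq_sqrt (by positivity)]]
    have : c ≤ K ^ 4 := hc.trans (le_self_pow₀ hK1 (by norm_num))
    gcongr
  refine ⟨K, fun T m μ _ h => ?_⟩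
  exact
  { T_pos := h.T_pos
    memLp_l2 := h.conc.memLp_l2
    second_moment := h.second_moment
    one_le := hK1
    M_le := by linarith
    M_div_le := by linarith
    M_div_div_le := by linarith
    one_div_le := by linarith
    ratio_le := h.ratio_le.trans (by linarith)
    linQ_bound := fun x => (h.integral_linQ_sq_le hγ hC x).trans
      (hsq _ (by rw [← hc1]; linarith) _)
    linQD_bound := fun x => (h.integral_linQD_sq_le hγ x).trans
      (hsq _ (by rw [← hc2]; linarith) _)
    linQQD_bound := fun x => (h.integral_linQQD_sq_le hγ x).trans
      (hsq _ (by rw [← hc3]; linarith) _)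
    fst_bound := fun a ha haM u => by
      refine (h.integral_dotProduct_Qbar_pow_four_le hγ hC hκ ha haM u).trans ?_
      rw [← hc4, mul_pow]
      have : c4 ≤ K ^ 4 := le_trans (by linarith) (le_self_pow₀ hK1 (by norm_num : (4 : ℕ) ≠ 0))
      gcongr
    quadQ_bound := (h.integral_quadQ_sub_pow_four_le hγ hC).trans
      (hT2 _ (by rw [← hc5]; linarith) _)
    quadQQ_bound := (h.integral_quadQQ_sub_pow_four_le hγ hC).trans
      (hT2 _ (by rw [← hc6]; linarith) _) }

end Bias

/-! ### Bias of the resolvent and of its square, against `Q̄` at a free parameter. -/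

section Bias

variable {γ M K : ℝ} {T m : ℕ} {μ : Measure (Fin T → ℝ)} [IsProbabilityMeasure μ]

theorem integrable_l2_sq (hμ : ∀ q : ℕ, MemLp l2 q μ) : Integrable (fun s => l2 s ^ 2) μ := by
  refine (hμ 2).integrable_norm_pow'.congr (Eventually.of_forall fun s => ?_)
  simp only [Real.norm_of_nonneg (l2_nonneg s)]

/-- Integrating a bilinear form of a row, whose second argument depends on the other rows. -/
theorem integral_fst_dotProduct_mul (hμ : ∀ q : ℕ, MemLp l2 q μ) {ν : Measure (Fin m → Fin T → ℝ)}
    [IsProbabilityMeasure ν] (w : Fin T → ℝ) (y : (Fin m → Fin T → ℝ) → Fin T → ℝ)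
    (h1 : PolyBdd fun z : (Fin T → ℝ) × (Fin m → Fin T → ℝ) => z.1 ⬝ᵥ y z.2)
    (h2 : PolyBdd fun z : (Fin T → ℝ) × (Fin m → Fin T → ℝ) =>
      (momentMatrix μ *ᵥ w) ⬝ᵥ y z.2) :
    ∫ z, (z.1 ⬝ᵥ w) * (z.1 ⬝ᵥ y z.2) ∂(μ.prod ν) =
      ∫ z, (momentMatrix μ *ᵥ w) ⬝ᵥ y z.2 ∂(μ.prod ν) := by
  rw [integral_prod_symm _ (((polyBdd_fst_dotProduct w).mul h1).integrable hμ),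
    integral_prod_symm _ (h2.integrable hμ)]
  have hi := integrable_l2_sq hμ
  have hs : (momentMatrix μ)ᵀ = momentMatrix μ := by
    simpa using (posSemidef_momentMatrix hi).isHermitian.eq
  refine integral_congr_ae (Eventually.of_forall fun R => ?_)
  simp only [integral_const, probReal_univ, smul_eq_mul, one_mul]
  rw [← dotProduct_mulVec_symm hs, dotProduct_momentMatrix hi]

/-- The bias of the resolvent against the candidate `Q̄` with parameter `a`. -/
theorem HasMomentBounds.abs_integral_fullRes_sub_le (h : HasMomentBounds γ M K T m μ)
    (hγ : 0 < γ) {a ρ : ℝ} (ha : 0 ≤ a) (haM : a ≤ M / γ) (hρ : 0 ≤ ρ)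
    (hquad : ∫ z, (quadQ γ z - a) ^ 4 ∂(μ.prod (Measure.pi fun _ : Fin m => μ)) ≤ ρ ^ 4)
    (u x : Fin T → ℝ) :
    |∫ z, u ⬝ᵥ fullRes γ z *ᵥ x ∂(μ.prod (Measure.pi fun _ : Fin m => μ)) -
      u ⬝ᵥ Qbar (m + 1) γ (momentMatrix μ) a *ᵥ x| ≤
      K ^ 3 * (1 / (T : ℝ) + ρ) * (l2 u * l2 x) := by
  have hμ := h.memLp_l2
  have hΦ := posSemidef_momentMatrix (integrable_l2_sq hμ)
  set Φ := momentMatrix μ with hΦdef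
  set ν := Measure.pi fun _ : Fin m => μ
  -- With `w = Q̄u` and `v = Ψw`, one has `u = v + γw`. The `γw` part is handled by the averaged
  -- resolvent identity, the `v` part by removing the row `s`; their main terms nearly cancel.
  set w := Qbar (m + 1) γ Φ a *ᵥ u with hw
  set v := Psi (m + 1) Φ a *ᵥ w with hv
  have hu : v + γ • w = u := Psi_Qbar_add hγ hΦ (m + 1) ha u
  have hwx : u ⬝ᵥ Qbar (m + 1) γ Φ a *ᵥ x = w ⬝ᵥ x := dotProduct_Qbar hΦ (m + 1) ha u x
  have hvu : l2 v ≤ l2 u := l2_Psi_Qbar_le hγ hΦ (m + 1) ha u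
  have hK := h.one_le
  have hu0 := l2_nonneg u
  have hx0 := l2_nonneg x
  set c := ((m + 1 : ℕ) : ℝ) / T with hc
  have hc0 : 0 ≤ c := by positivity
  have ha1 : 0 < 1 + a := by linarith
  have hvΦ : v = (c / (1 + a)) • Φ *ᵥ w := by
    rw [hv, Psi, Matrix.smul_mulVec]
  -- expansion
  have p1 := polyBdd_dotProduct_fullRes (m := m) hγ v x
  have p2 := polyBdd_dotProduct_fullRes (m := m) hγ w x
  have p3 := polyBdd_dotProduct_resolvent (m := m) hγ v x
  have p4 := (polyBdd_linQ (m := m) hγ v).mul (polyBdd_linQD hγ x)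
  have p5 := (polyBdd_fst_dotProduct (m := m) w).mul (polyBdd_linQ hγ x)
  have p6 := (polyBdd_fst_dotProduct (m := m) w).mul (polyBdd_linQD hγ x)
  have pq := (polyBdd_quadQ (T := T) (m := m) hγ).sub (PolyBdd.const a)
  have e1 : ∫ z, u ⬝ᵥ fullRes γ z *ᵥ x ∂(μ.prod ν) =
      ∫ z, v ⬝ᵥ fullRes γ z *ᵥ x ∂(μ.prod ν) + γ * ∫ z, w ⬝ᵥ fullRes γ z *ᵥ x ∂(μ.prod ν) := by
    rw [← integral_const_mul, ← integral_add (p1.integrable hμ)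
      ((p2.const_mul γ).integrable hμ)]
    refine integral_congr_ae (Eventually.of_forall fun z => ?_)
    dsimp only
    rw [← smul_eq_mul, ← smul_dotProduct, ← add_dotProduct, hu]
  have e2 := mul_integral_dotProduct_linQD (m := m) hγ hμ w x
  have e3 : ∫ z, v ⬝ᵥ fullRes γ z *ᵥ x ∂(μ.prod ν) =
      ∫ z, v ⬝ᵥ resolvent γ (Matrix.of z.2) *ᵥ x ∂(μ.prod ν) -
      1 / (T : ℝ) * ∫ z, linQ γ v z * linQD γ x z ∂(μ.prod ν) := by
    simp only [dotProduct_fullRes hγ]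
    rw [integral_sub (p3.integrable hμ) ((p4.const_mul _).integrable hμ), integral_const_mul]
  -- As `v` is a multiple of `Φw` and `s` is independent of `Q₋`, the matrix `Φ` can be written back
  -- as a mean over `s`.
  have e4 : ∫ z : (Fin T → ℝ) × (Fin m → Fin T → ℝ), v ⬝ᵥ resolvent γ (Matrix.of z.2) *ᵥ x
      ∂(μ.prod ν) = c / (1 + a) * ∫ z, (z.1 ⬝ᵥ w) * linQ γ x z ∂(μ.prod ν) := by
    have := integral_fst_dotProduct_mul hμ (ν := ν) w
      (fun R => resolvent γ (Matrix.of R) *ᵥ x) (polyBdd_linQ hγ x)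
      (polyBdd_dotProduct_resolvent hγ _ x)
    unfold linQ
    rw [this, ← integral_const_mul]
    refine integral_congr_ae (Eventually.of_forall fun z => ?_)
    dsimp only
    rw [hvΦ, smul_dotProduct, smul_eq_mul]
  -- Since `linQ = linQD (1 + quadQ)`, the difference `linQ/(1+a) - linQD` equals `linQD (quadQ -
  -- a)/(1+a)`. This is where the error `ρ` enters.
  have e5 : c / (1 + a) * ∫ z, (z.1 ⬝ᵥ w) * linQ γ x z ∂(μ.prod ν) -
      c * ∫ z, (z.1 ⬝ᵥ w) * linQD γ x z ∂(μ.prod ν) =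
      c / (1 + a) * ∫ z, (z.1 ⬝ᵥ w) * (quadQ γ z - a) * linQD γ x z ∂(μ.prod ν) := by
    rw [← integral_const_mul, ← integral_const_mul, ← integral_const_mul,
      ← integral_sub ((p5.const_mul _).integrable hμ) ((p6.const_mul _).integrable hμ)]
    refine integral_congr_ae (Eventually.of_forall fun z => ?_)
    have hD := (one_add_quadQ_pos hγ z).ne'
    dsimp only
    unfold linQD
    field_simp
    ring
  have b1 : |∫ z, linQ γ v z * linQD γ x z ∂(μ.prod ν)| ≤ (K * l2 v) * (K * l2 x) :=
    (polyBdd_linQ hγ v).abs_integral_mul_le (polyBdd_linQD hγ x) hμ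
      (mul_nonneg (by linarith) (l2_nonneg _)) (by positivity) (h.linQ_bound v) (h.linQD_bound x)
  have b2 : |∫ z, (z.1 ⬝ᵥ w) * (quadQ γ z - a) * linQD γ x z ∂(μ.prod ν)| ≤
      (K * l2 u) * ρ * (K * l2 x) := by
    refine (polyBdd_fst_dotProduct w).abs_integral_mul_mul_le pq (polyBdd_linQD hγ x) hμ
      (by positivity) hρ (by positivity) ?_ hquad (h.linQD_bound x)
    rw [integral_fun_fst (μ := μ) (ν := ν) (fun s => (s ⬝ᵥ w) ^ 4)]
    simp only [probReal_univ, one_smul]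
    exact h.fst_bound a ha haM u
  have e6 : ∫ z, u ⬝ᵥ fullRes γ z *ᵥ x ∂(μ.prod ν) - u ⬝ᵥ Qbar (m + 1) γ Φ a *ᵥ x =
      c / (1 + a) * (∫ z, (z.1 ⬝ᵥ w) * (quadQ γ z - a) * linQD γ x z ∂(μ.prod ν)) -
      1 / (T : ℝ) * ∫ z, linQ γ v z * linQD γ x z ∂(μ.prod ν) := by
    rw [hwx, e1, e3, e4, ← e5]
    linarith
  have hca : c / (1 + a) ≤ K := (div_le_self hc0 (by linarith)).trans h.ratio_le
  have hca0 : 0 ≤ c / (1 + a) := by positivity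
  rw [e6]
  refine (abs_sub _ _).trans ?_
  rw [abs_mul, abs_mul, abs_of_nonneg hca0, abs_of_nonneg (by positivity : 0 ≤ 1 / (T : ℝ))]
  have b3 : c / (1 + a) * |∫ z, (z.1 ⬝ᵥ w) * (quadQ γ z - a) * linQD γ x z ∂(μ.prod ν)| ≤
      K * ((K * l2 u) * ρ * (K * l2 x)) :=
    mul_le_mul hca b2 (abs_nonneg _) (by linarith)
  have b4 : 1 / (T : ℝ) * |∫ z, linQ γ v z * linQD γ x z ∂(μ.prod ν)| ≤
      1 / (T : ℝ) * (K * ((K * l2 u) * (K * l2 x))) := by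
    refine mul_le_mul_of_nonneg_left (b1.trans ?_) (by positivity)
    have : (K * l2 v) * (K * l2 x) ≤ (K * l2 u) * (K * l2 x) := by gcongr
    refine this.trans (le_mul_of_one_le_left (by positivity) hK)
  refine (add_le_add b3 b4).trans (le_of_eq ?_)
  ring

/-- Deleting a row is a rank-one change with prefactor `1/T`, and the remaining product has bounded
mean. -/
theorem HasMomentBounds.abs_integral_resolvent_sub_fullRes_le (h : HasMomentBounds γ M K T m μ)
    (hγ : 0 < γ) (u x : Fin T → ℝ) :
    |∫ z, u ⬝ᵥ resolvent γ (Matrix.of z.2) *ᵥ x ∂(μ.prod (Measure.pi fun _ : Fin m => μ)) -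
      ∫ z, u ⬝ᵥ fullRes γ z *ᵥ x ∂(μ.prod (Measure.pi fun _ : Fin m => μ))| ≤
      K ^ 2 * (1 / (T : ℝ)) * (l2 u * l2 x) := by
  have hμ := h.memLp_l2
  have hK := h.one_le
  have hu0 := l2_nonneg u
  have hx0 := l2_nonneg x
  have p4 := (polyBdd_linQ (m := m) hγ u).mul (polyBdd_linQD hγ x)
  simp only [dotProduct_fullRes hγ]
  rw [integral_sub ((polyBdd_dotProduct_resolvent hγ u x).integrable hμ)
    ((p4.const_mul _).integrable hμ), integral_const_mul, sub_sub_cancel, abs_mul,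
    abs_of_nonneg (by positivity : 0 ≤ 1 / (T : ℝ))]
  have b1 := (polyBdd_linQ hγ u).abs_integral_mul_le (polyBdd_linQD hγ x) hμ
      (by positivity) (by positivity) (h.linQ_bound u) (h.linQD_bound x)
  refine (mul_le_mul_of_nonneg_left b1 (by positivity)).trans (le_of_eq ?_)
  ring

/-- A bound for `E[Q₋² - Q²]`. -/
theorem HasMomentBounds.abs_integral_fullRes_sq_sub_le (h : HasMomentBounds γ M K T m μ)
    (hγ : 0 < γ) (u x : Fin T → ℝ) :
    |∫ z, u ⬝ᵥ fullRes γ z *ᵥ (fullRes γ z *ᵥ x) ∂(μ.prod (Measure.pi fun _ : Fin m => μ)) -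
      ∫ z, u ⬝ᵥ resolvent γ (Matrix.of z.2) *ᵥ (resolvent γ (Matrix.of z.2) *ᵥ x)
        ∂(μ.prod (Measure.pi fun _ : Fin m => μ))| ≤
      3 * K ^ 3 * (1 / (T : ℝ)) * (l2 u * l2 x) := by
  have hμ := h.memLp_l2
  have hK := h.one_le
  have hu0 := l2_nonneg u
  have hx0 := l2_nonneg x
  set ν := Measure.pi fun _ : Fin m => μ
  have pxu := (polyBdd_linQ (m := m) hγ x).mul (polyBdd_linQQD hγ u)
  have pux := (polyBdd_linQ (m := m) hγ u).mul (polyBdd_linQQD hγ x)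
  have pr := (polyBdd_quadQQ_div (T := T) (m := m) hγ).mul (polyBdd_linQD hγ u)
  have prx := pr.mul (polyBdd_linQ hγ x)
  have p0 := polyBdd_dotProduct_resolvent_sq (m := m) hγ u x
  have e : ∫ z, u ⬝ᵥ fullRes γ z *ᵥ (fullRes γ z *ᵥ x) ∂(μ.prod ν) -
      ∫ z : (Fin T → ℝ) × (Fin m → Fin T → ℝ),
        u ⬝ᵥ resolvent γ (Matrix.of z.2) *ᵥ (resolvent γ (Matrix.of z.2) *ᵥ x) ∂(μ.prod ν) =
      1 / (T : ℝ) * (∫ z, quadQQ γ z / (1 + quadQ γ z) * linQD γ u z * linQ γ x z ∂(μ.prod ν) -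
        ∫ z, linQ γ x z * linQQD γ u z ∂(μ.prod ν) -
        ∫ z, linQ γ u z * linQQD γ x z ∂(μ.prod ν)) := by
    have i1 := ((p0.sub (pxu.const_mul (1 / (T : ℝ)))).sub (pux.const_mul (1 / (T : ℝ))))
    simp only [dotProduct_fullRes_sq hγ]
    rw [integral_add (i1.integrable hμ) ((prx.const_mul _).integrable hμ),
      integral_sub ((p0.sub (pxu.const_mul (1 / (T : ℝ)))).integrable hμ)
        ((pux.const_mul _).integrable hμ),
      integral_sub (p0.integrable hμ) ((pxu.const_mul _).integrable hμ), integral_const_mul,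
      integral_const_mul, integral_const_mul]
    ring
  have b1 := (polyBdd_linQ hγ x).abs_integral_mul_le (polyBdd_linQQD hγ u) hμ
      (by positivity) (by positivity) (h.linQ_bound x) (h.linQQD_bound u)
  have b2 := (polyBdd_linQ hγ u).abs_integral_mul_le (polyBdd_linQQD hγ x) hμ
      (by positivity) (by positivity) (h.linQ_bound u) (h.linQQD_bound x)
  have b3 : |∫ z, quadQQ γ z / (1 + quadQ γ z) * linQD γ u z * linQ γ x z ∂(μ.prod ν)| ≤
      (K * (K * l2 u)) * (K * l2 x) := by
    refine pr.abs_integral_mul_le (polyBdd_linQ hγ x) hμ (by positivity) (by positivity) ?_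
      (h.linQ_bound x)
    refine (integral_mono ((pr.pow 2).integrable hμ)
      ((((polyBdd_linQD hγ u).pow 2).const_mul (K ^ 2)).integrable hμ) fun z => ?_).trans ?_
    · dsimp only
      rw [mul_pow]
      refine mul_le_mul_of_nonneg_right ?_ (sq_nonneg _)
      have := abs_le.1 ((abs_quadQQ_div_le hγ z).trans h.one_div_le)
      exact sq_le_sq' this.1 this.2
    · rw [integral_const_mul, mul_pow K]
      exact mul_le_mul_of_nonneg_left (h.linQD_bound u) (sq_nonneg _)
  rw [e, abs_mul, abs_of_nonneg (by positivity : 0 ≤ 1 / (T : ℝ))]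
  have h23 : (K * l2 x) * (K * l2 u) ≤ K ^ 3 * (l2 u * l2 x) := by
    have : K ^ 2 ≤ K ^ 3 := pow_le_pow_right₀ hK (by norm_num)
    have := mul_le_mul_of_nonneg_right this (mul_nonneg hu0 hx0)
    nlinarith
  have : |∫ z, quadQQ γ z / (1 + quadQ γ z) * linQD γ u z * linQ γ x z ∂(μ.prod ν) -
        ∫ z, linQ γ x z * linQQD γ u z ∂(μ.prod ν) -
        ∫ z, linQ γ u z * linQQD γ x z ∂(μ.prod ν)| ≤ 3 * K ^ 3 * (l2 u * l2 x) := by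
    refine ((abs_sub _ _).trans (add_le_add_left (abs_sub _ _) _)).trans ?_
    linarith
  refine (mul_le_mul_of_nonneg_left this (by positivity)).trans (le_of_eq ?_)
  ring

/-- The bias of the square of the resolvent. -/
theorem HasMomentBounds.abs_integral_fullRes_sq_sub_equivalent_le
    (h : HasMomentBounds γ M K T m μ)
    (hγ : 0 < γ) {a b ρ : ℝ} (ha : 0 ≤ a) (haM : a ≤ M / γ) (hb : 0 ≤ b) (hbK : b ≤ K)
    (hρ : 0 ≤ ρ)
    (hquad : ∫ z, (quadQ γ z - a) ^ 4 ∂(μ.prod (Measure.pi fun _ : Fin m => μ)) ≤ ρ ^ 4)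
    (hquad2 : ∫ z, (quadQQ γ z - b) ^ 4 ∂(μ.prod (Measure.pi fun _ : Fin m => μ)) ≤ ρ ^ 4)
    (u x : Fin T → ℝ) :
    |∫ z, u ⬝ᵥ fullRes γ z *ᵥ (fullRes γ z *ᵥ x) ∂(μ.prod (Measure.pi fun _ : Fin m => μ)) -
      (u ⬝ᵥ Qbar (m + 1) γ (momentMatrix μ) a *ᵥ (Qbar (m + 1) γ (momentMatrix μ) a *ᵥ x) +
        b / (1 + a) * (u ⬝ᵥ Qbar (m + 1) γ (momentMatrix μ) a *ᵥ (Psi (m + 1) (momentMatrix μ) a *ᵥ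
          (Qbar (m + 1) γ (momentMatrix μ) a *ᵥ x))))| ≤
      15 * K ^ 4 * (1 / (T : ℝ) + ρ) * (l2 u * l2 x) := by
  have hμ := h.memLp_l2
  have hΦ := posSemidef_momentMatrix (integrable_l2_sq hμ)
  have R1 := fun u x => h.abs_integral_fullRes_sub_le hγ ha haM hρ hquad u x
  set Φ := momentMatrix μ with hΦdef
  set ν := Measure.pi fun _ : Fin m => μ
  set w := Qbar (m + 1) γ Φ a *ᵥ u with hw
  set v := Psi (m + 1) Φ a *ᵥ w with hv
  have hu : v + γ • w = u := Psi_Qbar_add hγ hΦ (m + 1) ha u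
  have hwx : u ⬝ᵥ Qbar (m + 1) γ Φ a *ᵥ (Qbar (m + 1) γ Φ a *ᵥ x) =
      w ⬝ᵥ Qbar (m + 1) γ Φ a *ᵥ x := dotProduct_Qbar hΦ (m + 1) ha u _
  have hPsym : (Psi (m + 1) Φ a)ᵀ = Psi (m + 1) Φ a := by
    simpa using (posSemidef_Psi hΦ (m + 1) ha).isHermitian.eq
  have hvx : u ⬝ᵥ Qbar (m + 1) γ Φ a *ᵥ (Psi (m + 1) Φ a *ᵥ (Qbar (m + 1) γ Φ a *ᵥ x)) =
      v ⬝ᵥ Qbar (m + 1) γ Φ a *ᵥ x := by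
    rw [dotProduct_Qbar hΦ (m + 1) ha u, dotProduct_mulVec_symm hPsym]
  have hvu : l2 v ≤ l2 u := l2_Psi_Qbar_le hγ hΦ (m + 1) ha u
  have hwu : l2 w ≤ l2 u / γ := l2_Qbar_le hγ hΦ (m + 1) ha u
  have hK := h.one_le
  have hu0 := l2_nonneg u
  have hx0 := l2_nonneg x
  have hv0 := l2_nonneg v
  have hwu' : l2 w ≤ K * l2 u := by
    refine hwu.trans ?_
    rw [div_eq_mul_one_div, mul_comm]
    exact mul_le_mul_of_nonneg_right h.one_div_le hu0
  set c := ((m + 1 : ℕ) : ℝ) / T with hc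
  have hc0 : 0 ≤ c := by positivity
  have ha1 : 0 < 1 + a := by linarith
  have hvΦ : v = (c / (1 + a)) • Φ *ᵥ w := by
    rw [hv, Psi, Matrix.smul_mulVec]
  have p1 := polyBdd_dotProduct_fullRes_sq (m := m) hγ v x
  have p2 := polyBdd_dotProduct_fullRes_sq (m := m) hγ w x
  have pw := polyBdd_fst_dotProduct (m := m) w
  have pq := (polyBdd_quadQ (T := T) (m := m) hγ).sub (PolyBdd.const a)
  have pD := polyBdd_inv_one_add_quadQ (T := T) (m := m) hγ
  have pX : PolyBdd fun z : (Fin T → ℝ) × (Fin m → Fin T → ℝ) =>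
      quadQQ γ z * ((1 + quadQ γ z)⁻¹ * (1 + quadQ γ z)⁻¹) - b / (1 + a) ^ 2 :=
    ((polyBdd_quadQQ hγ).mul (pD.mul pD)).sub (PolyBdd.const _)
  have e1 : ∫ z, u ⬝ᵥ fullRes γ z *ᵥ (fullRes γ z *ᵥ x) ∂(μ.prod ν) =
      ∫ z, v ⬝ᵥ fullRes γ z *ᵥ (fullRes γ z *ᵥ x) ∂(μ.prod ν) +
      γ * ∫ z, w ⬝ᵥ fullRes γ z *ᵥ (fullRes γ z *ᵥ x) ∂(μ.prod ν) := by
    rw [← integral_const_mul, ← integral_add (p1.integrable hμ)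
      ((p2.const_mul γ).integrable hμ)]
    refine integral_congr_ae (Eventually.of_forall fun z => ?_)
    dsimp only
    rw [← smul_eq_mul, ← smul_dotProduct, ← add_dotProduct, hu]
  have e2 := mul_integral_dotProduct_fullRes_sq (m := m) hγ hμ w x
  have e4 : ∫ z : (Fin T → ℝ) × (Fin m → Fin T → ℝ),
      v ⬝ᵥ resolvent γ (Matrix.of z.2) *ᵥ (resolvent γ (Matrix.of z.2) *ᵥ x)
      ∂(μ.prod ν) = c / (1 + a) * ∫ z, (z.1 ⬝ᵥ w) * linQQ γ x z ∂(μ.prod ν) := by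
    have := integral_fst_dotProduct_mul hμ (ν := ν) w
      (fun R => resolvent γ (Matrix.of R) *ᵥ (resolvent γ (Matrix.of R) *ᵥ x))
      (polyBdd_linQQ hγ x) (polyBdd_dotProduct_resolvent_sq hγ _ x)
    unfold linQQ
    rw [this, ← integral_const_mul]
    refine integral_congr_ae (Eventually.of_forall fun z => ?_)
    dsimp only
    rw [hvΦ, smul_dotProduct, smul_eq_mul]
  have e5 : ∫ z : (Fin T → ℝ) × (Fin m → Fin T → ℝ), v ⬝ᵥ resolvent γ (Matrix.of z.2) *ᵥ x
      ∂(μ.prod ν) = c / (1 + a) * ∫ z, (z.1 ⬝ᵥ w) * linQ γ x z ∂(μ.prod ν) := by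
    have := integral_fst_dotProduct_mul hμ (ν := ν) w
      (fun R => resolvent γ (Matrix.of R) *ᵥ x) (polyBdd_linQ hγ x)
      (polyBdd_dotProduct_resolvent hγ _ x)
    unfold linQ
    rw [this, ← integral_const_mul]
    refine integral_congr_ae (Eventually.of_forall fun z => ?_)
    dsimp only
    rw [hvΦ, smul_dotProduct, smul_eq_mul]
  have q1 := (pw.mul (polyBdd_linQQ hγ x))
  have q2 := (pw.mul (polyBdd_linQ hγ x))
  have q3 := (pw.mul pq).mul (polyBdd_linQQD hγ x)
  have q4 := (pw.mul pX).mul (polyBdd_linQ hγ x)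
  -- Here `sᵀQ²x = linQQ/(1+quadQ) - quadQQ·linQ/(1+quadQ)²`. Freezing `quadQ` at `a` and `quadQQ`
  -- at `b` leaves the two main terms; the other two integrals are the errors.
  have e6 : c * ∫ z, (z.1 ⬝ᵥ w) * (z.1 ⬝ᵥ fullRes γ z *ᵥ (fullRes γ z *ᵥ x)) ∂(μ.prod ν) =
      c / (1 + a) * ∫ z, (z.1 ⬝ᵥ w) * linQQ γ x z ∂(μ.prod ν) -
      c / (1 + a) * ∫ z, (z.1 ⬝ᵥ w) * (quadQ γ z - a) * linQQD γ x z ∂(μ.prod ν) -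
      c * (b / (1 + a) ^ 2) * ∫ z, (z.1 ⬝ᵥ w) * linQ γ x z ∂(μ.prod ν) -
      c * ∫ z, (z.1 ⬝ᵥ w) * (quadQQ γ z * ((1 + quadQ γ z)⁻¹ * (1 + quadQ γ z)⁻¹) -
        b / (1 + a) ^ 2) * linQ γ x z ∂(μ.prod ν) := by
    simp only [← integral_const_mul]
    rw [← integral_sub ((q1.const_mul _).integrable hμ) ((q3.const_mul _).integrable hμ),
      ← integral_sub (((q1.const_mul _).sub (q3.const_mul _)).integrable hμ)
        ((q2.const_mul _).integrable hμ),
      ← integral_sub ((((q1.const_mul _).sub (q3.const_mul _)).sub (q2.const_mul _)).integrable hμ)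
        ((q4.const_mul _).integrable hμ)]
    refine integral_congr_ae (Eventually.of_forall fun z => ?_)
    have hD := (one_add_quadQ_pos hγ z).ne'
    dsimp only
    rw [fst_dotProduct_fullRes_sq hγ]
    unfold linQD linQQD
    field_simp
    ring
  have bA := h.abs_integral_fullRes_sq_sub_le hγ v x
  have hX : ∀ z : (Fin T → ℝ) × (Fin m → Fin T → ℝ),
      (quadQQ γ z * ((1 + quadQ γ z)⁻¹ * (1 + quadQ γ z)⁻¹) - b / (1 + a) ^ 2) ^ 4 ≤
      8 * ((quadQQ γ z - b) ^ 4 + 16 * K ^ 4 * (quadQ γ z - a) ^ 4) := by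
    intro z
    have hq := quadQ_nonneg hγ z
    have hD := one_add_quadQ_pos hγ z
    set D := 1 + quadQ γ z
    have hD1 : D⁻¹ ≤ 1 := inv_le_one_of_one_le₀ (by linarith)
    have hD0 : 0 ≤ D⁻¹ := (inv_pos.2 hD).le
    have hA1 : (1 + a)⁻¹ ≤ 1 := inv_le_one_of_one_le₀ (by linarith)
    have hA0 : 0 ≤ (1 + a)⁻¹ := (inv_pos.2 ha1).le
    -- The difference of inverse squares factors through `quadQ - a`. Its other factors are at most
    -- `2` in total since `D` and `1 + a` are at least 1; hence `16 = 2⁴` in `f2`.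
    have key : quadQQ γ z * (D⁻¹ * D⁻¹) - b / (1 + a) ^ 2 =
        (quadQQ γ z - b) * (D⁻¹ * D⁻¹) +
        b * (-(D⁻¹ * (1 + a)⁻¹ * (D⁻¹ + (1 + a)⁻¹))) * (quadQ γ z - a) := by
      have : quadQ γ z = D - 1 := by simp [D]
      rw [this]
      field_simp
      ring
    have f1 : (D⁻¹ * D⁻¹) ^ 4 ≤ 1 :=
      pow_le_one₀ (by positivity) (mul_le_one₀ hD1 hD0 hD1)
    have f2 : (b * (-(D⁻¹ * (1 + a)⁻¹ * (D⁻¹ + (1 + a)⁻¹)))) ^ 4 ≤ 16 * K ^ 4 := by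
      have g1 : D⁻¹ * (1 + a)⁻¹ * (D⁻¹ + (1 + a)⁻¹) ≤ 1 * 2 :=
        mul_le_mul (mul_le_one₀ hD1 hA0 hA1) (by linarith) (by positivity) zero_le_one
      have g2 : b * (D⁻¹ * (1 + a)⁻¹ * (D⁻¹ + (1 + a)⁻¹)) ≤ K * (1 * 2) :=
        mul_le_mul hbK g1 (by positivity) (by linarith)
      have g3 := pow_le_pow_left₀ (by positivity) g2 4
      calc _ = (b * (D⁻¹ * (1 + a)⁻¹ * (D⁻¹ + (1 + a)⁻¹))) ^ 4 := by ring
        _ ≤ _ := g3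
        _ = _ := by ring
    rw [key]
    refine (add_pow_four_le _ _).trans ?_
    rw [mul_pow, mul_pow _ (quadQ γ z - a)]
    have g1 : (quadQQ γ z - b) ^ 4 * (D⁻¹ * D⁻¹) ^ 4 ≤ (quadQQ γ z - b) ^ 4 :=
      mul_le_of_le_one_right (by positivity) f1
    have g2 := mul_le_mul_of_nonneg_right f2 (by positivity : 0 ≤ (quadQ γ z - a) ^ 4)
    linarith
  have hXi : ∫ z, (quadQQ γ z * ((1 + quadQ γ z)⁻¹ * (1 + quadQ γ z)⁻¹) - b / (1 + a) ^ 2) ^ 4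
      ∂(μ.prod ν) ≤ (8 * K * ρ) ^ 4 := by
    have pb := ((polyBdd_quadQQ (T := T) (m := m) hγ).sub (PolyBdd.const b)).pow 4
    refine (integral_mono ((pX.pow 4).integrable hμ)
      (((pb.add ((pq.pow 4).const_mul (16 * K ^ 4))).const_mul 8).integrable hμ) hX).trans ?_
    rw [integral_const_mul, integral_add (pb.integrable hμ)
      (((pq.pow 4).const_mul (16 * K ^ 4)).integrable hμ), integral_const_mul]
    have hK4 : 1 ≤ K ^ 4 := one_le_pow₀ hK
    have g1 := mul_le_mul_of_nonneg_left hquad (by positivity : 0 ≤ 16 * K ^ 4)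
    have g2 : ρ ^ 4 ≤ K ^ 4 * ρ ^ 4 := le_mul_of_one_le_left (by positivity) hK4
    calc _ ≤ 8 * (K ^ 4 * ρ ^ 4 + 16 * K ^ 4 * ρ ^ 4) := by linarith
      _ ≤ 4096 * (K ^ 4 * ρ ^ 4) := by
          have : 0 ≤ K ^ 4 * ρ ^ 4 := by positivity
          linarith
      _ = _ := by ring
  have hwp : ∫ z : (Fin T → ℝ) × (Fin m → Fin T → ℝ), (z.1 ⬝ᵥ w) ^ 4 ∂(μ.prod ν) ≤
      (K * l2 u) ^ 4 := by
    rw [integral_fun_fst (μ := μ) (ν := ν) (fun s => (s ⬝ᵥ w) ^ 4)]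
    simp only [probReal_univ, one_smul]
    exact h.fst_bound a ha haM u
  have bB : |∫ z, (z.1 ⬝ᵥ w) * (quadQ γ z - a) * linQQD γ x z ∂(μ.prod ν)| ≤
      (K * l2 u) * ρ * (K * l2 x) :=
    pw.abs_integral_mul_mul_le pq (polyBdd_linQQD hγ x) hμ
      (by positivity) hρ (by positivity) hwp hquad (h.linQQD_bound x)
  have bC : |∫ z, (z.1 ⬝ᵥ w) * (quadQQ γ z * ((1 + quadQ γ z)⁻¹ * (1 + quadQ γ z)⁻¹) -
        b / (1 + a) ^ 2) * linQ γ x z ∂(μ.prod ν)| ≤ (K * l2 u) * (8 * K * ρ) * (K * l2 x) :=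
    pw.abs_integral_mul_mul_le pX (polyBdd_linQ hγ x) hμ
      (by positivity) (by positivity) (by positivity) hwp hXi (h.linQ_bound x)
  have bD := R1 w x
  have bE := R1 v x
  have bF := h.abs_integral_resolvent_sub_fullRes_le hγ v x
  set I1 := ∫ z, v ⬝ᵥ fullRes γ z *ᵥ (fullRes γ z *ᵥ x) ∂(μ.prod ν)
  set I2 := ∫ z, w ⬝ᵥ fullRes γ z *ᵥ (fullRes γ z *ᵥ x) ∂(μ.prod ν)
  set I3 := ∫ z : (Fin T → ℝ) × (Fin m → Fin T → ℝ),
      v ⬝ᵥ resolvent γ (Matrix.of z.2) *ᵥ (resolvent γ (Matrix.of z.2) *ᵥ x) ∂(μ.prod ν)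
  set I4 := ∫ z : (Fin T → ℝ) × (Fin m → Fin T → ℝ),
      v ⬝ᵥ resolvent γ (Matrix.of z.2) *ᵥ x ∂(μ.prod ν)
  set I5 := ∫ z, w ⬝ᵥ fullRes γ z *ᵥ x ∂(μ.prod ν)
  set I6 := ∫ z, v ⬝ᵥ fullRes γ z *ᵥ x ∂(μ.prod ν)
  set J1 := ∫ z, (z.1 ⬝ᵥ w) * (quadQ γ z - a) * linQQD γ x z ∂(μ.prod ν)
  set J2 := ∫ z, (z.1 ⬝ᵥ w) * (quadQQ γ z * ((1 + quadQ γ z)⁻¹ * (1 + quadQ γ z)⁻¹) -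
        b / (1 + a) ^ 2) * linQ γ x z ∂(μ.prod ν)
  set J3 := ∫ z, (z.1 ⬝ᵥ w) * linQ γ x z ∂(μ.prod ν)
  set J4 := ∫ z, (z.1 ⬝ᵥ w) * linQQ γ x z ∂(μ.prod ν)
  -- The frozen term is again a mean of `vᵀQ₋x`, for which the first-order equivalent `vᵀQ̄x` is
  -- available; this produces `Q̄ΨQ̄`.
  have e7 : c * (b / (1 + a) ^ 2) * J3 = b / (1 + a) * I4 := by
    rw [e5]; field_simp
  have e8 : I1 + γ * I2 - (w ⬝ᵥ Qbar (m + 1) γ Φ a *ᵥ x + b / (1 + a) *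
      (v ⬝ᵥ Qbar (m + 1) γ Φ a *ᵥ x)) = (I1 - I3) + c / (1 + a) * J1 + c * J2 +
      (I5 - w ⬝ᵥ Qbar (m + 1) γ Φ a *ᵥ x) +
      b / (1 + a) * ((I4 - I6) + (I6 - v ⬝ᵥ Qbar (m + 1) γ Φ a *ᵥ x)) := by
    have : γ * I2 = I5 - c * ∫ z, (z.1 ⬝ᵥ w) * (z.1 ⬝ᵥ fullRes γ z *ᵥ (fullRes γ z *ᵥ x))
        ∂(μ.prod ν) := by linarith
    rw [this, e6, e7, e4]
    ring
  rw [e1, hwx, hvx, e8]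
  have hba : b / (1 + a) ≤ K := (div_le_self hb (by linarith)).trans hbK
  have hba0 : 0 ≤ b / (1 + a) := by positivity
  have hca : c / (1 + a) ≤ K := (div_le_self hc0 (by linarith)).trans h.ratio_le
  have hca0 : 0 ≤ c / (1 + a) := by positivity
  have hτ : 0 ≤ 1 / (T : ℝ) := by positivity
  set τ := 1 / (T : ℝ)
  set U := l2 u * l2 x with hU
  have hU0 : 0 ≤ U := mul_nonneg hu0 hx0
  have hvU : l2 v * l2 x ≤ U := mul_le_mul_of_nonneg_right hvu hx0
  have hwU : l2 w * l2 x ≤ K * U := by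
    have := mul_le_mul_of_nonneg_right hwu' hx0
    linarith
  have hK0 : 0 ≤ K := by linarith
  have hK34 : K ^ 3 ≤ K ^ 4 := pow_le_pow_right₀ hK (by norm_num)
  have hK23 : K ^ 2 ≤ K ^ 3 := pow_le_pow_right₀ hK (by norm_num)
  have t1 : |I1 - I3| ≤ 3 * (K ^ 4 * τ * U) := by
    refine bA.trans ?_
    calc 3 * K ^ 3 * τ * (l2 v * l2 x) ≤ 3 * K ^ 4 * τ * U := by gcongr
      _ = _ := by ring
  have t2 : |c / (1 + a) * J1| ≤ K ^ 4 * ρ * U := by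
    rw [abs_mul, abs_of_nonneg hca0]
    calc _ ≤ K * ((K * l2 u) * ρ * (K * l2 x)) := mul_le_mul hca bB (abs_nonneg _) hK0
      _ = K ^ 3 * ρ * U := by rw [hU]; ring
      _ ≤ _ := by gcongr
  have t3 : |c * J2| ≤ 8 * (K ^ 4 * ρ * U) := by
    rw [abs_mul, abs_of_nonneg hc0]
    calc _ ≤ K * ((K * l2 u) * (8 * K * ρ) * (K * l2 x)) :=
          mul_le_mul h.ratio_le bC (abs_nonneg _) hK0
      _ = _ := by rw [hU]; ring
  have t4 : |I5 - w ⬝ᵥ Qbar (m + 1) γ Φ a *ᵥ x| ≤ K ^ 4 * (τ + ρ) * U := by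
    refine bD.trans ?_
    calc _ ≤ K ^ 3 * (τ + ρ) * (K * U) := by gcongr
      _ = _ := by ring
  have t5 : |b / (1 + a) * ((I4 - I6) + (I6 - v ⬝ᵥ Qbar (m + 1) γ Φ a *ᵥ x))| ≤
      2 * (K ^ 4 * (τ + ρ) * U) := by
    rw [abs_mul, abs_of_nonneg hba0]
    have s1 : |I4 - I6| ≤ K ^ 3 * (τ + ρ) * U := by
      refine bF.trans ?_
      have : τ ≤ τ + ρ := by linarith
      gcongr
    have s2 : |I6 - v ⬝ᵥ Qbar (m + 1) γ Φ a *ᵥ x| ≤ K ^ 3 * (τ + ρ) * U := by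
      refine bE.trans ?_
      gcongr
    have s3 := (abs_add_le (I4 - I6) (I6 - v ⬝ᵥ Qbar (m + 1) γ Φ a *ᵥ x)).trans (add_le_add s1 s2)
    calc _ ≤ K * (K ^ 3 * (τ + ρ) * U + K ^ 3 * (τ + ρ) * U) :=
          mul_le_mul hba s3 (abs_nonneg _) hK0
      _ = _ := by ring
  have t6 := abs_add_le ((I1 - I3) + c / (1 + a) * J1 + c * J2 +
      (I5 - w ⬝ᵥ Qbar (m + 1) γ Φ a *ᵥ x))
      (b / (1 + a) * ((I4 - I6) + (I6 - v ⬝ᵥ Qbar (m + 1) γ Φ a *ᵥ x)))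
  have t7 := abs_add_le ((I1 - I3) + c / (1 + a) * J1 + c * J2)
      (I5 - w ⬝ᵥ Qbar (m + 1) γ Φ a *ᵥ x)
  have t8 := abs_add_le ((I1 - I3) + c / (1 + a) * J1) (c * J2)
  have t9 := abs_add_le (I1 - I3) (c / (1 + a) * J1)
  have s4 : 0 ≤ K ^ 4 * τ * U := by positivity
  have s5 : 0 ≤ K ^ 4 * ρ * U := by positivity
  have : 15 * K ^ 4 * (τ + ρ) * U = 15 * (K ^ 4 * τ * U) + 15 * (K ^ 4 * ρ * U) := by ring
  have s6 : K ^ 4 * (τ + ρ) * U = K ^ 4 * τ * U + K ^ 4 * ρ * U := by ring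
  linarith

end Bias

/-! ### The fixed-point equation: existence, uniqueness, stability. -/

section FixedPoint

variable {T N : ℕ} {Φ : Matrix (Fin T) (Fin T) ℝ} {γ a δ : ℝ}

theorem trace_transpose_mul_self_mul {ι κ : Type*} [Fintype ι] [Fintype κ] (B : Matrix κ ι ℝ)
    (D : Matrix ι ι ℝ) : (Bᵀ * B * D).trace = ∑ i, B i ⬝ᵥ D *ᵥ B i := by
  rw [Matrix.mul_assoc, Matrix.trace_mul_comm, Matrix.trace]
  refine Finset.sum_congr rfl fun i _ => ?_
  rw [Matrix.diag_apply, Matrix.mul_apply', Matrix.mul_apply_eq_vecMul, Matrix.dotProduct_mulVec]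
  rfl

open scoped MatrixOrder Matrix.Norms.L2Operator in
theorem exists_trace_mul_eq_sum {ι : Type*} [Fintype ι] {A : Matrix ι ι ℝ} (hA : A.PosSemidef) :
    ∃ B : Matrix ι ι ℝ, A = Bᵀ * B ∧
      ∀ D : Matrix ι ι ℝ, (A * D).trace = ∑ i, B i ⬝ᵥ D *ᵥ B i := by
  classical
  obtain ⟨B, rfl⟩ := CStarAlgebra.nonneg_iff_eq_star_mul_self.mp hA.nonneg
  rw [Matrix.star_eq_conjTranspose, Matrix.conjTranspose_eq_transpose_of_trivial]
  exact ⟨B, rfl, trace_transpose_mul_self_mul B⟩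

theorem trace_mul_le_trace_mul {ι : Type*} [Fintype ι] {A D D' : Matrix ι ι ℝ}
    (hA : A.PosSemidef) (h : ∀ x, x ⬝ᵥ D *ᵥ x ≤ x ⬝ᵥ D' *ᵥ x) :
    (A * D).trace ≤ (A * D').trace := by
  obtain ⟨B, -, hB⟩ := exists_trace_mul_eq_sum hA
  rw [hB, hB]
  exact Finset.sum_le_sum fun i _ => h _

/-- The right-hand side of the fixed-point equation. -/
noncomputable def deltaMap (N : ℕ) (γ : ℝ) (Φ : Matrix (Fin T) (Fin T) ℝ) (a : ℝ) : ℝ :=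
  1 / (T : ℝ) * (Φ * Qbar N γ Φ a).trace

theorem deltaMap_nonneg (hγ : 0 < γ) (hΦ : Φ.PosSemidef) (ha : 0 ≤ a) :
    0 ≤ deltaMap N γ Φ a := by
  have := trace_mul_le_trace_mul (D := 0) (D' := Qbar N γ Φ a) hΦ fun x => by
    rw [Matrix.zero_mulVec, dotProduct_zero]
    exact dotProduct_regInv_nonneg hγ (posSemidef_Psi hΦ N ha) x
  rw [Matrix.mul_zero, Matrix.trace_zero] at this
  unfold deltaMap
  positivity

theorem deltaMap_le (hγ : 0 < γ) (hΦ : Φ.PosSemidef) (ha : 0 ≤ a) :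
    deltaMap N γ Φ a ≤ 1 / (T : ℝ) * Φ.trace / γ := by
  have := trace_mul_le_trace_mul (D := Qbar N γ Φ a) (D' := γ⁻¹ • 1) hΦ fun x => by
    refine (dotProduct_regInv_le hγ (posSemidef_Psi hΦ N ha) x).trans (le_of_eq ?_)
    rw [Matrix.smul_mulVec, Matrix.one_mulVec, dotProduct_smul, l2_sq, smul_eq_mul, div_eq_inv_mul]
  rw [Matrix.mul_smul, Matrix.mul_one, Matrix.trace_smul, smul_eq_mul] at this
  rw [mul_div_assoc, div_eq_inv_mul Φ.trace]
  exact mul_le_mul_of_nonneg_left this (by positivity)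

/-- A comparison relative to the form at `δ`, hence free of the norm of `Φ`. With `y = Q̄(δ)x` and
`w = Q̄(a)y`, the increment is `(a-δ)/(1+δ)` times `xᵀ(y - γw)`. This lies between `0` and `xᵀy`,
because `Ψ(a)`, `Ψ(δ)` and their resolvents are nonnegative and commute. -/
theorem abs_dotProduct_Qbar_sub_le (hγ : 0 < γ) (hΦ : Φ.PosSemidef) (ha : 0 ≤ a) (hδ : 0 ≤ δ)
    (x : Fin T → ℝ) :
    |x ⬝ᵥ Qbar N γ Φ a *ᵥ x - x ⬝ᵥ Qbar N γ Φ δ *ᵥ x| ≤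
      |a - δ| / (1 + δ) * (x ⬝ᵥ Qbar N γ Φ δ *ᵥ x) := by
  have hP := posSemidef_Psi hΦ N ha
  have hxy := Psi_Qbar_add hγ hΦ N hδ x
  set y := Qbar N γ Φ δ *ᵥ x
  have hδ1 : 0 < 1 + δ := by linarith
  have ha1 : 0 < 1 + a := by linarith
  set r := (1 + a) / (1 + δ) with hr
  have hr0 : 0 ≤ r := by positivity
  have hPsi : Psi N Φ δ *ᵥ y = r • (Psi N Φ a *ᵥ y) := by
    rw [Psi, Psi, Matrix.smul_mulVec, Matrix.smul_mulVec, smul_smul]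
    congr 1
    rw [hr]; field_simp
  set v := Psi N Φ a *ᵥ y with hv
  set w := Qbar N γ Φ a *ᵥ y with hw
  have hyw : Psi N Φ a *ᵥ w + γ • w = y := Psi_Qbar_add hγ hΦ N ha y
  have hx : x = r • v + γ • y := by rw [← hxy, hPsi]
  have hQv : Qbar N γ Φ a *ᵥ v = y - γ • w := by
    have h1 : Qbar N γ Φ a *ᵥ (v + γ • y) = y := eq_regInv_mulVec hγ hP rfl
    rw [Matrix.mulVec_add, Matrix.mulVec_smul] at h1
    rw [← h1, add_sub_cancel_right]
  have hQx : Qbar N γ Φ a *ᵥ x = y + ((a - δ) / (1 + δ)) • (y - γ • w) := by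
    have : r = 1 + (a - δ) / (1 + δ) := by rw [hr]; field_simp; ring
    rw [hx, Matrix.mulVec_add, Matrix.mulVec_smul, Matrix.mulVec_smul, hQv, ← hw, this]
    module
  have hyPw : 0 ≤ y ⬝ᵥ (y - γ • w) := by
    have e : y - γ • w = Psi N Φ a *ᵥ w := by
      nth_rw 1 [← hyw]; exact add_sub_cancel_right _ _
    have h1 : y ⬝ᵥ Psi N Φ a *ᵥ w = l2 (Psi N Φ a *ᵥ w) ^ 2 + γ * (w ⬝ᵥ Psi N Φ a *ᵥ w) := by
      nth_rw 1 [← hyw]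
      rw [add_dotProduct, smul_dotProduct, l2_sq, smul_eq_mul]
    rw [e, h1]
    have := dotProduct_mulVec_nonneg hP w
    positivity
  have hvQv : 0 ≤ v ⬝ᵥ (y - γ • w) := by
    rw [← hQv]; exact dotProduct_regInv_nonneg hγ hP v
  have hvw : 0 ≤ v ⬝ᵥ w := by
    have : v ⬝ᵥ w = y ⬝ᵥ (y - γ • w) := by
      rw [← hQv, hw]
      change v ⬝ᵥ regInv γ _ *ᵥ y = y ⬝ᵥ regInv γ _ *ᵥ v
      rw [dotProduct_regInv hP, dotProduct_comm]
    rw [this]; exact hyPw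
  have hyw' : 0 ≤ y ⬝ᵥ w := dotProduct_regInv_nonneg hγ hP y
  have h0 : 0 ≤ x ⬝ᵥ (y - γ • w) := by
    rw [hx, add_dotProduct, smul_dotProduct, smul_dotProduct, smul_eq_mul, smul_eq_mul]
    positivity
  have h1 : x ⬝ᵥ (y - γ • w) ≤ x ⬝ᵥ y := by
    have : 0 ≤ x ⬝ᵥ w := by
      rw [hx, add_dotProduct, smul_dotProduct, smul_dotProduct, smul_eq_mul, smul_eq_mul]
      positivity
    rw [dotProduct_sub, dotProduct_smul, smul_eq_mul]
    nlinarith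
  rw [hQx, dotProduct_add, add_sub_cancel_left, dotProduct_smul, smul_eq_mul, abs_mul, abs_div,
    abs_of_pos hδ1, abs_of_nonneg h0]
  exact mul_le_mul_of_nonneg_left h1 (by positivity)

theorem abs_deltaMap_sub_le (hγ : 0 < γ) (hΦ : Φ.PosSemidef) (ha : 0 ≤ a) (hδ : 0 ≤ δ) :
    |deltaMap N γ Φ a - deltaMap N γ Φ δ| ≤ |a - δ| / (1 + δ) * deltaMap N γ Φ δ := by
  set c := |a - δ| / (1 + δ)
  have h : ∀ x, |x ⬝ᵥ Qbar N γ Φ a *ᵥ x - x ⬝ᵥ Qbar N γ Φ δ *ᵥ x| ≤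
      c * (x ⬝ᵥ Qbar N γ Φ δ *ᵥ x) := abs_dotProduct_Qbar_sub_le hγ hΦ ha hδ
  have h1 := trace_mul_le_trace_mul (D := Qbar N γ Φ a)
    (D' := Qbar N γ Φ δ + c • Qbar N γ Φ δ) hΦ fun x => by
      rw [Matrix.add_mulVec, Matrix.smul_mulVec, dotProduct_add, dotProduct_smul, smul_eq_mul]
      linarith [(abs_le.1 (h x)).2]
  have h2 := trace_mul_le_trace_mul (D := Qbar N γ Φ δ)
    (D' := Qbar N γ Φ a + c • Qbar N γ Φ δ) hΦ fun x => by
      rw [Matrix.add_mulVec, Matrix.smul_mulVec, dotProduct_add, dotProduct_smul, smul_eq_mul]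
      linarith [(abs_le.1 (h x)).1]
  rw [Matrix.mul_add, Matrix.mul_smul, Matrix.trace_add, Matrix.trace_smul, smul_eq_mul] at h1 h2
  have hT : (0 : ℝ) ≤ 1 / (T : ℝ) := by positivity
  have h1' := mul_le_mul_of_nonneg_left h1 hT
  have h2' := mul_le_mul_of_nonneg_left h2 hT
  unfold deltaMap
  rw [abs_le]
  constructor <;> linarith

/-- Stability of the fixed-point equation. -/
theorem IsDelta.abs_sub_le (h : IsDelta N γ Φ δ) (hγ : 0 < γ) (hΦ : Φ.PosSemidef) (ha : 0 ≤ a) :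
    |a - δ| ≤ (1 + δ) * |a - deltaMap N γ Φ a| := by
  obtain ⟨hδ, hfix⟩ := h
  have h1 := abs_deltaMap_sub_le (N := N) hγ hΦ ha hδ
  have hfix' : deltaMap N γ Φ δ = δ := hfix.symm
  rw [hfix'] at h1
  have h2 : |a - δ| ≤ |a - deltaMap N γ Φ a| + |deltaMap N γ Φ a - δ| :=
    _root_.abs_sub_le _ _ _
  have hδ1 : 0 < 1 + δ := by linarith
  -- At a solution the relative Lipschitz ratio is `δ/(1+δ) = 1 - 1/(1+δ)`. Absorbing it on the left
  -- leaves the factor `1/(1+δ)`.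
  have h3 : |a - δ| / (1 + δ) * δ = |a - δ| - |a - δ| / (1 + δ) := by field_simp; ring
  have h4 : |a - δ| / (1 + δ) ≤ |a - deltaMap N γ Φ a| := by linarith
  rwa [div_le_iff₀ hδ1, mul_comm] at h4

theorem existsUnique_isDelta (hγ : 0 < γ) (hΦ : Φ.PosSemidef) (N : ℕ) :
    ∃! δ, IsDelta N γ Φ δ := by
  -- The map takes `[0, ∞)` into `[0, B]`, so continuity on `[0, B]` gives a fixed point. Uniqueness
  -- is the stability bound with zero defect.
  set B := 1 / (T : ℝ) * Φ.trace / γ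
  have hB : 0 ≤ B := (deltaMap_nonneg (N := N) hγ hΦ le_rfl).trans (deltaMap_le hγ hΦ le_rfl)
  have hlip : LipschitzOnWith B.toNNReal (deltaMap N γ Φ) (Set.Icc 0 B) := by
    refine LipschitzOnWith.of_dist_le_mul fun x hx y hy => ?_
    rw [Real.dist_eq, Real.dist_eq, Real.coe_toNNReal _ hB, mul_comm]
    refine (abs_deltaMap_sub_le hγ hΦ hx.1 hy.1).trans ?_
    have h1 : |x - y| / (1 + y) ≤ |x - y| := div_le_self (abs_nonneg _) (by linarith [hy.1])
    exact mul_le_mul h1 (deltaMap_le hγ hΦ hy.1) (deltaMap_nonneg hγ hΦ hy.1) (abs_nonneg _)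
  obtain ⟨δ, hδ, hfix⟩ := exists_mem_Icc_isFixedPt_of_mapsTo hlip.continuousOn hB
    fun x hx => ⟨deltaMap_nonneg hγ hΦ hx.1, deltaMap_le hγ hΦ hx.1⟩
  have hδ' : IsDelta N γ Φ δ := ⟨hδ.1, hfix.symm⟩
  refine ⟨δ, hδ', fun a ha => ?_⟩
  have h := hδ'.abs_sub_le hγ hΦ ha.1
  have hfa : deltaMap N γ Φ a = a := ha.2.symm
  rw [hfa, sub_self, abs_zero, mul_zero] at h
  linarith [abs_nonpos_iff.1 h]

theorem IsDelta.pos (h : IsDelta N γ Φ δ) (hγ : 0 < γ) (hΦ : Φ.PosSemidef) (h0 : Φ ≠ 0) :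
    0 < δ := by
  obtain ⟨hδ, hfix⟩ := h
  refine hδ.lt_of_ne fun hz => h0 ?_
  rcases Nat.eq_zero_or_pos T with rfl | hT
  · exact Subsingleton.elim _ _
  obtain ⟨B, hB, htr⟩ := exists_trace_mul_eq_sum hΦ
  rw [htr, ← hz] at hfix
  have hP := posSemidef_Psi hΦ N (le_refl (0 : ℝ))
  have hnn : ∀ i ∈ Finset.univ, 0 ≤ B i ⬝ᵥ Qbar N γ Φ 0 *ᵥ B i := fun i _ =>
    dotProduct_regInv_nonneg hγ hP _
  have hT' : (T : ℝ) ≠ 0 := by positivity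
  have hs : ∑ i, B i ⬝ᵥ Qbar N γ Φ 0 *ᵥ B i = 0 := by
    rcases mul_eq_zero.1 hfix.symm with h | h
    · simp [hT'] at h
    · exact h
  -- A vanishing sum of nonnegative forms forces `Q̄ Bᵢ = 0`, and `Q̄` is invertible.
  have hBi : ∀ i, B i = 0 := fun i => by
    have h1 := (Finset.sum_eq_zero_iff_of_nonneg hnn).1 hs i (Finset.mem_univ _)
    have h2 := dotProduct_regInv_sq_le hγ hP (B i)
    rw [← Qbar_eq, h1, zero_div] at h2
    have h3 : Qbar N γ Φ 0 *ᵥ B i = 0 := dotProduct_self_eq_zero.1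
      (le_antisymm h2 (by rw [← l2_sq]; positivity))
    have h4 := Psi_Qbar_add hγ hΦ N (le_refl (0 : ℝ)) (B i)
    rw [h3] at h4
    simpa using h4.symm
  have : B = 0 := by ext i j; simp [hBi]
  rw [hB, this, Matrix.mul_zero]

/-- `Q̄ΨQ̄ = Q̄ - γQ̄²`. -/
theorem dotProduct_Qbar_Psi_Qbar (hγ : 0 < γ) (hΦ : Φ.PosSemidef) (N : ℕ) (ha : 0 ≤ a)
    (x : Fin T → ℝ) :
    0 ≤ x ⬝ᵥ Qbar N γ Φ a *ᵥ (Psi N Φ a *ᵥ (Qbar N γ Φ a *ᵥ x)) ∧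
      x ⬝ᵥ Qbar N γ Φ a *ᵥ (Psi N Φ a *ᵥ (Qbar N γ Φ a *ᵥ x)) ≤ x ⬝ᵥ Qbar N γ Φ a *ᵥ x := by
  have h := Psi_Qbar_add hγ hΦ N ha x
  rw [dotProduct_Qbar hΦ N ha x]
  set y := Qbar N γ Φ a *ᵥ x
  refine ⟨dotProduct_mulVec_nonneg (posSemidef_Psi hΦ N ha) y, ?_⟩
  have h1 := congrArg (y ⬝ᵥ ·) h
  simp only [dotProduct_add, dotProduct_smul, smul_eq_mul] at h1
  rw [← l2_sq, dotProduct_comm y x] at h1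
  nlinarith [sq_nonneg (l2 y)]

theorem trace_Psi_mul (N : ℕ) (hN : 0 < N) (D : Matrix (Fin T) (Fin T) ℝ) :
    1 / (N : ℝ) * (Psi N Φ a * D).trace = 1 / (T : ℝ) / (1 + a) * (Φ * D).trace := by
  have : (N : ℝ) ≠ 0 := by positivity
  rw [Psi, Matrix.smul_mul, Matrix.trace_smul, smul_eq_mul, ← mul_assoc]
  congr 1
  rw [div_div, div_div, div_mul_div_comm, one_mul]
  nth_rw 1 [← mul_one (N : ℝ)]
  rw [mul_div_mul_left _ _ this]

/-- `Q̄ΨQ̄ ≤ Q̄` under the trace against `Φ`, followed by the fixed-point equation. It keeps the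
denominator of the equivalent at least `1/(1+δ)`. -/
theorem IsDelta.trace_sq_le (h : IsDelta N γ Φ δ) (hγ : 0 < γ) (hΦ : Φ.PosSemidef) (hN : 0 < N) :
    1 / (N : ℝ) * ((Psi N Φ δ * Qbar N γ Φ δ) ^ 2).trace ≤ δ / (1 + δ) := by
  obtain ⟨hδ, hfix⟩ := h
  rw [sq, Matrix.mul_assoc, trace_Psi_mul N hN]
  have h1 := trace_mul_le_trace_mul (D := Qbar N γ Φ δ * (Psi N Φ δ * Qbar N γ Φ δ))
    (D' := Qbar N γ Φ δ) hΦ fun x => by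
      rw [← Matrix.mulVec_mulVec, ← Matrix.mulVec_mulVec]
      exact (dotProduct_Qbar_Psi_Qbar hγ hΦ N hδ x).2
  have h2 := mul_le_mul_of_nonneg_left h1 (by positivity : 0 ≤ 1 / (T : ℝ) / (1 + δ))
  refine h2.trans (le_of_eq ?_)
  rw [div_mul_eq_mul_div, ← hfix]

end FixedPoint

/-! ### Identification of the scalars `α` and `b`, and the deterministic equivalent of `Q²`. -/

section BiasAssembly

variable {γ M K : ℝ} {T m : ℕ} {μ : Measure (Fin T → ℝ)} [IsProbabilityMeasure μ]

theorem deltaMap_momentMatrix_le (hγ : 0 < γ) (h : HasMomentBounds γ M K T m μ) {a : ℝ} (ha : 0 ≤ a) :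
    deltaMap (m + 1) γ (momentMatrix μ) a ≤ M / γ := by
  have hi := integrable_l2_sq h.memLp_l2
  refine (deltaMap_le hγ (posSemidef_momentMatrix hi) ha).trans ?_
  have hT : (0 : ℝ) < T := by exact_mod_cast h.T_pos
  have h1 : (momentMatrix μ).trace = ∫ s, l2 s ^ 2 ∂μ := by
    have := trace_momentMatrix_mul hi 1
    rw [Matrix.mul_one] at this
    rw [this]
    exact integral_congr_ae (Eventually.of_forall fun s => by
      simp only [Matrix.one_mulVec, l2_sq])
  have h2 : 1 / (T : ℝ) * (momentMatrix μ).trace ≤ M := by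
    rw [h1, one_div, inv_mul_le_iff₀ hT, mul_comm]; exact h.second_moment
  gcongr

/-- The mean of a function of the row and the other rows, against a quadratic form in the row. -/
theorem abs_integral_prod_sub_trace_le (h : HasMomentBounds γ M K T m μ)
    {f : (Fin T → ℝ) × (Fin m → Fin T → ℝ) → ℝ}
    (hf : Integrable f (μ.prod (Measure.pi fun _ : Fin m => μ))) (D : Matrix (Fin T) (Fin T) ℝ)
    {c : ℝ} (hc : 0 ≤ c)
    (hfD : ∀ s, |∫ z, f (s, z.2) ∂(μ.prod (Measure.pi fun _ : Fin m => μ)) - s ⬝ᵥ D *ᵥ s| ≤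
      c * (l2 s * l2 s)) :
    |1 / (T : ℝ) * ∫ z, f z ∂(μ.prod (Measure.pi fun _ : Fin m => μ)) -
      1 / (T : ℝ) * (momentMatrix μ * D).trace| ≤ c * M := by
  have hi := integrable_l2_sq h.memLp_l2
  have hT : (0 : ℝ) < T := by exact_mod_cast h.T_pos
  have hsnd : ∀ s, ∫ z, f (s, z.2) ∂(μ.prod (Measure.pi fun _ : Fin m => μ)) =
      ∫ R, f (s, R) ∂(Measure.pi fun _ : Fin m => μ) := fun s => by
    have := integral_fun_snd (μ := μ) (ν := Measure.pi fun _ : Fin m => μ) (fun R => f (s, R))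
    simpa using this
  have hD : Integrable (fun s => s ⬝ᵥ D *ᵥ s) μ := by
    have e : ∀ s : Fin T → ℝ, s ⬝ᵥ D *ᵥ s = ∑ i, ∑ j, D i j * (s i * s j) := fun s => by
      simp only [dotProduct, Matrix.mulVec, Finset.mul_sum]
      exact Finset.sum_congr rfl fun i _ => Finset.sum_congr rfl fun j _ => by ring
    simp only [e]
    exact integrable_finsetSum _ fun i _ => integrable_finsetSum _ fun j _ =>
      (integrable_apply_mul_apply hi i j).const_mul _
  rw [trace_momentMatrix_mul hi, integral_prod _ hf, ← mul_sub,
    ← integral_sub hf.integral_prod_left hD, abs_mul, abs_of_pos (by positivity)]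
  have h1 : |∫ s, (∫ R, f (s, R) ∂(Measure.pi fun _ : Fin m => μ)) - s ⬝ᵥ D *ᵥ s ∂μ| ≤
      ∫ s, c * l2 s ^ 2 ∂μ := by
    rw [← Real.norm_eq_abs]
    refine norm_integral_le_of_norm_le (hi.const_mul c) (Eventually.of_forall fun s => ?_)
    rw [Real.norm_eq_abs, ← hsnd, sq]
    exact hfD s
  rw [integral_const_mul] at h1
  rw [one_div, inv_mul_le_iff₀ hT]
  refine h1.trans ?_
  have := mul_le_mul_of_nonneg_left h.second_moment hc
  linarith

/-- The deterministic equivalent of the resolvent squared, at the solution of the fixed-point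
equation. -/
theorem HasMomentBounds.abs_integral_resolvent_sq_sub_le (h : HasMomentBounds γ M K T m μ)
    (hγ : 0 < γ) {δ : ℝ} (hδ : IsDelta (m + 1) γ (momentMatrix μ) δ) (u : Fin T → ℝ) :
    |∫ S, u ⬝ᵥ resolvent γ (Matrix.of S) *ᵥ (resolvent γ (Matrix.of S) *ᵥ u)
        ∂(Measure.pi fun _ : Fin (m + 1) => μ) -
      (u ⬝ᵥ Qbar (m + 1) γ (momentMatrix μ) δ *ᵥ (Qbar (m + 1) γ (momentMatrix μ) δ *ᵥ u) +
        (1 / ((m + 1 : ℕ) : ℝ) * (Psi (m + 1) (momentMatrix μ) δ *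
            Qbar (m + 1) γ (momentMatrix μ) δ ^ 2).trace) /
          (1 - 1 / ((m + 1 : ℕ) : ℝ) * ((Psi (m + 1) (momentMatrix μ) δ *
            Qbar (m + 1) γ (momentMatrix μ) δ) ^ 2).trace) *
        (u ⬝ᵥ Qbar (m + 1) γ (momentMatrix μ) δ *ᵥ (Psi (m + 1) (momentMatrix μ) δ *ᵥ
          (Qbar (m + 1) γ (momentMatrix μ) δ *ᵥ u))))| ≤
      393 * K ^ 12 * (1 / √T) * l2 u ^ 2 := by
  have hμ := h.memLp_l2
  have hi := integrable_l2_sq hμ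
  have hΦ := posSemidef_momentMatrix hi
  have hT : (1 : ℝ) ≤ T := by exact_mod_cast h.T_pos
  have hK := h.one_le
  have hK0 : 0 ≤ K := by linarith
  have hM0 : 0 ≤ M := by
    have h1 : 0 ≤ M * T := le_trans (integral_nonneg fun s => by positivity) h.second_moment
    by_contra hneg
    nlinarith
  obtain ⟨η, hη⟩ : ∃ η, η = 1 / √(T : ℝ) := ⟨_, rfl⟩
  have hη0 : 0 ≤ η := by rw [hη]; positivity
  have hη1 : η ≤ 1 := by
    rw [hη, div_le_one (by positivity)]; exact Real.one_le_sqrt.2 hT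
  have hTη : 1 / (T : ℝ) ≤ η := by
    have : 1 / (T : ℝ) = η * η := by
      rw [hη, div_mul_div_comm, Real.mul_self_sqrt (by positivity), one_mul]
    rw [this]; nlinarith
  have pQ := polyBdd_quadQ (T := T) (m := m) hγ
  have pQQ := polyBdd_quadQQ (T := T) (m := m) hγ
  have hquadQ := h.quadQ_bound
  have hquadQQ := h.quadQQ_bound
  have hKη : K / √T = K * η := by rw [hη]; ring
  rw [hKη] at hquadQ hquadQQ
  rw [← hη]
  -- the means of the quadratic forms
  obtain ⟨α, hα⟩ : ∃ α, α = ∫ z, quadQ γ z ∂(μ.prod (Measure.pi fun _ : Fin m => μ)) := ⟨_, rfl⟩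
  obtain ⟨b, hb⟩ : ∃ b, b = ∫ z, quadQQ γ z ∂(μ.prod (Measure.pi fun _ : Fin m => μ)) := ⟨_, rfl⟩
  rw [← hα] at hquadQ
  rw [← hb] at hquadQQ
  have hα0 : 0 ≤ α := by rw [hα]; exact integral_nonneg fun z => quadQ_nonneg hγ z
  have hb0 : 0 ≤ b := by rw [hb]; exact integral_nonneg fun z => quadQQ_nonneg z
  have hαM : α ≤ M / γ := by
    have h1 : ∀ z : (Fin T → ℝ) × (Fin m → Fin T → ℝ), quadQ γ z ≤ 1 / (T : ℝ) / γ * l2 z.1 ^ 2 :=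
      fun z => by
        have := mul_le_mul_of_nonneg_left (dotProduct_regInv_le hγ
          (posSemidef_gram (Matrix.of z.2)) z.1) (by positivity : 0 ≤ 1 / (T : ℝ))
        refine this.trans (le_of_eq ?_)
        ring
    have h2 : α ≤ ∫ z : (Fin T → ℝ) × (Fin m → Fin T → ℝ), 1 / (T : ℝ) / γ * l2 z.1 ^ 2
        ∂(μ.prod (Measure.pi fun _ : Fin m => μ)) := by
      rw [hα]
      exact integral_mono (pQ.integrable hμ) ((hi.comp_fst _).const_mul _) h1
    have h3 := integral_fun_fst (μ := μ) (ν := Measure.pi fun _ : Fin m => μ) (fun s => l2 s ^ 2)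
    rw [integral_const_mul, h3, probReal_univ, one_smul] at h2
    refine h2.trans ?_
    have h4 := mul_le_mul_of_nonneg_left h.second_moment
      (by positivity : 0 ≤ 1 / (T : ℝ) / γ)
    refine h4.trans (le_of_eq ?_)
    field_simp
  have hbK : b ≤ K := by
    have h1 : b ≤ α / γ := by
      rw [hb, hα, ← integral_div]
      exact integral_mono (pQQ.integrable hμ) ((pQ.integrable hμ).div_const _)
        fun z => quadQQ_le hγ z
    exact (h1.trans (by gcongr)).trans h.M_div_div_le
  -- the fixed point
  have hδ0 := hδ.1
  have hδM : δ ≤ M / γ := by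
    have := deltaMap_momentMatrix_le hγ h hδ0
    rwa [show deltaMap (m + 1) γ (momentMatrix μ) δ = δ from hδ.2.symm] at this
  have hδK : 1 + δ ≤ 2 * K := by linarith [h.M_div_le]
  have hδ1 : 0 < 1 + δ := by linarith
  -- With `s` frozen, the mean of `sᵀQ₋s` is close to `sᵀQ̄(α)s`. Averaging over the independent `s`
  -- gives `α` on one side and `deltaMap` at `α` on the other.
  have hαfix : |α - deltaMap (m + 1) γ (momentMatrix μ) α| ≤ 3 * K ^ 5 * η := by
    have h1 : ∀ s : Fin T → ℝ, |∫ z, s ⬝ᵥ resolvent γ (Matrix.of z.2) *ᵥ s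
          ∂(μ.prod (Measure.pi fun _ : Fin m => μ)) -
        s ⬝ᵥ Qbar (m + 1) γ (momentMatrix μ) α *ᵥ s| ≤
        (K ^ 2 * (1 / (T : ℝ)) + K ^ 3 * (1 / (T : ℝ) + K * η)) * (l2 s * l2 s) := fun s => by
      have a1 := h.abs_integral_resolvent_sub_fullRes_le hγ s s
      have a2 := h.abs_integral_fullRes_sub_le hγ hα0 hαM (by positivity) hquadQ s s
      refine (_root_.abs_sub_le _ _ _).trans ((add_le_add a1 a2).trans (le_of_eq ?_))
      ring
    have h2 := abs_integral_prod_sub_trace_le h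
      ((PolyBdd.of_le_l2 (f := fun z : (Fin T → ℝ) × (Fin m → Fin T → ℝ) => linQ γ z.1 z)
        ?_ (1 / γ) 2 (by positivity) fun z =>
          (abs_linQ_le hγ z.1 z).trans (le_of_eq (by ring))).integrable hμ)
      (Qbar (m + 1) γ (momentMatrix μ) α) (by positivity) h1
    · rw [← integral_const_mul] at h2
      change |∫ z, quadQ γ z ∂(μ.prod (Measure.pi fun _ : Fin m => μ)) - deltaMap _ _ _ _| ≤ _ at h2
      rw [← hα] at h2
      refine h2.trans ?_
      have e1 : K ^ 2 * (1 / (T : ℝ)) + K ^ 3 * (1 / (T : ℝ) + K * η) ≤ 3 * K ^ 4 * η := by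
        have i1 : K ^ 2 * (1 / (T : ℝ)) ≤ K ^ 4 * η :=
          mul_le_mul (pow_le_pow_right₀ hK (by norm_num)) hTη (by positivity) (by positivity)
        have i2 : K ^ 3 * (1 / (T : ℝ)) ≤ K ^ 4 * η :=
          mul_le_mul (pow_le_pow_right₀ hK (by norm_num)) hTη (by positivity) (by positivity)
        linarith
      calc _ ≤ 3 * K ^ 4 * η * K := mul_le_mul e1 h.M_le hM0 (by positivity)
        _ = _ := by ring
    · have := continuous_resolvent (T := T) hγ
        (fun z : (Fin T → ℝ) × (Fin m → Fin T → ℝ) => Matrix.of z.2) continuous_snd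
      exact continuous_fst.dotProduct (this.matrix_mulVec continuous_fst)
  have hαδ : |α - δ| ≤ 6 * K ^ 6 * η := by
    refine (hδ.abs_sub_le hγ hΦ hα0).trans ?_
    calc _ ≤ 2 * K * (3 * K ^ 5 * η) := mul_le_mul hδK hαfix (abs_nonneg _) (by positivity)
      _ = _ := by ring
  -- Both the fluctuation of `quadQ` about `α` and the distance from `α` to `δ` are at most `6 K⁶
  -- η`; the fourth-power inequality `8(x⁴ + x⁴) = (2x)⁴` doubles this.
  obtain ⟨ρ, hρ⟩ : ∃ ρ, ρ = 12 * K ^ 6 * η := ⟨_, rfl⟩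
  have hρ0 : 0 ≤ ρ := by rw [hρ]; positivity
  have hKρ : K * η ≤ 6 * K ^ 6 * η := by
    have : K ^ 1 ≤ K ^ 6 := pow_le_pow_right₀ hK (by norm_num)
    have : K ≤ 6 * K ^ 6 := by rw [pow_one] at this; nlinarith
    gcongr
  have hquadδ : ∫ z, (quadQ γ z - δ) ^ 4 ∂(μ.prod (Measure.pi fun _ : Fin m => μ)) ≤ ρ ^ 4 := by
    have h1 : ∫ z, (quadQ γ z - δ) ^ 4 ∂(μ.prod (Measure.pi fun _ : Fin m => μ)) ≤
        ∫ z, 8 * ((quadQ γ z - α) ^ 4 + (α - δ) ^ 4)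
          ∂(μ.prod (Measure.pi fun _ : Fin m => μ)) := by
      refine integral_mono (((pQ.sub (PolyBdd.const δ)).pow 4).integrable hμ)
        (((((pQ.sub (PolyBdd.const α)).pow 4).add
          (PolyBdd.const ((α - δ) ^ 4))).const_mul 8).integrable hμ) fun z => ?_
      have := add_pow_four_le (quadQ γ z - α) (α - δ)
      rwa [sub_add_sub_cancel] at this
    rw [integral_const_mul, integral_add (((pQ.sub (PolyBdd.const α)).pow 4).integrable hμ)
      (integrable_const _), integral_const, probReal_univ, one_smul] at h1
    have h2 : (α - δ) ^ 4 ≤ (6 * K ^ 6 * η) ^ 4 := by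
      rw [← Even.pow_abs (by decide : Even 4)]
      exact pow_le_pow_left₀ (abs_nonneg _) hαδ 4
    have h3 : (K * η) ^ 4 ≤ (6 * K ^ 6 * η) ^ 4 := pow_le_pow_left₀ (by positivity) hKρ 4
    have h4 : ρ ^ 4 = 16 * (6 * K ^ 6 * η) ^ 4 := by rw [hρ]; ring
    rw [h4]
    linarith
  have hquadb : ∫ z, (quadQQ γ z - b) ^ 4 ∂(μ.prod (Measure.pi fun _ : Fin m => μ)) ≤ ρ ^ 4 := by
    refine hquadQQ.trans (pow_le_pow_left₀ (by positivity) ?_ 4)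
    rw [hρ]
    have : 0 ≤ K ^ 6 * η := by positivity
    linarith
  have hR2 := fun v : Fin T → ℝ => h.abs_integral_fullRes_sq_sub_equivalent_le hγ hδ0 hδM hb0 hbK
    hρ0 hquadδ hquadb v v
  have hconst : 15 * K ^ 4 * (1 / (T : ℝ) + ρ) ≤ 195 * K ^ 10 * η := by
    have h1 : 1 / (T : ℝ) ≤ K ^ 6 * η := hTη.trans (le_mul_of_one_le_left hη0 (one_le_pow₀ hK))
    calc _ ≤ 15 * K ^ 4 * (K ^ 6 * η + 12 * K ^ 6 * η) := by rw [hρ]; gcongr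
      _ = _ := by ring
  -- the equation for `b`
  set Φ := momentMatrix μ with hΦdef
  set Q := Qbar (m + 1) γ Φ δ with hQ
  set Ψ := Psi (m + 1) Φ δ with hΨ
  obtain ⟨t1, ht1⟩ : ∃ t1, t1 = 1 / (T : ℝ) * (Φ * Q ^ 2).trace := ⟨_, rfl⟩
  obtain ⟨t2, ht2⟩ : ∃ t2, t2 = 1 / ((m + 1 : ℕ) : ℝ) * ((Ψ * Q) ^ 2).trace := ⟨_, rfl⟩
  have ht2' : t2 = 1 / (T : ℝ) / (1 + δ) * (Φ * (Q * (Ψ * Q))).trace := by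
    rw [ht2, sq, Matrix.mul_assoc, trace_Psi_mul _ m.succ_pos]
  have ht1' : 1 / ((m + 1 : ℕ) : ℝ) * (Ψ * Q ^ 2).trace = t1 / (1 + δ) := by
    rw [trace_Psi_mul _ m.succ_pos, ht1]; ring
  have ht2le : t2 ≤ δ / (1 + δ) := by rw [ht2]; exact hδ.trace_sq_le hγ hΦ m.succ_pos
  -- The equivalent of `Q²`, moved to `Q₋²` at cost `3K³/T`, is tested against the independent row
  -- `s`. Its own coefficient involves `b`, which makes the relation an equation; `198 = 195 + 3`.
  have hbeq : |b - (t1 + b * t2)| ≤ 198 * K ^ 11 * η := by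
    have h1 : ∀ s : Fin T → ℝ, |∫ z, s ⬝ᵥ resolvent γ (Matrix.of z.2) *ᵥ
          (resolvent γ (Matrix.of z.2) *ᵥ s) ∂(μ.prod (Measure.pi fun _ : Fin m => μ)) -
        s ⬝ᵥ (Q ^ 2 + (b / (1 + δ)) • (Q * (Ψ * Q))) *ᵥ s| ≤
        (198 * K ^ 10 * η) * (l2 s * l2 s) := fun s => by
      have a1 := h.abs_integral_fullRes_sq_sub_le hγ s s
      rw [abs_sub_comm] at a1
      have a2 := hR2 s
      have e : s ⬝ᵥ (Q ^ 2 + (b / (1 + δ)) • (Q * (Ψ * Q))) *ᵥ s =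
          s ⬝ᵥ Q *ᵥ (Q *ᵥ s) + b / (1 + δ) * (s ⬝ᵥ Q *ᵥ (Ψ *ᵥ (Q *ᵥ s))) := by
        rw [Matrix.add_mulVec, Matrix.smul_mulVec, dotProduct_add, dotProduct_smul, smul_eq_mul, sq,
          ← Matrix.mulVec_mulVec, ← Matrix.mulVec_mulVec, ← Matrix.mulVec_mulVec]
      rw [e]
      refine (_root_.abs_sub_le _ _ _).trans ((add_le_add a1 a2).trans ?_)
      rw [← add_mul]
      have hs : 0 ≤ l2 s * l2 s := mul_nonneg (l2_nonneg s) (l2_nonneg s)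
      refine mul_le_mul_of_nonneg_right ?_ hs
      have : 3 * K ^ 3 * (1 / (T : ℝ)) ≤ 3 * K ^ 10 * η := by
        have := pow_le_pow_right₀ hK (by norm_num : 3 ≤ 10)
        gcongr
      linarith
    have h2 := abs_integral_prod_sub_trace_le h
      ((PolyBdd.of_le_l2 (f := fun z : (Fin T → ℝ) × (Fin m → Fin T → ℝ) => linQQ γ z.1 z)
        ?_ (1 / γ / γ) 2 (by positivity) fun z =>
          (abs_linQQ_le hγ z.1 z).trans (le_of_eq (by ring))).integrable hμ)
      (Q ^ 2 + (b / (1 + δ)) • (Q * (Ψ * Q))) (by positivity) h1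
    · rw [← integral_const_mul] at h2
      change |∫ z, quadQQ γ z ∂(μ.prod (Measure.pi fun _ : Fin m => μ)) - _| ≤ _ at h2
      rw [← hb] at h2
      have e2 : 1 / (T : ℝ) * (Φ * (Q ^ 2 + (b / (1 + δ)) • (Q * (Ψ * Q)))).trace =
          t1 + b * t2 := by
        rw [Matrix.mul_add, Matrix.mul_smul, Matrix.trace_add, Matrix.trace_smul, smul_eq_mul,
          ht1, ht2']
        ring
      rw [e2] at h2
      refine h2.trans ?_
      calc _ ≤ 198 * K ^ 10 * η * K := mul_le_mul_of_nonneg_left h.M_le (by positivity)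
        _ = _ := by ring
    · have := continuous_resolvent (T := T) hγ
        (fun z : (Fin T → ℝ) × (Fin m → Fin T → ℝ) => Matrix.of z.2) continuous_snd
      exact continuous_fst.dotProduct (this.matrix_mulVec (this.matrix_mulVec continuous_fst))
  have hratio : |b / (1 + δ) - t1 / (1 + δ) / (1 - t2)| ≤ 198 * K ^ 11 * η := by
    have h1 : 1 / (1 + δ) ≤ 1 - t2 := by
      have : 1 / (1 + δ) = 1 - δ / (1 + δ) := by field_simp; ring
      linarith
    have h2 : 0 < 1 - t2 := lt_of_lt_of_le (by positivity) h1
    have h3 : 1 ≤ (1 + δ) * (1 - t2) := by rwa [div_le_iff₀' hδ1] at h1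
    -- Solving the scalar equation divides the defect by `(1+δ)(1-t2) ≥ 1`, so nothing is lost.
    have e : b / (1 + δ) - t1 / (1 + δ) / (1 - t2) =
        (b - (t1 + b * t2)) / ((1 + δ) * (1 - t2)) := by
      field_simp; ring
    rw [e, abs_div, abs_of_pos (by positivity : 0 < (1 + δ) * (1 - t2))]
    exact (div_le_self (abs_nonneg _) h3).trans hbeq
  -- conclusion
  have hint : ∫ S, u ⬝ᵥ resolvent γ (Matrix.of S) *ᵥ (resolvent γ (Matrix.of S) *ᵥ u)
        ∂(Measure.pi fun _ : Fin (m + 1) => μ) =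
      ∫ z, u ⬝ᵥ fullRes γ z *ᵥ (fullRes γ z *ᵥ u)
        ∂(μ.prod (Measure.pi fun _ : Fin m => μ)) := by
    rw [← integral_pi_succ (fun z => u ⬝ᵥ fullRes γ z *ᵥ (fullRes γ z *ᵥ u)) 0]
    simp only [fullRes_eq_resolvent]
  rw [ht1', ← ht2, hint]
  have hQΨQ := dotProduct_Qbar_Psi_Qbar hγ hΦ (m + 1) hδ0 u
  have hQu : u ⬝ᵥ Q *ᵥ u ≤ K * l2 u ^ 2 := by
    refine (dotProduct_regInv_le hγ (posSemidef_Psi hΦ (m + 1) hδ0) u).trans ?_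
    rw [div_eq_mul_one_div, mul_comm]
    exact mul_le_mul_of_nonneg_right h.one_div_le (sq_nonneg _)
  set q := u ⬝ᵥ Q *ᵥ (Ψ *ᵥ (Q *ᵥ u))
  set q0 := u ⬝ᵥ Q *ᵥ (Q *ᵥ u)
  have hq : |q| ≤ K * l2 u ^ 2 := by
    rw [abs_of_nonneg hQΨQ.1]; exact hQΨQ.2.trans hQu
  have hfin : |(q0 + b / (1 + δ) * q) - (q0 + t1 / (1 + δ) / (1 - t2) * q)| ≤
      198 * K ^ 11 * η * (K * l2 u ^ 2) := by
    rw [add_sub_add_left_eq_sub, ← sub_mul, abs_mul]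
    exact mul_le_mul hratio hq (abs_nonneg _) (by positivity)
  refine (_root_.abs_sub_le _ (q0 + b / (1 + δ) * q) _).trans ((add_le_add (hR2 u) hfin).trans ?_)
  have h1 : 15 * K ^ 4 * (1 / (T : ℝ) + ρ) * (l2 u * l2 u) ≤ 195 * K ^ 12 * η * l2 u ^ 2 := by
    rw [← sq]
    refine mul_le_mul_of_nonneg_right (hconst.trans ?_) (sq_nonneg _)
    have := pow_le_pow_right₀ hK (by norm_num : 10 ≤ 12)
    gcongr
  have h2 : 198 * K ^ 11 * η * (K * l2 u ^ 2) = 198 * K ^ 12 * η * l2 u ^ 2 := by ring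
  rw [h2]
  refine (add_le_add_left h1 _).trans (le_of_eq ?_)
  ring

end BiasAssembly

/-! ### The training error and its equivalent as sums of quadratic forms. -/

section TrainError

variable {n T d : ℕ} {γ : ℝ}

theorem frobNorm_transpose_sq (A : Matrix (Fin n) (Fin d) ℝ) :
    frobNorm A ^ 2 = ∑ k, l2 (Aᵀ k) ^ 2 := by
  have h : frobNorm A ^ 2 = ∑ i, ∑ j, ‖A i j‖ ^ (2 : ℝ) := by
    rw [frobNorm, Matrix.frobenius_norm_def, ← Real.sqrt_eq_rpow, Real.sq_sqrt (by positivity)]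
  rw [h, Finset.sum_comm]
  refine Finset.sum_congr rfl fun k _ => ?_
  rw [l2_sq, dotProduct]
  refine Finset.sum_congr rfl fun i _ => ?_
  rw [Real.rpow_two, Real.norm_eq_abs, sq_abs, sq]
  rfl

/-- The residual of the ridge regression. -/
theorem transpose_sub_mul_ridge (hγ : 0 < γ) (S : Matrix (Fin n) (Fin T) ℝ)
    (Y : Matrix (Fin d) (Fin T) ℝ) : Yᵀ - Sᵀ * ridge γ S Y = γ • (resolvent γ S * Yᵀ) := by
  have h : Sᵀ * ridge γ S Y = gram S * (resolvent γ S * Yᵀ) := by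
    rw [ridge, gram, Matrix.mul_smul, Matrix.smul_mul, Matrix.mul_assoc, Matrix.mul_assoc]
  have h2 : gram S * resolvent γ S + γ • resolvent γ S = 1 := by
    have := mul_regInv hγ (posSemidef_gram S)
    rwa [Matrix.add_mul, Matrix.smul_mul, Matrix.one_mul] at this
  have h3 : Yᵀ = gram S * (resolvent γ S * Yᵀ) + γ • (resolvent γ S * Yᵀ) := by
    rw [← Matrix.mul_assoc, ← Matrix.smul_mul, ← Matrix.add_mul, h2, Matrix.one_mul]
  rw [h]
  nth_rw 1 [h3]
  exact add_sub_cancel_left _ _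

theorem trainError_eq_sum (hγ : 0 < γ) (S : Matrix (Fin n) (Fin T) ℝ)
    (Y : Matrix (Fin d) (Fin T) ℝ) : trainError γ S Y =
      γ ^ 2 / (T : ℝ) * ∑ k, Y k ⬝ᵥ resolvent γ S *ᵥ (resolvent γ S *ᵥ Y k) := by
  rw [trainError, transpose_sub_mul_ridge hγ, frobNorm_transpose_sq]
  have h : ∀ k, l2 ((γ • (resolvent γ S * Yᵀ))ᵀ k) ^ 2 =
      γ ^ 2 * (Y k ⬝ᵥ resolvent γ S *ᵥ (resolvent γ S *ᵥ Y k)) := fun k => by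
    have e : (γ • (resolvent γ S * Yᵀ))ᵀ k = γ • (resolvent γ S *ᵥ Y k) := rfl
    rw [e, l2_smul, mul_pow, sq_abs, dotProduct_resolvent, l2_sq]
  simp only [h]
  rw [← Finset.mul_sum]
  ring

theorem trainError_eq_trace (hγ : 0 < γ) (S : Matrix (Fin n) (Fin T) ℝ)
    (Y : Matrix (Fin d) (Fin T) ℝ) :
    trainError γ S Y = γ ^ 2 / (T : ℝ) * (Yᵀ * Y * resolvent γ S ^ 2).trace := by
  rw [trainError_eq_sum hγ, trace_transpose_mul_self_mul]
  simp only [sq, ← Matrix.mulVec_mulVec]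

theorem trainErrorBar_eq_sum (n : ℕ) (γ : ℝ) (Φ : Matrix (Fin T) (Fin T) ℝ) (δ : ℝ)
    (Y : Matrix (Fin d) (Fin T) ℝ) : trainErrorBar n γ Φ δ Y =
      γ ^ 2 / (T : ℝ) * ∑ k, (Y k ⬝ᵥ Qbar n γ Φ δ *ᵥ (Qbar n γ Φ δ *ᵥ Y k) +
        (1 / (n : ℝ) * (Psi n Φ δ * Qbar n γ Φ δ ^ 2).trace) /
          (1 - 1 / (n : ℝ) * ((Psi n Φ δ * Qbar n γ Φ δ) ^ 2).trace) *
        (Y k ⬝ᵥ Qbar n γ Φ δ *ᵥ (Psi n Φ δ *ᵥ (Qbar n γ Φ δ *ᵥ Y k)))) := by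
  change γ ^ 2 / (T : ℝ) * (Yᵀ * Y * Qbar n γ Φ δ *
    (((1 / (n : ℝ) * (Psi n Φ δ * Qbar n γ Φ δ ^ 2).trace) /
      (1 - 1 / (n : ℝ) * ((Psi n Φ δ * Qbar n γ Φ δ) ^ 2).trace)) • Psi n Φ δ + 1) *
    Qbar n γ Φ δ).trace = _
  rw [Matrix.mul_assoc (Yᵀ * Y), Matrix.mul_assoc (Yᵀ * Y), trace_transpose_mul_self_mul]
  congr 1
  refine Finset.sum_congr rfl fun k _ => ?_
  rw [← Matrix.mulVec_mulVec, ← Matrix.mulVec_mulVec, Matrix.add_mulVec, Matrix.smul_mulVec,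
    Matrix.one_mulVec, Matrix.mulVec_add, Matrix.mulVec_smul, dotProduct_add, dotProduct_smul,
    smul_eq_mul, add_comm]

end TrainError

/-! ### The law of a row of random features satisfies the assumptions. -/

section FeatureLaw

variable {σ φ : ℝ → ℝ} {lamσ lamφ : ℝ≥0} {p T m : ℕ}

/-- The row of features produced by a Gaussian row `b`. -/
def featMap (σ φ : ℝ → ℝ) (X : Matrix (Fin p) (Fin T) ℝ) (b : Fin p → ℝ) : Fin T → ℝ :=
  fun t => σ (((fun k => φ (b k)) ᵥ* X) t)

/-- The law of a row of features. -/
noncomputable def featLaw (σ φ : ℝ → ℝ) (X : Matrix (Fin p) (Fin T) ℝ) : Measure (Fin T → ℝ) :=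
  (Measure.pi fun _ : Fin p => gaussianReal 0 1).map (featMap σ φ X)

theorem continuous_featMap (hσ : LipschitzWith lamσ σ) (hφ : LipschitzWith lamφ φ)
    (X : Matrix (Fin p) (Fin T) ℝ) : Continuous (featMap σ φ X) := by
  have h1 : Continuous fun b : Fin p → ℝ => fun k => φ (b k) :=
    continuous_pi fun k => hφ.continuous.comp (continuous_apply k)
  exact continuous_pi fun t => hσ.continuous.comp
    ((continuous_apply t).comp (h1.matrix_vecMul continuous_const))

theorem isProbabilityMeasure_featLaw (hσ : LipschitzWith lamσ σ) (hφ : LipschitzWith lamφ φ)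
    (X : Matrix (Fin p) (Fin T) ℝ) : IsProbabilityMeasure (featLaw σ φ X) :=
  Measure.isProbabilityMeasure_map (continuous_featMap hσ hφ X).aemeasurable

theorem Phi_eq_momentMatrix (hσ : LipschitzWith lamσ σ) (hφ : LipschitzWith lamφ φ)
    (X : Matrix (Fin p) (Fin T) ℝ) : Phi σ φ X = momentMatrix (featLaw σ φ X) := by
  ext i j
  have hc := continuous_featMap hσ hφ X
  have h1 : Continuous fun b : Fin p → ℝ => fun k => φ (b k) :=
    continuous_pi fun k => hφ.continuous.comp (continuous_apply k)
  rw [Phi, momentMatrix, Matrix.of_apply, Matrix.of_apply, lawNφ, featLaw,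
    integral_map hc.aemeasurable (by fun_prop), integral_map h1.aemeasurable]
  · rfl
  · have h2 : ∀ t, Continuous fun w : Fin p → ℝ => σ ((w ᵥ* X) t) := fun t =>
      hσ.continuous.comp ((continuous_apply t).comp
        (continuous_id.matrix_vecMul continuous_const))
    exact ((h2 i).mul (h2 j)).aestronglyMeasurable

theorem l2_comp_sub_le {ι : Type*} [Fintype ι] {f : ℝ → ℝ} {L : ℝ≥0} (hf : LipschitzWith L f)
    (x y : ι → ℝ) : l2 ((fun i => f (x i)) - fun i => f (y i)) ≤ L * l2 (x - y) := by
  rw [← abs_of_nonneg L.coe_nonneg, ← l2_smul]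
  refine l2_mono fun i => ?_
  rw [Pi.sub_apply, Pi.smul_apply, Pi.sub_apply, smul_eq_mul, abs_mul,
    abs_of_nonneg L.coe_nonneg]
  simpa [Real.dist_eq] using hf.dist_le_mul (x i) (y i)

open scoped Matrix.Norms.L2Operator in
theorem l2_vecMul_le (w : Fin p → ℝ) (X : Matrix (Fin p) (Fin T) ℝ) :
    l2 (w ᵥ* X) ≤ opNorm X * l2 w := by
  have h := Matrix.l2_opNorm_mulVec Xᵀ (WithLp.toLp 2 w)
  rw [← Matrix.conjTranspose_eq_transpose_of_trivial, Matrix.l2_opNorm_conjTranspose,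
    Matrix.conjTranspose_eq_transpose_of_trivial] at h
  rw [← Matrix.mulVec_transpose]
  exact h

theorem opNorm_nonneg (X : Matrix (Fin p) (Fin T) ℝ) : 0 ≤ opNorm X := by
  unfold opNorm
  open scoped Matrix.Norms.L2Operator in exact norm_nonneg _

theorem l2_featMap_sub_le (hσ : LipschitzWith lamσ σ) (hφ : LipschitzWith lamφ φ)
    {X : Matrix (Fin p) (Fin T) ℝ} {B : ℝ} (hX : opNorm X ≤ B) (b b' : Fin p → ℝ) :
    l2 (featMap σ φ X b - featMap σ φ X b') ≤ lamσ * B * lamφ * l2 (b - b') := by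
  refine (l2_comp_sub_le hσ _ _).trans ?_
  rw [← Matrix.sub_vecMul]
  have h1 := l2_vecMul_le ((fun k => φ (b k)) - fun k => φ (b' k)) X
  have h2 := l2_comp_sub_le hφ b b'
  have h3 := l2_nonneg ((fun k => φ (b k)) - fun k => φ (b' k))
  have hB : 0 ≤ B := (opNorm_nonneg X).trans hX
  calc _ ≤ (lamσ : ℝ) * (B * (lamφ * l2 (b - b'))) := by
        refine mul_le_mul_of_nonneg_left (h1.trans ?_) lamσ.coe_nonneg
        exact mul_le_mul hX h2 h3 hB
    _ = _ := by ring

theorem l2_comp_sq_le {ι : Type*} [Fintype ι] {f : ℝ → ℝ} {L : ℝ≥0} (hf : LipschitzWith L f)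
    (x : ι → ℝ) : l2 (fun i => f (x i)) ^ 2 ≤
      2 * (f 0 ^ 2 * Fintype.card ι + (L : ℝ) ^ 2 * l2 x ^ 2) := by
  rw [l2_sq, l2_sq, dotProduct, dotProduct, mul_add, Finset.mul_sum, Finset.mul_sum, mul_comm (f 0 ^ 2),
    ← nsmul_eq_mul, ← Finset.card_univ, ← Finset.sum_const, Finset.mul_sum,
    ← Finset.sum_add_distrib]
  refine Finset.sum_le_sum fun i _ => ?_
  have h1 : |f (x i) - f 0| ≤ L * |x i| := by
    simpa [Real.dist_eq] using hf.dist_le_mul (x i) 0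
  have h2 : (f (x i) - f 0) ^ 2 ≤ (L * |x i|) ^ 2 := by
    rw [← sq_abs]; exact pow_le_pow_left₀ (abs_nonneg _) h1 2
  rw [mul_pow, sq_abs] at h2
  nlinarith [sq_nonneg (f (x i) - 2 * f 0)]

theorem integral_l2_sq_pi_gaussian (p : ℕ) :
    Integrable (fun b : Fin p → ℝ => l2 b ^ 2) (Measure.pi fun _ : Fin p => gaussianReal 0 1) ∧
    ∫ b, l2 b ^ 2 ∂(Measure.pi fun _ : Fin p => gaussianReal 0 1) = p := by
  have hi : Integrable (fun x : ℝ => x * x) (gaussianReal 0 1) := by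
    simpa only [sq, id] using (memLp_id_gaussianReal (μ := 0) (v := 1) 2).integrable_sq
  have hm : ∫ x, x * x ∂(gaussianReal 0 1) = 1 := by
    have h := variance_id_gaussianReal (μ := 0) (v := 1)
    rw [variance_eq_integral (by fun_prop)] at h
    simp only [id, integral_id_gaussianReal, sub_zero, sq] at h
    simpa using h
  have hk : ∀ k : Fin p, Integrable (fun b : Fin p → ℝ => b k * b k)
      (Measure.pi fun _ : Fin p => gaussianReal 0 1) := fun k =>
    (measurePreserving_eval (fun _ : Fin p => gaussianReal 0 1) k).integrable_comp_of_integrable hi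
  have hm2 : ∀ k : Fin p, ∫ b, b k * b k ∂(Measure.pi fun _ : Fin p => gaussianReal 0 1) = 1 :=
    fun k => by
      have h := integral_map (μ := Measure.pi fun _ : Fin p => gaussianReal 0 1)
        (φ := fun b => b k) (measurable_pi_apply k).aemeasurable (f := fun x : ℝ => x * x) (by fun_prop)
      rw [show (Measure.pi fun _ : Fin p => gaussianReal 0 1).map (fun b => b k) =
        gaussianReal 0 1 from (measurePreserving_eval (fun _ : Fin p => gaussianReal 0 1) k).map_eq,
        hm] at h
      exact h.symm
  simp only [l2_sq, dotProduct]
  refine ⟨integrable_finsetSum _ fun k _ => hk k, ?_⟩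
  rw [integral_finsetSum _ fun k _ => hk k]
  simp [hm2]

/-- Lipschitz functions grow at most linearly; the values at 0 contribute through the dimensions,
and `E‖b‖² = p`. Proportionality of `p` and `T` makes this `O(T)`. -/
theorem integral_l2_sq_featLaw_le (hσ : LipschitzWith lamσ σ) (hφ : LipschitzWith lamφ φ)
    {X : Matrix (Fin p) (Fin T) ℝ} {B : ℝ} (hX : opNorm X ≤ B) :
    ∫ s, l2 s ^ 2 ∂(featLaw σ φ X) ≤
      2 * σ 0 ^ 2 * T + 4 * lamσ ^ 2 * B ^ 2 * (φ 0 ^ 2 + lamφ ^ 2) * p := by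
  have hc := continuous_featMap hσ hφ X
  have hB : 0 ≤ B := (opNorm_nonneg X).trans hX
  obtain ⟨hi, hp⟩ := integral_l2_sq_pi_gaussian p
  have h1 : ∀ b : Fin p → ℝ, l2 (featMap σ φ X b) ^ 2 ≤
      2 * σ 0 ^ 2 * T + 4 * lamσ ^ 2 * B ^ 2 * φ 0 ^ 2 * p +
        4 * lamσ ^ 2 * B ^ 2 * lamφ ^ 2 * l2 b ^ 2 := fun b => by
    have a1 := l2_comp_sq_le hσ ((fun k => φ (b k)) ᵥ* X)
    have a2 := l2_comp_sq_le hφ b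
    have a3 : l2 ((fun k => φ (b k)) ᵥ* X) ^ 2 ≤ B ^ 2 * l2 (fun k => φ (b k)) ^ 2 := by
      rw [← mul_pow]
      refine pow_le_pow_left₀ (l2_nonneg _) ((l2_vecMul_le _ X).trans ?_) 2
      exact mul_le_mul_of_nonneg_right hX (l2_nonneg _)
    rw [Fintype.card_fin] at a1 a2
    refine a1.trans ?_
    have a4 := mul_le_mul_of_nonneg_left (a3.trans (mul_le_mul_of_nonneg_left a2 (sq_nonneg B)))
      (sq_nonneg (lamσ : ℝ))
    linarith
  have hint := (hi.const_mul (4 * lamσ ^ 2 * B ^ 2 * lamφ ^ 2)).add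
    (integrable_const (2 * σ 0 ^ 2 * T + 4 * lamσ ^ 2 * B ^ 2 * φ 0 ^ 2 * p))
  rw [featLaw, integral_map hc.aemeasurable
    (show Continuous fun s : Fin T → ℝ => l2 s ^ 2 from continuous_l2.pow 2).aestronglyMeasurable]
  have h2 := integral_mono_of_nonneg (Eventually.of_forall fun b => sq_nonneg _) hint
    (Eventually.of_forall fun b => (h1 b).trans (le_of_eq (add_comm _ _)))
  refine h2.trans (le_of_eq ?_)
  rw [integral_add' (hi.const_mul _) (integrable_const _), integral_const_mul, hp, integral_const,
    probReal_univ, one_smul]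
  ring

/-- A matrix of independent standard Gaussian entries has independent standard Gaussian rows. -/
theorem pi_map_curry (m p : ℕ) (μ : Measure ℝ) [IsProbabilityMeasure μ] :
    (Measure.pi fun _ : Fin m × Fin p => μ).map (fun B i k => B (i, k)) =
      Measure.pi fun _ : Fin m => Measure.pi fun _ : Fin p => μ := by
  have h := Measure.infinitePi_map_curry (ι := Fin m) (κ := Fin p) fun _ _ => μ
  simp only [Measure.infinitePi_eq_pi] at h
  exact h

/-- Presenting all rows as one image of a single Gaussian vector gives their joint concentration
from `conc_map_pi_gaussian` with a constant independent of `m`. -/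
theorem pi_featLaw (hσ : LipschitzWith lamσ σ) (hφ : LipschitzWith lamφ φ)
    (X : Matrix (Fin p) (Fin T) ℝ) (m : ℕ) :
    (Measure.pi fun _ : Fin m => featLaw σ φ X) =
      (Measure.pi fun _ : Fin m × Fin p => gaussianReal 0 1).map
        (fun B i => featMap σ φ X fun k => B (i, k)) := by
  have hc := (continuous_featMap hσ hφ X).measurable
  have := isProbabilityMeasure_featLaw hσ hφ X
  have h := Measure.infinitePi_map_pi (ι := Fin m)
    (μ := fun _ => Measure.pi fun _ : Fin p => gaussianReal 0 1) (f := fun _ => featMap σ φ X)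
    fun _ => hc
  have e := Measure.infinitePi_eq_pi (μ := fun _ : Fin m => featLaw σ φ X)
  rw [Measure.infinitePi_eq_pi] at h
  replace h := h.trans e
  rw [← h, ← pi_map_curry, Measure.map_map (by fun_prop) (by fun_prop)]
  rfl

/-- The map acts row by row, so its Lipschitz constant for the Frobenius norm is that of a single
row. -/
theorem fro_featMap_sub_le (hσ : LipschitzWith lamσ σ) (hφ : LipschitzWith lamφ φ)
    {X : Matrix (Fin p) (Fin T) ℝ} {B : ℝ} (hX : opNorm X ≤ B) (b b' : Fin m × Fin p → ℝ) :
    fro ((fun i => featMap σ φ X fun k => b (i, k)) - fun i => featMap σ φ X fun k => b' (i, k)) ≤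
      lamσ * B * lamφ * l2 (b - b') := by
  have hB : 0 ≤ B := (opNorm_nonneg X).trans hX
  have hc : 0 ≤ lamσ * B * lamφ := by positivity
  have h1 : l2 (b - b') = fro fun i k => (b - b') (i, k) := by
    refine (sq_eq_sq₀ (l2_nonneg _) (fro_nonneg _)).1 ?_
    rw [fro_sq, l2_sq, dotProduct, Fintype.sum_prod_type]
    rfl
  rw [h1, fro, fro, ← abs_of_nonneg hc, ← l2_smul]
  refine l2_mono fun i => ?_
  rw [abs_of_nonneg (l2_nonneg _), Pi.smul_apply, smul_eq_mul,
    abs_of_nonneg (mul_nonneg hc (l2_nonneg _))]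
  exact l2_featMap_sub_le hσ hφ hX (fun k => b (i, k)) fun k => b' (i, k)

theorem isFeatureLaw_featLaw (hσ : LipschitzWith lamσ σ) (hφ : LipschitzWith lamφ φ)
    {X : Matrix (Fin p) (Fin T) ℝ} {B κ : ℝ} (hX : opNorm X ≤ B) (hT : 0 < T)
    (hp : p ≤ κ * T) (h1 : ((m + 1 : ℕ) : ℝ) / T ≤ κ) (h2 : T / ((m + 1 : ℕ) : ℝ) ≤ κ) :
    IsFeatureLaw (2 * σ 0 ^ 2 + 4 * lamσ ^ 2 * B ^ 2 * (φ 0 ^ 2 + lamφ ^ 2) * κ) κ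
      (fun k => momentConst k * (lamσ * B * lamφ) ^ (2 * k)) T m (featLaw σ φ X) where
  T_pos := hT
  conc := by
    have hB : 0 ≤ B := (opNorm_nonneg X).trans hX
    exact conc_map_pi_gaussian _ (continuous_featMap hσ hφ X).measurable _ _ (by positivity)
      (l2_featMap_sub_le hσ hφ hX)
  conc_pi := by
    have hB : 0 ≤ B := (opNorm_nonneg X).trans hX
    have hc := (continuous_featMap hσ hφ X).measurable
    rw [pi_featLaw hσ hφ X m]
    exact conc_map_pi_gaussian _ (by fun_prop) _ _ (by positivity) (fro_featMap_sub_le hσ hφ hX)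
  second_moment := by
    refine (integral_l2_sq_featLaw_le hσ hφ hX).trans ?_
    have := mul_le_mul_of_nonneg_left hp
      (by positivity : 0 ≤ 4 * (lamσ : ℝ) ^ 2 * B ^ 2 * (φ 0 ^ 2 + lamφ ^ 2))
    linarith
  ratio_le := h1
  inv_ratio_le := h2

theorem map_features {Ω : Type*} [MeasurableSpace Ω] {P : Measure Ω} [IsProbabilityMeasure P]
    (hσ : LipschitzWith lamσ σ) (hφ : LipschitzWith lamφ φ) (X : Matrix (Fin p) (Fin T) ℝ)
    {W : Ω → Matrix (Fin m) (Fin p) ℝ}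
    (hlaw : ∀ i j, HasLaw (fun ω => W ω i j) (gaussianReal 0 1) P)
    (hindep : iIndepFun (fun (ij : Fin m × Fin p) ω => W ω ij.1 ij.2) P) :
    AEMeasurable (fun ω i => featMap σ φ X (W ω i)) P ∧
    P.map (fun ω i => featMap σ φ X (W ω i)) = Measure.pi fun _ : Fin m => featLaw σ φ X := by
  have hc := (continuous_featMap hσ hφ X).measurable
  have hm : ∀ ij : Fin m × Fin p, AEMeasurable (fun ω => W ω ij.1 ij.2) P :=
    fun ij => (hlaw ij.1 ij.2).aemeasurable
  have h := (iIndepFun_iff_map_fun_eq_pi_map hm).1 hindep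
  simp only [(hlaw _ _).map_eq] at h
  have hg : Measurable fun (B : Fin m × Fin p → ℝ) i => featMap σ φ X fun k => B (i, k) := by
    fun_prop
  have hm' : AEMeasurable (fun ω (ij : Fin m × Fin p) => W ω ij.1 ij.2) P :=
    aemeasurable_pi_lambda _ hm
  refine ⟨hg.comp_aemeasurable hm', ?_⟩
  rw [pi_featLaw hσ hφ X m, ← h, AEMeasurable.map_map_of_aemeasurable hg.aemeasurable hm']
  rfl

end FeatureLaw

/-! ### From moments to almost sure rates. -/

section AlmostSure

variable {Ω : Type*} [MeasurableSpace Ω] {P : Measure Ω}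

/-- Random variables whose even moments decay like those of `n^{-1/2}` times a bounded one are
almost surely `o(n^{-1/2+ε})`. -/
theorem ae_tendsto_zero_of_moment_le {Z : ℕ → Ω → ℝ} (hZ : ∀ n, AEMeasurable (Z n) P)
    {D : ℕ → ℝ} (hD : ∀ᶠ n : ℕ in atTop, ∀ k : ℕ,
      ∫⁻ ω, ENNReal.ofReal (Z n ω ^ (2 * k)) ∂P ≤ ENNReal.ofReal (D k / (n : ℝ) ^ k))
    {ε : ℝ} (hε : 0 < ε) :
    ∀ᵐ ω ∂P, Tendsto (fun n : ℕ => (n : ℝ) ^ ((1 : ℝ) / 2 - ε) * Z n ω) atTop (𝓝 0) := by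
  -- Shifting by `n0` discards the indices without a bound, as well as `n = 0`, where real powers
  -- degenerate.
  obtain ⟨n0, hn0⟩ := eventually_atTop.1 (hD.and (eventually_gt_atTop 0))
  -- The normalized moment of order `2k` is `O(n^{-2kε})`, summable once `2kε > 1`. The series of
  -- the random variables themselves is then almost surely finite, so its terms tend to 0; no joint
  -- law over `n` is involved.
  obtain ⟨k, hk⟩ := exists_nat_gt (1 / (2 * ε))
  have hkε : 1 < 2 * k * ε := by
    rw [div_lt_iff₀ (by positivity)] at hk; linarith
  have hk0 : 2 * k ≠ 0 := by
    rintro h0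
    have : (k : ℝ) = 0 := by
      have : k = 0 := by omega
      exact_mod_cast this
    rw [this] at hkε; linarith
  set f : ℕ → Ω → ℝ≥0∞ := fun n ω =>
    ENNReal.ofReal ((((n + n0 : ℕ) : ℝ) ^ ((1 : ℝ) / 2 - ε) * Z (n + n0) ω) ^ (2 * k)) with hf
  have hfm : ∀ n, AEMeasurable (f n) P := fun n =>
    (((hZ _).const_mul _).pow_const _).ennreal_ofReal
  have hfi : ∀ n, ∫⁻ ω, f n ω ∂P ≤
      ENNReal.ofReal (|D k| * ((n + n0 : ℕ) : ℝ) ^ (-(2 * k * ε))) := fun n => by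
    obtain ⟨h1, h2⟩ := hn0 (n + n0) (by omega)
    have hN : (0 : ℝ) < ((n + n0 : ℕ) : ℝ) := by exact_mod_cast h2
    simp only [hf, mul_pow]
    have hc : 0 ≤ (((n + n0 : ℕ) : ℝ) ^ ((1 : ℝ) / 2 - ε)) ^ (2 * k) := by positivity
    simp only [ENNReal.ofReal_mul hc]
    rw [lintegral_const_mul' _ _ ENNReal.ofReal_ne_top]
    refine (mul_le_mul_right (h1 k) _).trans ?_
    rw [← ENNReal.ofReal_mul hc]
    refine ENNReal.ofReal_le_ofReal ?_
    have e1 : (((n + n0 : ℕ) : ℝ) ^ ((1 : ℝ) / 2 - ε)) ^ (2 * k) =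
        ((n + n0 : ℕ) : ℝ) ^ (-(2 * k * ε)) * ((n + n0 : ℕ) : ℝ) ^ k := by
      rw [← Real.rpow_natCast, ← Real.rpow_mul hN.le, ← Real.rpow_natCast _ k, ← Real.rpow_add hN]
      congr 1
      push_cast
      ring
    rw [e1, mul_assoc, mul_div_cancel₀ _ (by positivity), mul_comm]
    gcongr
    exact le_abs_self _
  have hsum : ∑' n, ∫⁻ ω, f n ω ∂P ≠ ∞ := by
    have hs : Summable fun n : ℕ => |D k| * ((n + n0 : ℕ) : ℝ) ^ (-(2 * k * ε)) :=
      ((summable_nat_add_iff n0).2 (Real.summable_nat_rpow.2 (by linarith))).mul_left _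
    exact ne_top_of_le_ne_top hs.tsum_ofReal_ne_top (ENNReal.tsum_le_tsum hfi)
  rw [← lintegral_tsum hfm] at hsum
  filter_upwards [ae_lt_top' (AEMeasurable.tsum hfm) hsum] with ω hω
  have h1 := ENNReal.tendsto_atTop_zero_of_tsum_ne_top hω.ne
  have h2 := (ENNReal.tendsto_toReal ENNReal.zero_ne_top).comp h1
  rw [← tendsto_add_atTop_iff_nat n0]
  have h3 : Tendsto (fun n : ℕ => |((n + n0 : ℕ) : ℝ) ^ ((1 : ℝ) / 2 - ε) * Z (n + n0) ω| ^ (2 * k))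
      atTop (𝓝 0) := by
    refine h2.congr fun n => ?_
    simp only [hf, Function.comp_apply]
    rw [ENNReal.toReal_ofReal (Even.pow_nonneg (even_two_mul k) _), (even_two_mul k).pow_abs]
  have h4 := h3.rpow_const (p := ((2 * k : ℕ) : ℝ)⁻¹) (Or.inr (by positivity))
  rw [Real.zero_rpow (by positivity)] at h4
  simp only [Real.pow_rpow_inv_natCast (abs_nonneg _) hk0] at h4
  exact (tendsto_zero_iff_abs_tendsto_zero _).2 h4

end AlmostSure

/-! ### Uniform bounds extracted from the growth conditions. -/

section Growth

theorem GrowthRate.exists_bounds {d : ℕ} {p T : ℕ → ℕ}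
    {X : ∀ n, Matrix (Fin (p n)) (Fin (T n)) ℝ} {Y : ∀ n, Matrix (Fin d) (Fin (T n)) ℝ}
    (h : GrowthRate p T X Y) : ∃ κ B A : ℝ, 0 ≤ κ ∧ 0 ≤ B ∧ 0 ≤ A ∧ ∀ᶠ n : ℕ in atTop,
      0 < n ∧ 0 < T n ∧ (p n : ℝ) ≤ κ * T n ∧ (n : ℝ) / T n ≤ κ ∧ (T n : ℝ) / n ≤ κ ∧
      opNorm (X n) ≤ B ∧ ∀ i j, |Y n i j| ≤ A := by
  obtain ⟨c, hc0, hc⟩ := ENNReal.lt_iff_exists_nnreal_btwn.1 h.liminf_pos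
  obtain ⟨C, hC, -⟩ := ENNReal.lt_iff_exists_nnreal_btwn.1 h.limsup_lt_top
  obtain ⟨B, hB, -⟩ := ENNReal.lt_iff_exists_nnreal_btwn.1 h.limsup_X
  obtain ⟨A, hA, -⟩ := ENNReal.lt_iff_exists_nnreal_btwn.1 h.limsup_Y
  have hc0' : (0 : ℝ) < c := by exact_mod_cast hc0
  -- With `c < T/n` and `p/n, T/n ≤ C`, the three summands bound `n/T`, `T/n` and `p/T`.
  refine ⟨1 / c + C + C / c, B, A, by positivity, by positivity, by positivity, ?_⟩
  filter_upwards [eventually_lt_of_lt_liminf hc, eventually_lt_of_limsup_lt hC,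
    eventually_lt_of_limsup_lt hB, eventually_lt_of_limsup_lt hA, eventually_gt_atTop 0]
    with n h1 h2 h3 h4 hn
  have hn' : (0 : ℝ) < n := by exact_mod_cast hn
  have hdiv : ∀ a : ℕ, (a : ℝ≥0∞) / (n : ℝ≥0∞) = ENNReal.ofReal ((a : ℝ) / n) := fun a => by
    rw [ENNReal.ofReal_div_of_pos hn', ENNReal.ofReal_natCast, ENNReal.ofReal_natCast]
  rw [hdiv, hdiv] at h1 h2
  rw [← ENNReal.ofReal_coe_nnreal] at h1 h2 h3 h4
  have hT1 : (c : ℝ) < T n / n :=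
    (ENNReal.ofReal_lt_ofReal_iff_of_nonneg c.coe_nonneg).1 (lt_min_iff.1 h1).2
  have hp2 : (p n : ℝ) / n ≤ C :=
    (ENNReal.ofReal_le_ofReal_iff C.coe_nonneg).1 (max_lt_iff.1 h2).1.le
  have hT2 : (T n : ℝ) / n ≤ C :=
    (ENNReal.ofReal_le_ofReal_iff C.coe_nonneg).1 (max_lt_iff.1 h2).2.le
  rw [lt_div_iff₀ hn'] at hT1
  have hT0 : (0 : ℝ) < T n := lt_trans (by positivity) hT1
  have q1 : (0 : ℝ) ≤ 1 / c := by positivity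
  have q2 : (0 : ℝ) ≤ C := C.coe_nonneg
  have q3 : (0 : ℝ) ≤ C / c := by positivity
  refine ⟨hn, by exact_mod_cast hT0, ?_, ?_, by linarith,
    (ENNReal.ofReal_le_ofReal_iff B.coe_nonneg).1 h3.le, fun i j => ?_⟩
  · rw [div_le_iff₀ hn'] at hp2
    have h5 : (C : ℝ) / c * (c * n) ≤ C / c * T n := mul_le_mul_of_nonneg_left hT1.le q3
    have h6 : (C : ℝ) / c * (c * n) = C * n := by field_simp
    have h7 : 0 ≤ (1 / c + C : ℝ) * T n := by positivity
    linarith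
  · have : (n : ℝ) / T n ≤ 1 / c := by
      rw [div_le_div_iff₀ hT0 hc0']; linarith
    linarith
  · refine (ENNReal.ofReal_le_ofReal_iff A.coe_nonneg).1 (le_trans ?_ h4.le)
    exact le_iSup₂ (f := fun i j => ENNReal.ofReal |Y n i j|) i j

end Growth

/-! ### Fluctuation and bias of the training error. -/

section Concentration

variable {n d T : ℕ} {γ A : ℝ} {Y : Matrix (Fin d) (Fin T) ℝ}

theorem l2_sq_le_of_abs_le (hY : ∀ i j, |Y i j| ≤ A) (k : Fin d) :
    l2 (Y k) ^ 2 ≤ A ^ 2 * T := by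
  rw [l2_sq, dotProduct]
  refine (Finset.sum_le_card_nsmul _ _ (A ^ 2) fun j _ => ?_).trans (le_of_eq ?_)
  · rw [← sq, ← sq_abs]; exact pow_le_pow_left₀ (abs_nonneg _) (hY k j) 2
  · rw [Finset.card_univ, Fintype.card_fin, nsmul_eq_mul, mul_comm]

theorem continuous_trainError (hγ : 0 < γ) (Y : Matrix (Fin d) (Fin T) ℝ) :
    Continuous fun S : Fin n → Fin T → ℝ => trainError γ (Matrix.of S) Y := by
  simp only [trainError_eq_sum hγ]
  have h := continuous_resolvent (T := T) hγ
    (fun S : Fin n → Fin T → ℝ => (Matrix.of S : Matrix (Fin n) (Fin T) ℝ)) continuous_id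
  refine continuous_const.mul (continuous_finsetSum _ fun k _ => ?_)
  exact continuous_const.dotProduct (h.matrix_mulVec (h.matrix_mulVec continuous_const))

/-- The prefactor `γ²/T` cancels the size `A²T` of `‖Yₖ‖²`, so the order `T^{-1/2}` of `lipConst`
survives. The number `d` of rows of `Y` stays in the constant. -/
theorem abs_trainError_sub_le (hγ : 0 < γ) (hT : 0 < T) (hY : ∀ i j, |Y i j| ≤ A)
    (S S' : Fin n → Fin T → ℝ) :
    |trainError γ (Matrix.of S) Y - trainError γ (Matrix.of S') Y| ≤
      4 * d * A ^ 2 / √γ * (1 / √T) * fro (S - S') := by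
  have hT' : (0 : ℝ) < T := by exact_mod_cast hT
  have hf := fro_nonneg (S - S')
  have hl := lipConst_nonneg hγ T
  rw [trainError_eq_sum hγ, trainError_eq_sum hγ, ← mul_sub, ← Finset.sum_sub_distrib, abs_mul,
    abs_of_nonneg (by positivity)]
  have h1 : |∑ k, (Y k ⬝ᵥ resolvent γ (Matrix.of S) *ᵥ (resolvent γ (Matrix.of S) *ᵥ Y k) -
      Y k ⬝ᵥ resolvent γ (Matrix.of S') *ᵥ (resolvent γ (Matrix.of S') *ᵥ Y k))| ≤
      ∑ _k : Fin d, 2 / γ * lipConst γ T * (A ^ 2 * T) * fro (S - S') := by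
    refine (Finset.abs_sum_le_sum_abs _ _).trans (Finset.sum_le_sum fun k _ => ?_)
    refine (abs_resolvent_sq_sub_le hγ hT (Matrix.of S) (Matrix.of S') (Y k) (Y k)).trans ?_
    refine mul_le_mul_of_nonneg_right ?_ hf
    refine mul_le_mul_of_nonneg_left ?_ (by positivity)
    rw [← sq]; exact l2_sq_le_of_abs_le hY k
  rw [Finset.sum_const, Finset.card_univ, Fintype.card_fin, nsmul_eq_mul] at h1
  refine (mul_le_mul_of_nonneg_left h1 (by positivity)).trans (le_of_eq ?_)
  rw [lipConst, Real.sqrt_mul hγ.le]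
  have h2 : √γ ≠ 0 := by positivity
  have h3 : √(T : ℝ) ≠ 0 := by positivity
  field_simp
  ring

theorem abs_integral_trainError_sub_le {M K : ℝ} {m : ℕ} {μ : Measure (Fin T → ℝ)}
    [IsProbabilityMeasure μ] (h : HasMomentBounds γ M K T m μ) (hγ : 0 < γ)
    (hY : ∀ i j, |Y i j| ≤ A) {δ : ℝ} (hδ : IsDelta (m + 1) γ (momentMatrix μ) δ) :
    |∫ S, trainError γ (Matrix.of S) Y ∂(Measure.pi fun _ : Fin (m + 1) => μ) -
      trainErrorBar (m + 1) γ (momentMatrix μ) δ Y| ≤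
      393 * γ ^ 2 * K ^ 12 * d * A ^ 2 * (1 / √T) := by
  have hT : (0 : ℝ) < T := by exact_mod_cast h.T_pos
  have hK : 0 ≤ K := zero_le_one.trans h.one_le
  have hint : ∀ k, Integrable (fun S : Fin (m + 1) → Fin T → ℝ =>
      Y k ⬝ᵥ resolvent γ (Matrix.of S) *ᵥ (resolvent γ (Matrix.of S) *ᵥ Y k))
      (Measure.pi fun _ : Fin (m + 1) => μ) := fun k => by
    have hc := continuous_resolvent (T := T) hγ (fun S : Fin (m + 1) → Fin T → ℝ =>
      (Matrix.of S : Matrix (Fin (m + 1)) (Fin T) ℝ)) continuous_id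
    refine (integrable_const (l2 (Y k) * (l2 (Y k) / γ / γ))).mono'
      (continuous_const.dotProduct
        (hc.matrix_mulVec (hc.matrix_mulVec continuous_const))).aestronglyMeasurable
      (Eventually.of_forall fun S => ?_)
    refine (abs_dotProduct_le _ _).trans (mul_le_mul_of_nonneg_left ?_ (l2_nonneg _))
    exact (l2_resolvent_le hγ _ _).trans
      (div_le_div_of_nonneg_right (l2_resolvent_le hγ _ _) hγ.le)
  simp only [trainError_eq_sum hγ]
  rw [trainErrorBar_eq_sum, integral_const_mul, integral_finsetSum _ fun k _ => hint k, ← mul_sub,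
    ← Finset.sum_sub_distrib, abs_mul, abs_of_nonneg (by positivity)]
  have h1 := (Finset.abs_sum_le_sum_abs _ Finset.univ).trans
    (Finset.sum_le_sum fun k (_ : k ∈ Finset.univ) =>
      (h.abs_integral_resolvent_sq_sub_le hγ hδ (Y k)).trans
        (mul_le_mul_of_nonneg_left (l2_sq_le_of_abs_le hY k) (by positivity)))
  rw [Finset.sum_const, Finset.card_univ, Fintype.card_fin, nsmul_eq_mul] at h1
  refine (mul_le_mul_of_nonneg_left h1 (by positivity)).trans (le_of_eq ?_)
  field_simp

end Concentration

/-! ### Even moments of the total error. -/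

section Main

theorem exists_moment_trainError_sub_le {σ φ : ℝ → ℝ} {lamσ lamφ : ℝ≥0}
    (hσ : LipschitzWith lamσ σ) (hφ : LipschitzWith lamφ φ) {γ : ℝ} (hγ : 0 < γ) (d : ℕ)
    {κ B A : ℝ} (hκ : 0 ≤ κ) (hB : 0 ≤ B) :
    ∃ D : ℕ → ℝ, ∀ {n p T : ℕ} (X : Matrix (Fin p) (Fin T) ℝ) (Y : Matrix (Fin d) (Fin T) ℝ)
      (δ : ℝ), 0 < n → 0 < T → (p : ℝ) ≤ κ * T → (n : ℝ) / T ≤ κ → (T : ℝ) / n ≤ κ →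
      opNorm X ≤ B → (∀ i j, |Y i j| ≤ A) → IsDelta n γ (Phi σ φ X) δ → ∀ k : ℕ,
      ∫⁻ S, ENNReal.ofReal ((trainError γ (Matrix.of S) Y -
          trainErrorBar n γ (Phi σ φ X) δ Y) ^ (2 * k))
        ∂(Measure.pi fun _ : Fin n => featLaw σ φ X) ≤ ENNReal.ofReal (D k / (n : ℝ) ^ k) := by
  obtain ⟨M, hM⟩ : ∃ M, M = 2 * σ 0 ^ 2 + 4 * (lamσ : ℝ) ^ 2 * B ^ 2 *
    (φ 0 ^ 2 + (lamφ : ℝ) ^ 2) * κ := ⟨_, rfl⟩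
  have hM0 : 0 ≤ M := by rw [hM]; positivity
  obtain ⟨K, hK⟩ := exists_hasMomentBounds (M := M) (κ := κ)
    (C := fun k => momentConst k * (lamσ * B * lamφ) ^ (2 * k)) hγ hM0 hκ fun k =>
      mul_nonneg (momentConst_pos k).le (by positivity)
  obtain ⟨A1, hA1⟩ : ∃ A1, A1 = 4 * d * A ^ 2 / √γ := ⟨_, rfl⟩
  have hA10 : 0 ≤ A1 := by rw [hA1]; positivity
  obtain ⟨A2, hA2⟩ : ∃ A2, A2 = 393 * γ ^ 2 * K ^ 12 * d * A ^ 2 := ⟨_, rfl⟩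
  have hA20 : 0 ≤ A2 := by rw [hA2]; positivity
  -- `A1` carries the fluctuation and `A2` the bias, combined by convexity of the even power; `κ ^
  -- k` converts `T^{-k}` into `n^{-k}`. At `k = 0` the truncated exponent is 0, which is harmless.
  refine ⟨fun k => 2 ^ (2 * k - 1) * (momentConst k * (lamσ * B * lamφ) ^ (2 * k) * A1 ^ (2 * k) +
    A2 ^ (2 * k)) * κ ^ k, ?_⟩
  intro n p T X Y δ hn hT hp h1 h2 hX hY hδ k
  -- One row is singled out, so the estimates are stated with `m` remaining rows.
  obtain ⟨m, rfl⟩ : ∃ m, n = m + 1 := ⟨n - 1, by omega⟩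
  have hT' : (0 : ℝ) < T := by exact_mod_cast hT
  have := isProbabilityMeasure_featLaw hσ hφ X
  have hlaw := isFeatureLaw_featLaw hσ hφ hX hT hp h1 h2
  rw [← hM] at hlaw
  rw [Phi_eq_momentMatrix hσ hφ] at hδ ⊢
  have hb := abs_integral_trainError_sub_le (hK T m _ hlaw) hγ hY hδ
  rw [← hA2] at hb
  have hc : Conc (Measure.pi fun _ : Fin (m + 1) => featLaw σ φ X) (fun R R' => fro (R - R'))
      (fun k => momentConst k * (lamσ * B * lamφ) ^ (2 * k)) := by
    have hc := (continuous_featMap hσ hφ X).measurable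
    rw [pi_featLaw hσ hφ X]
    exact conc_map_pi_gaussian _ (by fun_prop) _ _ (by positivity) (fro_featMap_sub_le hσ hφ hX)
  set ν := Measure.pi fun _ : Fin (m + 1) => featLaw σ φ X
  set F : (Fin (m + 1) → Fin T → ℝ) → ℝ := fun S => trainError γ (Matrix.of S) Y
  set E := trainErrorBar (m + 1) γ (momentMatrix (featLaw σ φ X)) δ Y
  have hL := abs_trainError_sub_le (n := m + 1) hγ hT hY
  rw [← hA1] at hL
  obtain ⟨hmem, hmom⟩ := hc F (A1 * (1 / √T)) (continuous_trainError hγ Y).measurable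
    (by positivity) hL
  have hint : Integrable (fun S => (F S - ∫ S, F S ∂ν) ^ (2 * k)) ν := by
    have h3 : MemLp (fun S => F S - ∫ S, F S ∂ν) (2 * k : ℕ) ν :=
      (hmem _).sub (memLp_const _)
    refine h3.integrable_norm_pow'.congr (Eventually.of_forall fun S => ?_)
    simp only [Real.norm_eq_abs, (even_two_mul k).pow_abs]
  have hpt : ∀ S, (F S - E) ^ (2 * k) ≤
      2 ^ (2 * k - 1) * ((F S - ∫ S, F S ∂ν) ^ (2 * k) + (A2 * (1 / √T)) ^ (2 * k)) := fun S => by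
    have h4 := (even_two_mul k).add_pow_le (a := F S - ∫ S, F S ∂ν) (b := ∫ S, F S ∂ν - E)
    rw [sub_add_sub_cancel] at h4
    refine h4.trans ?_
    have h5 : (∫ S, F S ∂ν - E) ^ (2 * k) ≤ (A2 * (1 / √T)) ^ (2 * k) := by
      rw [← (even_two_mul k).pow_abs]
      exact pow_le_pow_left₀ (abs_nonneg _) hb _
    gcongr
  have hint2 : Integrable (fun S => 2 ^ (2 * k - 1) *
      ((F S - ∫ S, F S ∂ν) ^ (2 * k) + (A2 * (1 / √T)) ^ (2 * k))) ν := (hint.add (integrable_const ((A2 * (1 / √T)) ^ (2 * k)))).const_mul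
    ((2 : ℝ) ^ (2 * k - 1))
  have hle := lintegral_mono (μ := ν) fun S => ENNReal.ofReal_le_ofReal (hpt S)
  refine hle.trans ?_
  rw [← ofReal_integral_eq_lintegral_ofReal hint2 (Eventually.of_forall fun S =>
    (Even.pow_nonneg (even_two_mul k) _).trans (hpt S))]
  refine ENNReal.ofReal_le_ofReal ?_
  rw [integral_const_mul, integral_add hint (integrable_const _), integral_const, probReal_univ,
    one_smul]
  have hpow : (1 / √(T : ℝ)) ^ (2 * k) ≤ κ ^ k / ((m + 1 : ℕ) : ℝ) ^ k := by
    rw [pow_mul, div_pow, Real.sq_sqrt hT'.le, one_pow, ← div_pow]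
    refine pow_le_pow_left₀ (by positivity) ?_ k
    rw [div_le_div_iff₀ hT' (by positivity), one_mul]
    rwa [div_le_iff₀ hT'] at h1
  have hC0 : 0 ≤ momentConst k * (lamσ * B * lamφ) ^ (2 * k) * A1 ^ (2 * k) + A2 ^ (2 * k) := by
    have := (momentConst_pos k).le
    positivity
  have h6 := hmom k
  calc _ ≤ 2 ^ (2 * k - 1) * (momentConst k * (lamσ * B * lamφ) ^ (2 * k) *
        (A1 * (1 / √T)) ^ (2 * k) + (A2 * (1 / √T)) ^ (2 * k)) := by gcongr
    _ = 2 ^ (2 * k - 1) * (momentConst k * (lamσ * B * lamφ) ^ (2 * k) * A1 ^ (2 * k) +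
        A2 ^ (2 * k)) * (1 / √T) ^ (2 * k) := by rw [mul_pow, mul_pow]; ring
    _ ≤ 2 ^ (2 * k - 1) * (momentConst k * (lamσ * B * lamφ) ^ (2 * k) * A1 ^ (2 * k) +
        A2 ^ (2 * k)) * (κ ^ k / ((m + 1 : ℕ) : ℝ) ^ k) :=
      mul_le_mul_of_nonneg_left hpow (by positivity)
    _ = _ := by ring

end Main

/-- Concentration serves here only to make the second moments finite. The bound on `X` is its own
operator norm, so the growth conditions play no role and the result holds for every `n`. -/
theorem posSemidef_Phi {σ φ : ℝ → ℝ} {lamσ lamφ : ℝ≥0} {p T : ℕ} (hσ : LipschitzWith lamσ σ)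
    (hφ : LipschitzWith lamφ φ) (X : Matrix (Fin p) (Fin T) ℝ) : (Phi σ φ X).PosSemidef := by
  have := isProbabilityMeasure_featLaw hσ hφ X
  have hc : Conc (featLaw σ φ X) (fun x y => l2 (x - y)) _ :=
    conc_map_pi_gaussian (featMap σ φ X) (continuous_featMap hσ hφ X).measurable
    (fun x y => l2 (x - y)) _ (mul_nonneg (mul_nonneg lamσ.coe_nonneg (opNorm_nonneg X)) lamφ.coe_nonneg)
    (l2_featMap_sub_le hσ hφ le_rfl)
  rw [Phi_eq_momentMatrix hσ hφ]
  exact posSemidef_momentMatrix (integrable_l2_sq hc.memLp_l2)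

end RandomFeatures

theorem theorem3 {Ω : Type*} [MeasurableSpace Ω] (P : Measure Ω) [IsProbabilityMeasure P]
    (σ φ : ℝ → ℝ) (lamσ lamφ : ℝ≥0) (hσ : LipschitzWith lamσ σ) (hφ : LipschitzWith lamφ φ)
    (γ : ℝ) (hγ : 0 < γ) (d : ℕ) (p T : ℕ → ℕ)
    (X : ∀ n, Matrix (Fin (p n)) (Fin (T n)) ℝ) (Y : ∀ n, Matrix (Fin d) (Fin (T n)) ℝ)
    (hgrowth : RandomFeatures.GrowthRate p T X Y)
    (Wt : ∀ n, Ω → Matrix (Fin n) (Fin (p n)) ℝ)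
    (hlaw : ∀ n i j, HasLaw (fun ω => Wt n ω i j) (gaussianReal 0 1) P)
    (hindep : ∀ n, iIndepFun (fun (ij : Fin n × Fin (p n)) ω => Wt n ω ij.1 ij.2) P) :
    (∀ n ω, RandomFeatures.trainError γ
        (RandomFeatures.features σ ((Wt n ω).map φ) (X n)) (Y n) =
      (γ ^ 2 / (T n : ℝ)) * ((Y n)ᵀ * Y n * RandomFeatures.resolvent γ
        (RandomFeatures.features σ ((Wt n ω).map φ) (X n)) ^ 2).trace) ∧
    (∀ n, ∃! δ : ℝ, RandomFeatures.IsDelta n γ (RandomFeatures.Phi σ φ (X n)) δ) ∧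
    ∀ δ : ℕ → ℝ, (∀ n, RandomFeatures.IsDelta n γ (RandomFeatures.Phi σ φ (X n)) (δ n)) →
      (∀ n, RandomFeatures.Phi σ φ (X n) ≠ 0 → 0 < δ n) ∧
      ∀ ε : ℝ, 0 < ε → ∀ᵐ ω ∂P, Tendsto
        (fun n : ℕ => (n : ℝ) ^ ((1 : ℝ) / 2 - ε) *
          (RandomFeatures.trainError γ
              (RandomFeatures.features σ ((Wt n ω).map φ) (X n)) (Y n) -
            RandomFeatures.trainErrorBar n γ (RandomFeatures.Phi σ φ (X n)) (δ n) (Y n)))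
        atTop (𝓝 0) := by
  have hΦ := fun n => RandomFeatures.posSemidef_Phi hσ hφ (X n)
  refine ⟨fun n ω => RandomFeatures.trainError_eq_trace hγ _ _,
    fun n => RandomFeatures.existsUnique_isDelta hγ (hΦ n) n,
    fun δ hδ => ⟨fun n h0 => (hδ n).pos hγ (hΦ n) h0, fun ε hε => ?_⟩⟩
  obtain ⟨κ, B, A, hκ, hB, hA, hev⟩ := hgrowth.exists_bounds
  obtain ⟨D, hD⟩ := RandomFeatures.exists_moment_trainError_sub_le hσ hφ hγ d hκ hB
  have hmap := fun n => RandomFeatures.map_features hσ hφ (X n) (hlaw n) (hindep n)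
  have hF : ∀ n, Measurable fun S : Fin n → Fin (T n) → ℝ =>
      RandomFeatures.trainError γ (Matrix.of S) (Y n) -
        RandomFeatures.trainErrorBar n γ (RandomFeatures.Phi σ φ (X n)) (δ n) (Y n) := fun n =>
    ((RandomFeatures.continuous_trainError hγ (Y n)).sub continuous_const).measurable
  -- Only the law of the features at each fixed `n` is needed from here on; the moment integral over
  -- `Ω` is transported to that law by `map_features`.
  refine RandomFeatures.ae_tendsto_zero_of_moment_le (D := D)
    (fun n => (hF n).comp_aemeasurable (hmap n).1) ?_ hε
  filter_upwards [hev] with n hn k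
  obtain ⟨h1, h2, h3, h4, h5, h6, h7⟩ := hn
  have h := hD (X n) (Y n) (δ n) h1 h2 h3 h4 h5 h6 h7 (hδ n) k
  rw [← (hmap n).2, lintegral_map' ((hF n).pow_const _).ennreal_ofReal.aemeasurable
    (hmap n).1] at h
  exact h
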